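/- **Setting.** Let $n\ge 1$ bidders have valuations in $[a,b]$, $0\le a<b$. A mechanism $m=(x,p)$ consists of (measurable) $x:[a,b]^n\to[0,1]^n$ and $p:[a,b]^n\to\mathbb R^n$; it is *DSIC* if for all $i$, $\mathbf v\in[a,b]^n$, $\hat v_i\in[a,b]$: $v_ix_i(\mathbf v)-p_i(\mathbf v)\ge 0$, $v_ix_i(\mathbf v)-p_i(\mathbf v)\ge v_ix_i(\hat v_i,\mathbf v_{-i})-p_i(\hat v_i,\mathbf v_{-i})$, and $\sum_i x_i(\mathbf v)\le 1$. Let $\mathcal M_{\rm all}$ be the class of all DSIC mechanisms and $\mathcal F_{\rm iid}$ the class of laws $\mathbf F=F^{\otimes n}$ with $F$ a probability distribution on $[a,b]$. For $\lambda\in(0,1]$ let $R_\lambda(m,\mathbf F)=\mathbb E_{\mathbf v\sim\mathbf F}[\lambda\max_i v_i-\sum_i p_i(\mathbf v)]\in(-\infty,\infty]$. The minimax $\lambda$-regret is $\inf_{m\in\mathcal M_{\rm all}}\sup_{\mathbf F\in\mathcal F_{\rm iid}}R_\lambda(m,\mathbf F)$. A pair $(m^*,\mathbf F^*)\in\mathcal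 M_{\rm all}\times\mathcal F_{\rm iid}$ is a *saddle point* if $R_\lambda(m^*,\mathbf F)\le R_\lambda(m^*,\mathbf F^*)\le R_\lambda(m,\mathbf F^*)$ for all $m\in\mathcal M_{\rm all}$, $\mathbf F\in\mathcal F_{\rm iid}$. The second-price auction $\mathrm{SPA}(r)$ (resp. pooling auction $\mathrm{POOL}(r)$) allocates the item to a uniformly chosen highest bidder if $\max(\mathbf v)\ge r$; if $\max(\mathbf v)<r$ it allocates nothing (resp. allocates to each bidder with probability $1/n$). Payments are $p_i(\mathbf v)=v_ix_i(\mathbf v)-\int_a^{v_i}x_i(t,\mathbf v_{-i})\,dt$. $\mathrm{SPA}(\Phi)$ and $\mathrm{POOL}(\Psi)$ denote the mechanisms with a random reserve $r\sim\Phi$, resp. threshold $r\sim\Psi$ (allocations and payments are averaged over $r$). Distributions $\Phi^*,\Psi^*,\mathcal D,F^*$ on $[a,b]$ are given by their CDFs on $[a,b]$, and $\mathbf F^*=(F^*)^{\otimes n}$. Expressions of the form $0/0$ at the left endpoint of a CDF formula are read as the limit value $0$ of that formula. **Theorem.** Fix $n\ge1$ and $\lambda\in(0,1]$. There is a unique $k_l\in(0,1)$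 with $$\lambda\int_{k_l}^1\frac{(t-k_l)^{n-1}}{t^n}\,dt=(1-k_l)^{n-1}.$$ If $n=1$ put $k_h=1$; if $n\ge2$ there is a unique $k_h\in(0,1)$ with $$\int_{k_h}^1\Big[\frac{(t-k_h)^{n-1}}{t^n}-(1-\lambda)\frac{(t-k_h)^n}{t^{n+1}}\Big]dt=(1-k_h)^n .$$ Moreover $k_l<k_h$, and for all $0\le a<b$ the following holds. 1. Suppose $a/b\le k_l$; let $r^*=k_lb$. Let $\Phi^*(v)=0$ for $v<r^*$ and $\Phi^*(v)=\lambda\frac{v^{n-1}}{(v-r^*)^{n-1}}\int_{r^*}^v\frac{(t-r^*)^{n-1}}{t^n}dt$ for $v\in[r^*,b]$; let $F^*(v)=0$ on $[a,r^*)$, $F^*(v)=1-r^*/v$ on $[r^*,b)$, $F^*(b)=1$. These are CDFs of probability distributions on $[a,b]$, $(\mathrm{SPA}(\Phi^*),\mathbf F^*)$ is a saddle point, and the minimax $\lambda$-regret equals $$-(1-\lambda)b+\Big[(1-k_l)^n-\lambda\int_{k_l}^1\Big(1-\frac{k_l}{t}\Big)^ndt\Big]b .$$ 2. Suppose $a/b\ge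 k_h$ (so $n\ge2$); let $\phi_0=(a-k_hb)/(1-k_h)$ and $k_h'=k_h/(1-k_h)$. Then $\phi_0\in[0,a]$. Let $\Psi^*(v)=\frac{n\lambda}{n-1}\big(\frac{v-\phi_0}{v-a}\big)^n\int_a^v\frac{(t-a)^n}{(t-\phi_0)^{n+1}}dt$ on $[a,b]$; let $F^*(v)=1-\frac{a-\phi_0}{v-\phi_0}$ on $[a,b)$, $F^*(b)=1$. These are CDFs of probability distributions on $[a,b]$, $(\mathrm{POOL}(\Psi^*),\mathbf F^*)$ is a saddle point, and the minimax $\lambda$-regret equals $$-(1-\lambda)b+\Big[(1-k_h)^n+\int_0^1\frac{t^{n-1}\big(nk_h'^2-\lambda t(t+k_h')\big)}{(t+k_h')^{n+1}}dt\Big](b-a).$$ 3. Suppose $k_l\le a/b\le k_h$. The system $$\frac{(v^*-a)^{n-1}}{(v^*)^{n-1}}(1-n\alpha)=\lambda\int_a^{v^*}\frac{(t-a)^{n-1}}{t^n}dt,$$ $$\frac{(b-a)^n}{b^n}-\frac{(v^*-a)^n}{(v^*)^n}\big(1-(n-1)\alpha\big)=\int_{v^*}^b\Big[\frac{(t-a)^{n-1}}{t^n}-(1-\lambda)\frac{(t-a)^n}{t^{n+1}}\Big]dt$$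 has a solution with $v^*\in[a,b]$ and $\alpha\in[0,1/n]$; $v^*$ is unique among all solutions $(v^*,\alpha)\in[a,b]\times\mathbb R$, and so is $\alpha$ if $a/b<k_h$. For $n\ge2$ let $$\mathcal D(v)=\begin{cases}\lambda\big(\frac v{v-a}\big)^{n-1}\int_a^v\frac{(t-a)^{n-1}}{t^n}dt,&v\in[a,v^*],\\[1mm]-\frac1{n-1}+\frac n{n-1}\big(\frac v{v-a}\big)^n\Big[\big(\frac{b-a}b\big)^n-\int_v^b\Big[\frac{(t-a)^{n-1}}{t^n}-(1-\lambda)\frac{(t-a)^n}{t^{n+1}}\Big]dt\Big],&v\in(v^*,b],\end{cases}$$ and for $n=1$ let $\mathcal D(v)=1+\lambda\log(v/b)$ on $[a,b]$. Let $F^*(v)=1-a/v$ on $[a,b)$, $F^*(b)=1$. These are CDFs of probability distributions on $[a,b]$. Let $m^*$ draw $r\sim\mathcal D$ and run $\mathrm{SPA}(r)$ if $r\le v^*$ and $\mathrm{POOL}(r)$ if $r>v^*$. Then $(m^*,\mathbf F^*)$ is a saddle point, and the minimax $\lambda$-regret equals $$-(1-\lambda)b+b\Big(1-\frac ab\Big)^n-\lambda\int_a^b\Big(1-\frac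 at\Big)^ndt .$$ -/

import Mathlib

open MeasureTheory ProbabilityTheory

noncomputable section

namespace RobustAuction

/-- A direct mechanism with `n` bidders: the allocation rule `x` and the payment rule `p`.
Only the values on the box `[a,b]^n` of feasible valuations are ever used. -/
structure Mechanism (n : ℕ) where
  x : (Fin n → ℝ) → Fin n → ℝ
  p : (Fin n → ℝ) → Fin n → ℝ

/-- The feasible valuation vectors `[a,b]^n`. -/
def box (n : ℕ) (a b : ℝ) : Set (Fin n → ℝ) :=
  {v | ∀ i, v i ∈ Set.Icc a b}

/-- The class of all dominant strategy incentive compatible mechanisms on `[a,b]^n`: (measurable)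
allocation probabilities and payments that satisfy individual rationality, incentive compatibility
and the constraint that at most one item is allocated. Payments may have either sign and need not
be bounded below. -/
def dsic (n : ℕ) (a b : ℝ) : Set (Mechanism n) :=
  {m | Measurable m.x ∧ Measurable m.p ∧
    (∀ v ∈ box n a b, ∀ i, m.x v i ∈ Set.Icc (0 : ℝ) 1) ∧
    (∀ v ∈ box n a b, ∀ i, 0 ≤ v i * m.x v i - m.p v i) ∧
    (∀ v ∈ box n a b, ∀ i, ∀ w ∈ Set.Icc a b,
      v i * m.x (Function.update v i w) i - m.p (Function.update v i w) i
        ≤ v i * m.x v i - m.p v i) ∧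
    (∀ v ∈ box n a b, ∑ i, m.x v i ≤ 1)}

/-- The joint laws of `n` i.i.d. valuations whose marginal is supported on `[a,b]`. -/
def iidLaws (n : ℕ) (a b : ℝ) : Set (Measure (Fin n → ℝ)) :=
  {P | ∃ μ : Measure ℝ, IsProbabilityMeasure μ ∧ μ (Set.Icc a b)ᶜ = 0 ∧
    P = Measure.pi (fun _ : Fin n => μ)}

/-- The highest valuation. -/
def vmax {n : ℕ} (v : Fin n → ℝ) : ℝ := ⨆ j, v j

/-- The expectation `E[f] = E[f⁺] - E[f⁻]` with values in the extended reals. -/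
def expectation {Ω : Type*} [MeasurableSpace Ω] (P : Measure Ω) (f : Ω → ℝ) : EReal :=
  ((∫⁻ ω, ENNReal.ofReal (f ω) ∂P : ENNReal) : EReal)
    - ((∫⁻ ω, ENNReal.ofReal (-f ω) ∂P : ENNReal) : EReal)

/-- The `λ`-regret `E[λ max(v) - ∑ i, p_i(v)]`. For a mechanism in `dsic n a b` the integrand is
bounded below on `[a,b]^n`, so this is the usual expectation, with value `⊤` when the expected
payments to the bidders are infinite. -/
def regret {n : ℕ} (lam : ℝ) (m : Mechanism n) (P : Measure (Fin n → ℝ)) : EReal :=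
  expectation P (fun v => lam * vmax v - ∑ i, m.p v i)

/-- The minimax `λ`-regret over all DSIC mechanisms against i.i.d. laws on `[a,b]`. -/
def minimaxRegret (n : ℕ) (lam a b : ℝ) : EReal :=
  ⨅ m ∈ dsic n a b, ⨆ P ∈ iidLaws n a b, regret lam m P

/-- `(m, P)` is a saddle point of the `λ`-regret. -/
def IsSaddlePoint (n : ℕ) (lam a b : ℝ) (m : Mechanism n) (P : Measure (Fin n → ℝ)) : Prop :=
  m ∈ dsic n a b ∧ P ∈ iidLaws n a b ∧
    (∀ Q ∈ iidLaws n a b, regret lam m Q ≤ regret lam m P) ∧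
    (∀ m' ∈ dsic n a b, regret lam m P ≤ regret lam m' P)

/-- The payment rule that Myerson's envelope formula attaches to the allocation rule `x`,
normalised by `p_i(a, v_{-i}) = a x_i(a, v_{-i})`. -/
def envelopePayment {n : ℕ} (a : ℝ) (x : (Fin n → ℝ) → Fin n → ℝ) (v : Fin n → ℝ) (i : Fin n) :
    ℝ :=
  v i * x v i - ∫ t in a..(v i), x (Function.update v i t) i

/-- The item goes to a highest bidder, ties being broken uniformly. -/
def highestShare {n : ℕ} (v : Fin n → ℝ) (i : Fin n) : ℝ :=
  if v i = vmax v then 1 / ((Finset.univ.filter (fun j => v j = vmax v)).card : ℝ) else 0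

/-- The second-price auction with reserve `r`. -/
def spa (n : ℕ) (a r : ℝ) : Mechanism n where
  x := fun v i => if r ≤ vmax v then highestShare v i else 0
  p := envelopePayment a (fun v i => if r ≤ vmax v then highestShare v i else 0)

/-- The pooling auction with threshold `τ`. -/
def pool (n : ℕ) (a τ : ℝ) : Mechanism n where
  x := fun v i => if τ ≤ vmax v then highestShare v i else 1 / (n : ℝ)
  p := envelopePayment a (fun v i => if τ ≤ vmax v then highestShare v i else 1 / (n : ℝ))

/-- The randomised mechanism that draws `r` from `μ` and runs `m r`. -/
def mix {n : ℕ} (μ : Measure ℝ) (m : ℝ → Mechanism n) : Mechanism n where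
  x := fun v i => ∫ r, (m r).x v i ∂μ
  p := fun v i => ∫ r, (m r).p v i ∂μ

/-- `SPA(Φ)`: the second-price auction with a random reserve of law `Φ`. -/
def randomSpa (n : ℕ) (a : ℝ) (Φ : Measure ℝ) : Mechanism n := mix Φ (fun r => spa n a r)

/-- `POOL(Ψ)`: the pooling auction with a random threshold of law `Ψ`. -/
def randomPool (n : ℕ) (a : ℝ) (Ψ : Measure ℝ) : Mechanism n := mix Ψ (fun τ => pool n a τ)

/-- Draw a unified threshold `r` from `D`; run `SPA(r)` if `r ≤ vs` and `POOL(r)` otherwise. -/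
def unified (n : ℕ) (a vs : ℝ) (D : Measure ℝ) : Mechanism n :=
  mix D (fun r => if r ≤ vs then spa n a r else pool n a r)

/-- `μ` is the probability law on `[a,b]` whose cumulative distribution function there is `G`. -/
def IsLawWithCDF (a b : ℝ) (μ : Measure ℝ) (G : ℝ → ℝ) : Prop :=
  IsProbabilityMeasure μ ∧ μ (Set.Icc a b)ᶜ = 0 ∧ ∀ v ∈ Set.Icc a b, cdf μ v = G v

/-- The equation for `k_l`. -/
def IsLowCutoff (n : ℕ) (lam k : ℝ) : Prop :=
  k ∈ Set.Ioo (0 : ℝ) 1 ∧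
    lam * (∫ t in k..1, (t - k) ^ (n - 1) / t ^ n) = (1 - k) ^ (n - 1)

/-- The equation for `k_h`, with `k_h = 1` for a single bidder. -/
def IsHighCutoff (n : ℕ) (lam k : ℝ) : Prop :=
  if n = 1 then k = 1
  else k ∈ Set.Ioo (0 : ℝ) 1 ∧
    (∫ t in k..1, ((t - k) ^ (n - 1) / t ^ n - (1 - lam) * ((t - k) ^ n / t ^ (n + 1))))
      = (1 - k) ^ n

/-! ### Low relative support information -/

/-- The reserve distribution `Φ*`, with `r* = rs`; it puts no mass below `r*`. -/
def lowReserveCDF (n : ℕ) (lam rs v : ℝ) : ℝ :=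
  if v < rs then 0
  else lam * (v ^ (n - 1) / (v - rs) ^ (n - 1)) * ∫ t in rs..v, (t - rs) ^ (n - 1) / t ^ n

/-- The isorevenue distribution on `[r*, b]`, with `r* = rs`. -/
def isorevenueCDF (b rs v : ℝ) : ℝ :=
  if v < rs then 0 else if v < b then 1 - rs / v else 1

def lowValue (n : ℕ) (lam kl b : ℝ) : ℝ :=
  -(1 - lam) * b + ((1 - kl) ^ n - lam * ∫ t in kl..1, (1 - kl / t) ^ n) * b

/-! ### High relative support information -/

/-- The threshold distribution `Ψ*`. -/
def highThresholdCDF (n : ℕ) (lam a φ₀ v : ℝ) : ℝ :=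
  ((n : ℝ) * lam / ((n : ℝ) - 1)) * ((v - φ₀) / (v - a)) ^ n
    * ∫ t in a..v, (t - a) ^ n / (t - φ₀) ^ (n + 1)

/-- The distribution on `[a,b]` with constant virtual value `φ₀` below `b`. -/
def constVirtualCDF (a b φ₀ v : ℝ) : ℝ :=
  if v < b then 1 - (a - φ₀) / (v - φ₀) else 1

/-- The minimax regret, where `kp` is `k_h' = k_h / (1 - k_h)`. -/
def highValue (n : ℕ) (lam kh kp a b : ℝ) : ℝ :=
  -(1 - lam) * b +
    ((1 - kh) ^ n +
      ∫ t in (0 : ℝ)..1,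
        t ^ (n - 1) * ((n : ℝ) * kp ^ 2 - lam * t * (t + kp)) / (t + kp) ^ (n + 1)) * (b - a)

/-! ### Moderate relative support information -/

/-- `(vs, α)` solves the two equations for `(v*, α)`, with `v*` in `[a,b]`. -/
def IsModeratePair (n : ℕ) (lam a b vs α : ℝ) : Prop :=
  vs ∈ Set.Icc a b ∧
  (vs - a) ^ (n - 1) / vs ^ (n - 1) * (1 - (n : ℝ) * α)
    = lam * (∫ t in a..vs, (t - a) ^ (n - 1) / t ^ n) ∧
  (b - a) ^ n / b ^ n - (vs - a) ^ n / vs ^ n * (1 - ((n : ℝ) - 1) * α)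
    = ∫ t in vs..b, ((t - a) ^ (n - 1) / t ^ n - (1 - lam) * ((t - a) ^ n / t ^ (n + 1)))

/-- The distribution `D` of the unified threshold. For a single bidder `POOL` always allocates the
item, exactly as `SPA(a)` does, and `v* = b`; then `D` is the distribution of the posted price. -/
def unifiedCDF (n : ℕ) (lam a b vs v : ℝ) : ℝ :=
  if n = 1 then 1 + lam * Real.log (v / b)
  else if v ≤ vs then
    lam * (v / (v - a)) ^ (n - 1) * ∫ t in a..v, (t - a) ^ (n - 1) / t ^ n
  else
    -(1 / ((n : ℝ) - 1)) + (n : ℝ) / ((n : ℝ) - 1) * (v / (v - a)) ^ n *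
      (((b - a) / b) ^ n -
        ∫ t in v..b, ((t - a) ^ (n - 1) / t ^ n - (1 - lam) * ((t - a) ^ n / t ^ (n + 1))))

def moderateValue (n : ℕ) (lam a b : ℝ) : ℝ :=
  -(1 - lam) * b + b * (1 - a / b) ^ n - lam * ∫ t in a..b, (1 - a / t) ^ n

end RobustAuction

end

/-!
The two players of the zero-sum game are treated separately and meet at a common value.

*Seller.* Against the law `F*` every bidder has a constant virtual value `φ` below `b`, and virtual
value `b` at the atom in `b`. The envelope formula bounds the expected payment of a bidder, given
the valuations of the others, by the expected virtual value of the allocation. At most one item is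
sold and `φ ≥ 0`, so no mechanism collects more than `b (1 - q ^ n) + φ q ^ n`, where `q ^ n` is the
probability that no valuation equals `b`. This gives a lower bound for the regret,
`isoValue_le_regret`; it needs no integrability of the payments.

*Nature.* `SPA(Φ)`, `POOL(Ψ)` and the mixture of the two are all of the form `unified n a vs D`. The
regret of such a mechanism at a profile is a function of the highest valuation plus a sum of
functions of the highest competing valuations. Therefore, by the layer-cake formula, its expectation
under i.i.d. valuations with distribution function `G` is
`-(1 - λ) b + ∫ (n A G ^ (n - 1) - N G ^ n)`, where `A` and `N` do not depend on `G`
(`regret_unified`). Pointwise, the integrand is largest at `G = w` as soon as `N w = (n - 1) A`, by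
the tangent line inequality for `w ↦ w ^ n`, and at `G = 0` where `A = 0` and `N = λ`, which is the
case below the lowest reserve. With `w (t) = (t - c) / (t - φ)`, the distribution function of `F*`,
the condition is a linear differential equation for the distribution function of `D`, one where the
threshold acts as a reserve and one where it acts as a pooling threshold. `IsEqualizer` collects
these equations. Under them the maximum is the same number as the seller's bound, and
`IsEqualizer.isSaddlePoint` follows.

*Solving the equations.* In the variable `w` all integrals become values of
`B_m (q) = ∫₀^q w ^ m / (1 - w) dw` (`betaInt`), and the solutions that stay bounded at the left
endpoint are multiples of `B_m (w) / w ^ m` (`betaRatio`). This ratio increases strictly from `0` to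
`∞` on `[0, 1)`; so the solutions are distribution functions, and the normalisation at `b` is the
equation that defines `k_l` or `k_h`. Between the two cutoffs the reserve solution is used up to
`v*` and the pooling solution above it, the latter with a homogeneous part `κ / w ^ n`, `κ ≤ 0`
(`exists_moderateEqualizer`). Elimination of `α` leaves one equation for `v*`, with a strictly
monotone defect (`pairDefect`) whose signs at `a` and `b` are those given by `k_h` and `k_l`; it
also says that the two solutions agree at `v*`.
-/

noncomputable section

namespace RobustAuction

/-! ### The incomplete beta-type integrals `∫₀^q w^m / (1 - w) dw` -/

/-- The primitive `B_m(q) = ∫₀^q w^m / (1 - w) dw`, used for `q < 1` only. Every integral of the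
theorem becomes a value of some `B_m` after the substitution `w = (t - c) / (t - φ)`. -/
def betaInt (m : ℕ) (q : ℝ) : ℝ := ∫ w in (0 : ℝ)..q, w ^ m / (1 - w)

/-- The normalised primitive `B_m(q) / q^m`; it increases strictly from `0` to `∞` on `[0, 1)`. -/
def betaRatio (m : ℕ) (q : ℝ) : ℝ := betaInt m q / q ^ m

@[simp] lemma betaInt_zero (m : ℕ) : betaInt m 0 = 0 := by simp [betaInt]

@[simp] lemma betaRatio_zero (m : ℕ) : betaRatio m 0 = 0 := by simp [betaRatio]

lemma hasDerivAt_betaInt (m : ℕ) {q : ℝ} (hq : q < 1) :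
    HasDerivAt (betaInt m) (q ^ m / (1 - q)) q := by
  have hcont : ContinuousOn (fun w : ℝ => w ^ m / (1 - w)) (Set.Iio 1) := by
    apply ContinuousOn.div (by fun_prop) (by fun_prop)
    intro x hx
    have : x < 1 := hx
    linarith
  apply intervalIntegral.integral_hasDerivAt_right
  · apply ContinuousOn.intervalIntegrable
    apply hcont.mono
    intro x hx
    rw [Set.mem_uIcc] at hx
    rcases hx with h | h
    · exact lt_of_le_of_lt h.2 hq
    · exact lt_of_le_of_lt h.2 one_pos
  · exact hcont.stronglyMeasurableAtFilter isOpen_Iio q hq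
  · exact hcont.continuousAt (Iio_mem_nhds hq)

lemma continuousOn_betaInt (m : ℕ) : ContinuousOn (betaInt m) (Set.Iio 1) := fun _ hx =>
  (hasDerivAt_betaInt m hx).continuousAt.continuousWithinAt

lemma betaInt_strictMonoOn (m : ℕ) : StrictMonoOn (betaInt m) (Set.Ico 0 1) := by
  apply strictMonoOn_of_deriv_pos (convex_Ico 0 1)
    ((continuousOn_betaInt m).mono fun x hx => hx.2)
  intro x hx
  rw [interior_Ico] at hx
  rw [(hasDerivAt_betaInt m hx.2).deriv]
  exact div_pos (pow_pos hx.1 m) (by linarith [hx.2])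

lemma betaInt_nonneg (m : ℕ) {q : ℝ} (h0 : 0 ≤ q) (h1 : q < 1) : 0 ≤ betaInt m q := by
  have := (betaInt_strictMonoOn m).monotoneOn ⟨le_rfl, one_pos⟩ ⟨h0, h1⟩ h0
  simpa using this

lemma betaInt_sub_betaInt_succ (m : ℕ) {q : ℝ} (h0 : 0 ≤ q) (h1 : q < 1) :
    betaInt m q - betaInt (m + 1) q = q ^ (m + 1) / (m + 1) := by
  have hc : ∀ k : ℕ, IntervalIntegrable (fun w : ℝ => w ^ k / (1 - w)) volume 0 q := by
    intro k
    apply ContinuousOn.intervalIntegrable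
    apply ContinuousOn.div (by fun_prop) (by fun_prop)
    intro x hx
    rw [Set.uIcc_of_le h0] at hx
    linarith [hx.2]
  unfold betaInt
  rw [← intervalIntegral.integral_sub (hc m) (hc (m + 1))]
  have : ∫ w in (0 : ℝ)..q, (w ^ m / (1 - w) - w ^ (m + 1) / (1 - w))
      = ∫ w in (0 : ℝ)..q, w ^ m := by
    apply intervalIntegral.integral_congr
    intro x hx
    rw [Set.uIcc_of_le h0] at hx
    have : 1 - x ≠ 0 := by linarith [hx.2]
    simp only
    field_simp
    ring
  rw [this, integral_pow]
  simp

lemma betaInt_zero_eq {q : ℝ} (h0 : 0 ≤ q) (h1 : q < 1) : betaInt 0 q = -Real.log (1 - q) := by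
  have := intervalIntegral.integral_eq_sub_of_hasDerivAt_of_le h0
    (f := fun x => -Real.log (1 - x)) (f' := fun w => w ^ 0 / (1 - w)) ?_ ?_ ?_
  · simpa [betaInt] using this
  · apply ContinuousOn.neg
    apply ContinuousOn.log (by fun_prop)
    intro x hx
    linarith [hx.2]
  · intro x hx
    have hx1 : 1 - x ≠ 0 := by linarith [hx.2]
    have := (((hasDerivAt_id x).const_sub 1).log hx1).neg
    refine this.congr_deriv ?_
    simp only [pow_zero, id]
    field_simp
  · apply ContinuousOn.intervalIntegrable
    apply ContinuousOn.div (by fun_prop) (by fun_prop)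
    intro x hx
    rw [Set.uIcc_of_le h0] at hx
    linarith [hx.2]

/-- The difference of the two sides vanishes at `0` and has derivative `q^m / (1 - q)^2`. -/
lemma mul_betaInt_lt (m : ℕ) {q : ℝ} (h0 : 0 < q) (h1 : q < 1) :
    m * betaInt m q < q ^ (m + 1) / (1 - q) := by
  have hd : ∀ x : ℝ, x < 1 → HasDerivAt (fun x : ℝ => x ^ (m + 1) / (1 - x) - m * betaInt m x)
      (x ^ m / (1 - x) ^ 2) x := by
    intro x hx
    have hx1 : 1 - x ≠ 0 := by linarith
    have := ((hasDerivAt_pow (m + 1) x).div ((hasDerivAt_id x).const_sub 1) hx1).sub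
      ((hasDerivAt_betaInt m hx).const_mul (m : ℝ))
    refine this.congr_deriv ?_
    push_cast
    simp only [id]
    field_simp
    ring
  have hmono : StrictMonoOn (fun x : ℝ => x ^ (m + 1) / (1 - x) - m * betaInt m x)
      (Set.Ico 0 1) := by
    apply strictMonoOn_of_deriv_pos (convex_Ico 0 1)
      (fun x hx => (hd x hx.2).continuousAt.continuousWithinAt)
    intro x hx
    rw [interior_Ico] at hx
    rw [(hd x hx.2).deriv]
    have : 0 < 1 - x := by linarith [hx.2]
    have := hx.1
    positivity
  have := hmono ⟨le_rfl, one_pos⟩ ⟨h0.le, h1⟩ h0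
  simp at this
  linarith

lemma hasDerivAt_betaRatio (m : ℕ) {q : ℝ} (h0 : 0 < q) (h1 : q < 1) :
    HasDerivAt (betaRatio m) ((q ^ (m + 1) / (1 - q) - m * betaInt m q) / q ^ (m + 1)) q := by
  have hq : q ^ m ≠ 0 := by positivity
  have h1' : 1 - q ≠ 0 := by linarith
  have := (hasDerivAt_betaInt m h1).div (hasDerivAt_pow m q) hq
  refine this.congr_deriv ?_
  rcases m with _ | m
  · field_simp
    simp
  · simp only [Nat.add_sub_cancel]
    push_cast
    field_simp
    ring

lemma betaInt_le_pow_mul (m : ℕ) {q : ℝ} (h0 : 0 ≤ q) (h1 : q < 1) :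
    betaInt m q ≤ q ^ m * (q / (1 - q)) := by
  have := intervalIntegral.integral_mono_on (μ := volume) (a := 0) (b := q)
    (f := fun w => w ^ m / (1 - w)) (g := fun _ => q ^ m / (1 - q)) h0 ?_ (by simp) ?_
  · unfold betaInt
    refine this.trans (le_of_eq ?_)
    simp
    ring
  · apply ContinuousOn.intervalIntegrable
    apply ContinuousOn.div (by fun_prop) (by fun_prop)
    intro x hx
    rw [Set.uIcc_of_le h0] at hx
    linarith [hx.2]
  · intro x hx
    have h2 : 0 < 1 - q := by linarith
    have := hx.1
    have h3 := pow_le_pow_left₀ hx.1 hx.2 m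
    exact div_le_div₀ (by positivity) h3 h2 (by linarith [hx.2])

lemma betaRatio_nonneg (m : ℕ) {q : ℝ} (h0 : 0 ≤ q) (h1 : q < 1) : 0 ≤ betaRatio m q :=
  div_nonneg (betaInt_nonneg m h0 h1) (by positivity)

lemma betaRatio_le (m : ℕ) {q : ℝ} (h0 : 0 ≤ q) (h1 : q < 1) : betaRatio m q ≤ q / (1 - q) := by
  rcases h0.eq_or_lt with rfl | h
  · simp
  · rw [betaRatio, div_le_iff₀ (by positivity), mul_comm]
    exact betaInt_le_pow_mul m h0 h1

lemma continuousOn_betaRatio (m : ℕ) : ContinuousOn (betaRatio m) (Set.Ico 0 1) := by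
  intro x hx
  rcases hx.1.eq_or_lt with rfl | h
  · unfold ContinuousWithinAt
    rw [betaRatio_zero]
    apply tendsto_of_tendsto_of_tendsto_of_le_of_le' (g := fun _ => (0 : ℝ))
      (h := fun q : ℝ => q / (1 - q)) tendsto_const_nhds
    · have : ContinuousAt (fun q : ℝ => q / (1 - q)) 0 :=
        ContinuousAt.div (by fun_prop) (by fun_prop) (by norm_num)
      simpa using this.tendsto.mono_left nhdsWithin_le_nhds
    · filter_upwards [self_mem_nhdsWithin] with q hq using betaRatio_nonneg m hq.1 hq.2
    · filter_upwards [self_mem_nhdsWithin] with q hq using betaRatio_le m hq.1 hq.2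
  · exact (hasDerivAt_betaRatio m h hx.2).continuousAt.continuousWithinAt

lemma betaRatio_strictMonoOn (m : ℕ) : StrictMonoOn (betaRatio m) (Set.Ico 0 1) := by
  apply strictMonoOn_of_deriv_pos (convex_Ico 0 1) (continuousOn_betaRatio m)
  intro x hx
  rw [interior_Ico] at hx
  rw [(hasDerivAt_betaRatio m hx.1 hx.2).deriv]
  have := hx.1
  exact div_pos (by linarith [mul_betaInt_lt m hx.1 hx.2]) (by positivity)

lemma neg_log_sub_le_betaInt (m : ℕ) {q : ℝ} (h0 : 0 ≤ q) (h1 : q < 1) :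
    -Real.log (1 - q) - m ≤ betaInt m q := by
  induction m with
  | zero => simp [betaInt_zero_eq h0 h1]
  | succ m ih =>
    have h := betaInt_sub_betaInt_succ m h0 h1
    have h2 : q ^ (m + 1) / ((m : ℝ) + 1) ≤ 1 := by
      rw [div_le_one (by positivity)]
      have := pow_le_one₀ (n := m + 1) h0 h1.le
      have : (0 : ℝ) ≤ m := by positivity
      linarith
    push_cast
    linarith

/-- The ratio takes every positive value exactly once, because it is unbounded near `1`. -/
lemma exists_betaRatio_eq (m : ℕ) {y : ℝ} (hy : 0 < y) :
    ∃ q ∈ Set.Ioo (0 : ℝ) 1, betaRatio m q = y := by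
  set q₁ : ℝ := 1 - Real.exp (-(m + y)) with hq₁
  have he : 0 < Real.exp (-((m : ℝ) + y)) := Real.exp_pos _
  have hm : (0 : ℝ) ≤ m := by positivity
  have he1 : Real.exp (-((m : ℝ) + y)) < 1 := by
    rw [Real.exp_lt_one_iff]
    linarith
  have hq0 : 0 < q₁ := by linarith
  have hq1 : q₁ < 1 := by linarith
  have hbig : y ≤ betaRatio m q₁ := by
    have h1 := neg_log_sub_le_betaInt m hq0.le hq1
    have h2 : 1 - q₁ = Real.exp (-(m + y)) := by rw [hq₁]; ring
    rw [h2, Real.log_exp] at h1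
    have h3 := pow_le_one₀ (n := m) hq0.le hq1.le
    rw [betaRatio, le_div_iff₀ (by positivity)]
    nlinarith
  have hc : ContinuousOn (betaRatio m) (Set.Icc 0 q₁) :=
    (continuousOn_betaRatio m).mono fun x hx => ⟨hx.1, lt_of_le_of_lt hx.2 hq1⟩
  obtain ⟨q, hq, hqy⟩ := intermediate_value_Icc hq0.le hc (⟨by simpa using hy.le, hbig⟩ :
    y ∈ Set.Icc (betaRatio m 0) (betaRatio m q₁))
  refine ⟨q, ⟨lt_of_le_of_ne hq.1 ?_, lt_of_le_of_lt hq.2 hq1⟩, hqy⟩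
  rintro rfl
  simp at hqy
  linarith

/-! ### The substitution `w = (t - c) / (t - φ)` -/

lemma hasDerivAt_ratio {c φ t : ℝ} (h : t - φ ≠ 0) :
    HasDerivAt (fun t => (t - c) / (t - φ)) ((c - φ) / (t - φ) ^ 2) t := by
  have := ((hasDerivAt_id t).sub_const c).div ((hasDerivAt_id t).sub_const φ) h
  refine this.congr_deriv ?_
  simp only [id]
  field_simp
  ring

lemma ratio_mem_Ico {c φ t : ℝ} (hφ : φ < c) (h : c ≤ t) :
    (t - c) / (t - φ) ∈ Set.Ico (0 : ℝ) 1 :=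
  ⟨div_nonneg (by linarith) (by linarith), by rw [div_lt_one (by linarith)]; linarith⟩

lemma one_sub_ratio {c φ t : ℝ} (h : t - φ ≠ 0) : 1 - (t - c) / (t - φ) = (c - φ) / (t - φ) := by
  field_simp
  ring

lemma continuousOn_ratio {c φ : ℝ} (hφ : φ < c) :
    ContinuousOn (fun t => (t - c) / (t - φ)) (Set.Ici c) := by
  apply ContinuousOn.div (by fun_prop) (by fun_prop)
  intro x hx
  have : c ≤ x := hx
  linarith

lemma hasDerivAt_betaInt_ratio (m : ℕ) {c φ t : ℝ} (hφ : φ < c) (h : φ < t) :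
    HasDerivAt (fun t => betaInt m ((t - c) / (t - φ))) ((t - c) ^ m / (t - φ) ^ (m + 1)) t := by
  have ht : t - φ ≠ 0 := by linarith
  have hc : c - φ ≠ 0 := by linarith
  have hlt : (t - c) / (t - φ) < 1 := by
    rw [div_lt_one (by linarith)]
    linarith
  have := (hasDerivAt_betaInt m hlt).comp t (hasDerivAt_ratio (c := c) ht)
  refine this.congr_deriv ?_
  rw [one_sub_ratio ht, div_pow]
  field_simp
  ring

lemma continuousOn_ratio_integrand (m : ℕ) {c φ : ℝ} (hφ : φ < c) :
    ContinuousOn (fun t : ℝ => (t - c) ^ m / (t - φ) ^ (m + 1)) (Set.Ici c) := by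
  apply ContinuousOn.div (by fun_prop) (by fun_prop)
  intro x hx
  have : c ≤ x := hx
  have : 0 < x - φ := by linarith
  positivity

lemma integral_ratio_eq (m : ℕ) {c φ u v : ℝ} (hφ : φ < c) (hu : c ≤ u) (huv : u ≤ v) :
    ∫ t in u..v, (t - c) ^ m / (t - φ) ^ (m + 1)
      = betaInt m ((v - c) / (v - φ)) - betaInt m ((u - c) / (u - φ)) := by
  apply intervalIntegral.integral_eq_sub_of_hasDerivAt_of_le
    (f := fun t => betaInt m ((t - c) / (t - φ))) huv
  · intro x hx
    exact (hasDerivAt_betaInt_ratio m hφ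
      (by linarith [hx.1])).continuousAt.continuousWithinAt
  · intro x hx
    exact hasDerivAt_betaInt_ratio m hφ (by linarith [hx.1])
  · apply ContinuousOn.intervalIntegrable
    apply (continuousOn_ratio_integrand m hφ).mono
    rw [Set.uIcc_of_le huv]
    intro x hx
    exact hu.trans hx.1

/-- The case `φ = 0` of `integral_ratio_eq`. -/
lemma integral_ratio_zero_eq (m : ℕ) {c u v : ℝ} (hc : 0 < c) (hu : c ≤ u) (huv : u ≤ v) :
    ∫ t in u..v, (t - c) ^ m / t ^ (m + 1)
      = betaInt m ((v - c) / v) - betaInt m ((u - c) / u) := by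
  simpa using integral_ratio_eq m hc hu huv

/-- The integrand of the equations for `k_h` and `v*`. -/
lemma integral_pooling_integrand (m : ℕ) (lam : ℝ) {c u v : ℝ} (hc : 0 < c) (hu : c ≤ u)
    (huv : u ≤ v) :
    ∫ t in u..v, ((t - c) ^ m / t ^ (m + 1) - (1 - lam) * ((t - c) ^ (m + 1) / t ^ (m + 1 + 1)))
      = (((v - c) / v) ^ (m + 1) - ((u - c) / u) ^ (m + 1)) / (m + 1)
        + lam * (betaInt (m + 1) ((v - c) / v) - betaInt (m + 1) ((u - c) / u)) := by
  have hi : ∀ k : ℕ, IntervalIntegrable (fun t : ℝ => (t - c) ^ k / t ^ (k + 1)) volume u v := by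
    intro k
    apply ContinuousOn.intervalIntegrable
    rw [Set.uIcc_of_le huv]
    have h := (continuousOn_ratio_integrand k hc).mono (Set.Icc_subset_Ici_self.trans
      (Set.Ici_subset_Ici.2 hu) : Set.Icc u v ⊆ Set.Ici c)
    simpa using h
  rw [intervalIntegral.integral_sub (hi m) ((hi (m + 1)).const_mul _),
    intervalIntegral.integral_const_mul, integral_ratio_zero_eq m hc hu huv,
    integral_ratio_zero_eq (m + 1) hc hu huv]
  have hw : ∀ t, c ≤ t → (t - c) / t ∈ Set.Ico (0 : ℝ) 1 := fun t ht => by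
    simpa using ratio_mem_Ico hc ht
  have h1 := betaInt_sub_betaInt_succ m (hw u hu).1 (hw u hu).2
  have h2 := betaInt_sub_betaInt_succ m (hw v (hu.trans huv)).1 (hw v (hu.trans huv)).2
  rw [sub_div (((v - c) / v) ^ (m + 1))]
  linarith

/-! ### The cutoffs `k_l` and `k_h` -/

lemma isLowCutoff_iff (m : ℕ) {lam k : ℝ} (hk : k ∈ Set.Ioo (0 : ℝ) 1) :
    IsLowCutoff (m + 1) lam k ↔ lam * betaRatio m (1 - k) = 1 := by
  have h := integral_ratio_zero_eq m hk.1 le_rfl hk.2.le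
  have hq : 0 < (1 - k) ^ m := by
    have := hk.2
    have : 0 < 1 - k := by linarith
    positivity
  simp only [IsLowCutoff, Nat.add_sub_cancel, hk, true_and]
  rw [h, betaRatio, ← mul_div_assoc, div_eq_one_iff_eq hq.ne']
  simp

lemma isHighCutoff_iff (m : ℕ) (hm : m ≠ 0) {lam k : ℝ} (hk : k ∈ Set.Ioo (0 : ℝ) 1) :
    IsHighCutoff (m + 1) lam k ↔ lam * betaRatio (m + 1) (1 - k) = m / (m + 1) := by
  have h := integral_pooling_integrand m lam hk.1 le_rfl hk.2.le
  have hq : 0 < (1 - k) ^ (m + 1) := by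
    have := hk.2
    have : 0 < 1 - k := by linarith
    positivity
  have hm1 : m + 1 ≠ 1 := by omega
  have hm2 : (0 : ℝ) < m + 1 := by positivity
  rw [IsHighCutoff, if_neg hm1]
  simp only [Nat.add_sub_cancel, hk, true_and]
  rw [h, betaRatio, ← mul_div_assoc, div_eq_div_iff hq.ne' hm2.ne']
  simp only [div_one, sub_self, zero_div, ne_eq, Nat.succ_ne_zero, not_false_eq_true, zero_pow,
    sub_zero, betaInt_zero]
  field_simp
  constructor <;> intro h <;> linarith

lemma exists_lowCutoff (m : ℕ) {lam : ℝ} (hlam : 0 < lam) :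
    ∃ kl, IsLowCutoff (m + 1) lam kl ∧ ∀ k, IsLowCutoff (m + 1) lam k → k = kl := by
  obtain ⟨q, hq, hqe⟩ := exists_betaRatio_eq m (y := 1 / lam) (by positivity)
  have hk : 1 - q ∈ Set.Ioo (0 : ℝ) 1 := ⟨by linarith [hq.2], by linarith [hq.1]⟩
  refine ⟨1 - q, (isLowCutoff_iff m hk).2 ?_, fun k h => ?_⟩
  · rw [sub_sub_cancel, hqe]
    field_simp
  · have h1 := (isLowCutoff_iff m h.1).1 h
    have h2 : betaRatio m (1 - k) = betaRatio m q := by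
      rw [hqe]
      field_simp
      linarith
    have := (betaRatio_strictMonoOn m).injOn ⟨by linarith [h.1.2], by linarith [h.1.1]⟩
      ⟨hq.1.le, hq.2⟩ h2
    linarith

lemma exists_highCutoff (m : ℕ) {lam : ℝ} (hlam : 0 < lam) :
    ∃ kh, IsHighCutoff (m + 1) lam kh ∧ ∀ k, IsHighCutoff (m + 1) lam k → k = kh := by
  rcases eq_or_ne m 0 with rfl | hm
  · exact ⟨1, by simp [IsHighCutoff], fun k hk => by simpa [IsHighCutoff] using hk⟩
  have hm' : (0 : ℝ) < m := by positivity
  obtain ⟨q, hq, hqe⟩ := exists_betaRatio_eq (m + 1) (y := m / (m + 1) / lam) (by positivity)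
  have hk : 1 - q ∈ Set.Ioo (0 : ℝ) 1 := ⟨by linarith [hq.2], by linarith [hq.1]⟩
  refine ⟨1 - q, (isHighCutoff_iff m hm hk).2 ?_, fun k h => ?_⟩
  · rw [sub_sub_cancel, hqe]
    field_simp
  · have hk' : k ∈ Set.Ioo (0 : ℝ) 1 := by
      rw [IsHighCutoff, if_neg (by omega)] at h
      exact h.1
    have h1 := (isHighCutoff_iff m hm hk').1 h
    have h2 : betaRatio (m + 1) (1 - k) = betaRatio (m + 1) q := by
      rw [hqe, ← h1]
      field_simp
    have := (betaRatio_strictMonoOn (m + 1)).injOn ⟨by linarith [hk'.2], by linarith [hk'.1]⟩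
      ⟨hq.1.le, hq.2⟩ h2
    linarith

lemma betaRatio_eq_succ (m : ℕ) {q : ℝ} (h0 : 0 < q) (h1 : q < 1) :
    betaRatio m q = q * betaRatio (m + 1) q + q / (m + 1) := by
  have h := betaInt_sub_betaInt_succ m h0.le h1
  have hm : (0 : ℝ) < m + 1 := by positivity
  rw [betaRatio, betaRatio, show betaInt m q = betaInt (m + 1) q + q ^ (m + 1) / (m + 1) by
    linarith]
  field_simp
  ring

lemma IsHighCutoff.mem_Ioo {m : ℕ} (hm : m ≠ 0) {lam k : ℝ} (h : IsHighCutoff (m + 1) lam k) :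
    k ∈ Set.Ioo (0 : ℝ) 1 := by
  rw [IsHighCutoff, if_neg (by omega)] at h
  exact h.1

lemma lowCutoff_lt_highCutoff (m : ℕ) {lam kl kh : ℝ} (hlam : 0 < lam) (hlam1 : lam ≤ 1)
    (hl : IsLowCutoff (m + 1) lam kl) (hh : IsHighCutoff (m + 1) lam kh) : kl < kh := by
  rcases eq_or_ne m 0 with rfl | hm
  · have : kh = 1 := by simpa [IsHighCutoff] using hh
    rw [this]
    exact hl.1.2
  have hk := hh.mem_Ioo hm
  have h1 := (isLowCutoff_iff m hl.1).1 hl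
  have h2 := (isHighCutoff_iff m hm hk).1 hh
  have hq0 : 0 < 1 - kh := by linarith [hk.2]
  have hq1 : 1 - kh < 1 := by linarith [hk.1]
  have h3 := betaRatio_eq_succ m hq0 hq1
  have hm2 : (0 : ℝ) < m + 1 := by positivity
  -- At `q = 1 - k_h`, `λ B_m(q) / q^m = q (m + λ) / (m + 1) ≤ q < 1`.
  have h4 : lam * betaRatio m (1 - kh) < 1 := by
    rw [h3, mul_add, mul_left_comm, h2]
    have h5 : (1 - kh) * ((m : ℝ) / (m + 1)) + lam * ((1 - kh) / (m + 1))
        = (1 - kh) * ((m + lam) / (m + 1)) := by ring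
    have h6 : (m + lam) / ((m : ℝ) + 1) ≤ 1 := by
      rw [div_le_one hm2]
      linarith
    rw [h5]
    nlinarith
  by_contra hcon
  have hcon : kh ≤ kl := not_lt.1 hcon
  have := (betaRatio_strictMonoOn m).monotoneOn (a := 1 - kl) (b := 1 - kh)
    ⟨by linarith [hl.1.2], by linarith [hl.1.1]⟩ ⟨hq0.le, hq1⟩ (by linarith)
  nlinarith

/-! ### The pair `(v*, α)` -/

/-- The difference of the two sides of the equation that remains for `v*`, as a function of
`w = 1 - a / v*`, once `α` is eliminated. -/
def pairDefect (m : ℕ) (lam q w : ℝ) : ℝ :=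
  m * lam * (w * betaInt m w) + (m + 1) * lam * (betaInt (m + 1) q - betaInt (m + 1) w)
    - m * q ^ (m + 1)

lemma hasDerivAt_pairDefect (m : ℕ) (lam q : ℝ) {w : ℝ} (hw : w < 1) :
    HasDerivAt (pairDefect m lam q) (lam * (m * betaInt m w - w ^ (m + 1) / (1 - w))) w := by
  have h1 : 1 - w ≠ 0 := by linarith
  have := ((((hasDerivAt_id w).mul (hasDerivAt_betaInt m hw)).const_mul (m * lam)).add
    (((hasDerivAt_betaInt (m + 1) hw).const_sub (betaInt (m + 1) q)).const_mul
      ((m + 1) * lam))).sub_const (m * q ^ (m + 1))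
  refine this.congr_deriv ?_
  simp only [id]
  field_simp
  ring

lemma pairDefect_strictAntiOn (m : ℕ) {lam : ℝ} (hlam : 0 < lam) (q : ℝ) :
    StrictAntiOn (pairDefect m lam q) (Set.Ico 0 1) := by
  apply strictAntiOn_of_deriv_neg (convex_Ico 0 1)
    (fun x hx => (hasDerivAt_pairDefect m lam q hx.2).continuousAt.continuousWithinAt)
  intro x hx
  rw [interior_Ico] at hx
  rw [(hasDerivAt_pairDefect m lam q hx.2).deriv]
  have := mul_betaInt_lt m hx.1 hx.2
  nlinarith

lemma isModeratePair_iff (m : ℕ) {lam a b vs α : ℝ} (ha : 0 < a) (hvs : vs ∈ Set.Icc a b) :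
    IsModeratePair (m + 1) lam a b vs α ↔
      ((vs - a) / vs) ^ m * (1 - (m + 1) * α) = lam * betaInt m ((vs - a) / vs) ∧
      pairDefect m lam ((b - a) / b) ((vs - a) / vs) = 0 := by
  have h1 := integral_ratio_zero_eq m ha le_rfl hvs.1
  have h2 := integral_pooling_integrand m lam ha hvs.1 hvs.2
  have hm2 : (0 : ℝ) < m + 1 := by positivity
  simp only [IsModeratePair, Nat.add_sub_cancel, hvs, true_and]
  rw [h1, h2, ← div_pow, ← div_pow, ← div_pow]
  simp only [sub_self, zero_div, betaInt_zero, sub_zero]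
  push_cast
  generalize (vs - a) / vs = w
  generalize (b - a) / b = q
  apply and_congr_right
  intro h
  have h3 : w ^ (m + 1) * (1 - (m + 1) * α) = lam * (w * betaInt m w) := by
    rw [pow_succ, mul_right_comm, h]
    ring
  have hkey : pairDefect m lam q w = -((m + 1) * ((q ^ (m + 1)
      - w ^ (m + 1) * (1 - (m + 1 - 1) * α))
      - ((q ^ (m + 1) - w ^ (m + 1)) / (m + 1)
        + lam * (betaInt (m + 1) q - betaInt (m + 1) w)))) := by
    unfold pairDefect
    rw [mul_assoc (m : ℝ) lam, ← h3]
    field_simp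
    ring
  rw [hkey, neg_eq_zero, mul_eq_zero, or_iff_right hm2.ne', sub_eq_zero]

/-- The relative width `q = 1 - a / b` of the support. -/
lemma relativeWidth {a b : ℝ} (ha : 0 < a) (hab : a < b) :
    (b - a) / b = 1 - a / b ∧ 0 < (b - a) / b ∧ (b - a) / b < 1 := by
  have hb : 0 < b := ha.trans hab
  have h : (b - a) / b = 1 - a / b := by
    rw [sub_div, div_self hb.ne']
  have : 0 < a / b := by positivity
  exact ⟨h, div_pos (by linarith) hb, by linarith⟩

lemma IsLowCutoff.mul_betaRatio_le_one {m : ℕ} {lam kl a b : ℝ} (hl : IsLowCutoff (m + 1) lam kl)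
    (hlam : 0 < lam) (ha : 0 < a) (hab : a < b) (h1 : kl ≤ a / b) :
    lam * betaRatio m ((b - a) / b) ≤ 1 := by
  obtain ⟨hqk, hq0, hq1⟩ := relativeWidth ha hab
  have h := (isLowCutoff_iff m hl.1).1 hl
  have := (betaRatio_strictMonoOn m).monotoneOn (a := (b - a) / b) (b := 1 - kl) ⟨hq0.le, hq1⟩
    ⟨by linarith [hl.1.2], by linarith [hl.1.1]⟩ (by linarith)
  nlinarith

/-- At `v* = a` the remaining equation has the sign that the definition of `k_h` prescribes. -/
lemma IsHighCutoff.pairDefect_zero {m : ℕ} {lam kh a b : ℝ} (hh : IsHighCutoff (m + 1) lam kh)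
    (hlam : 0 < lam) (ha : 0 < a) (hab : a < b) (h2 : a / b ≤ kh) :
    0 ≤ pairDefect m lam ((b - a) / b) 0 ∧
      (pairDefect m lam ((b - a) / b) 0 = 0 → kh ≤ a / b) := by
  obtain ⟨hqk, hq0, hq1⟩ := relativeWidth ha hab
  set q := (b - a) / b with hq
  have hm2 : (0 : ℝ) < m + 1 := by positivity
  have hzero : pairDefect m lam q 0
      = (m + 1) * q ^ (m + 1) * (lam * betaRatio (m + 1) q - m / (m + 1)) := by
    unfold pairDefect betaRatio
    simp only [betaInt_zero, mul_zero]
    field_simp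
    ring
  rcases eq_or_ne m 0 with rfl | hm
  · have hB : 0 < betaRatio (0 + 1) q := by
      have := betaRatio_strictMonoOn (0 + 1) ⟨le_rfl, one_pos⟩ ⟨hq0.le, hq1⟩ hq0
      simpa using this
    rw [hzero]
    simp only [Nat.cast_zero, zero_div, sub_zero]
    have : 0 < (0 + 1) * q ^ (0 + 1) * (lam * betaRatio (0 + 1) q) := by positivity
    exact ⟨this.le, fun h => absurd h this.ne'⟩
  · have hk := hh.mem_Ioo hm
    have h := (isHighCutoff_iff m hm hk).1 hh
    have hmono := betaRatio_strictMonoOn (m + 1)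
    rw [hzero, ← h]
    constructor
    · have := hmono.monotoneOn (a := 1 - kh) (b := q)
        ⟨by linarith [hk.2], by linarith [hk.1]⟩ ⟨hq0.le, hq1⟩ (by linarith)
      apply mul_nonneg (by positivity)
      nlinarith
    · intro h0
      have h4 : lam * (betaRatio (m + 1) q - betaRatio (m + 1) (1 - kh)) = 0 := by
        rcases mul_eq_zero.1 h0 with h5 | h5
        · have : 0 < ((m : ℝ) + 1) * q ^ (m + 1) := by positivity
          linarith
        · linarith
      have h5 : betaRatio (m + 1) q = betaRatio (m + 1) (1 - kh) := by
        rcases mul_eq_zero.1 h4 with h6 | h6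
        · linarith
        · linarith
      have := hmono.injOn ⟨hq0.le, hq1⟩ ⟨by linarith [hk.2], by linarith [hk.1]⟩ h5
      linarith

lemma exists_moderatePair (m : ℕ) {lam kl kh a b : ℝ} (hlam : 0 < lam)
    (hl : IsLowCutoff (m + 1) lam kl) (hh : IsHighCutoff (m + 1) lam kh) (hab : a < b)
    (ha : 0 < a) (h1 : kl ≤ a / b) (h2 : a / b ≤ kh) :
    ∃ vs α : ℝ, IsModeratePair (m + 1) lam a b vs α ∧ α ∈ Set.Icc 0 (1 / ((m : ℝ) + 1)) ∧
      (∀ vs' α', IsModeratePair (m + 1) lam a b vs' α' → vs' = vs ∧ (a / b < kh → α' = α)) ∧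
      pairDefect m lam ((b - a) / b) ((vs - a) / vs) = 0 := by
  have hb : 0 < b := ha.trans hab
  obtain ⟨hqk, hq0, hq1⟩ := relativeWidth ha hab
  have hm2 : (0 : ℝ) < m + 1 := by positivity
  have hm0 : (0 : ℝ) ≤ m := by positivity
  have hratio := hl.mul_betaRatio_le_one hlam ha hab h1
  have hT0 := hh.pairDefect_zero hlam ha hab h2
  set q := (b - a) / b with hq
  have hT1 : pairDefect m lam q q ≤ 0 := by
    have : lam * betaInt m q ≤ q ^ m := by
      rw [betaRatio, ← mul_div_assoc, div_le_one (by positivity)] at hratio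
      exact hratio
    have h3 : pairDefect m lam q q = m * q * (lam * betaInt m q - q ^ m) := by
      unfold pairDefect
      ring
    rw [h3]
    exact mul_nonpos_of_nonneg_of_nonpos (by positivity) (by linarith)
  obtain ⟨w, hw, hTw⟩ := intermediate_value_Icc' hq0.le
    (f := pairDefect m lam q) (fun x hx => (hasDerivAt_pairDefect m lam q
      (lt_of_le_of_lt hx.2 hq1)).continuousAt.continuousWithinAt) (⟨hT1, hT0.1⟩ :
      (0 : ℝ) ∈ Set.Icc (pairDefect m lam q q) (pairDefect m lam q 0))
  have hw1 : 0 < 1 - w := by linarith [hw.2]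
  set vs := a / (1 - w) with hvs
  have hwvs : (vs - a) / vs = w := by
    rw [hvs]
    field_simp
    ring
  have hvsmem : vs ∈ Set.Icc a b := by
    constructor
    · rw [hvs, le_div_iff₀ hw1]
      nlinarith [hw.1]
    · rw [hvs, div_le_iff₀ hw1]
      have : b * (1 - q) = a := by rw [hq]; field_simp; ring
      nlinarith [hw.2]
  have hbr : betaRatio m w ≤ betaRatio m q :=
    (betaRatio_strictMonoOn m).monotoneOn ⟨hw.1, by linarith⟩ ⟨hq0.le, hq1⟩ hw.2
  have hbr0 := betaRatio_nonneg m hw.1 (by linarith)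
  have heq1 : w ^ m * (1 - (m + 1) * ((1 - lam * betaRatio m w) / (m + 1)))
      = lam * betaInt m w := by
    rw [mul_div_cancel₀ _ hm2.ne', sub_sub_cancel, betaRatio]
    rcases hw.1.eq_or_lt with h0 | h0
    · rw [← h0]
      simp
    · field_simp
  refine ⟨vs, (1 - lam * betaRatio m w) / (m + 1), ?_, ⟨?_, ?_⟩, ?_, ?_⟩
  · rw [isModeratePair_iff m ha hvsmem, hwvs]
    exact ⟨heq1, hTw⟩
  · apply div_nonneg _ hm2.le
    nlinarith
  · apply div_le_div_of_nonneg_right _ hm2.le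
    nlinarith
  · intro vs' α' h'
    have hvs' : vs' ∈ Set.Icc a b := h'.1
    rw [isModeratePair_iff m ha hvs'] at h'
    have hvs'0 : 0 < vs' := ha.trans_le hvs'.1
    have hw' : (vs' - a) / vs' ∈ Set.Ico (0 : ℝ) 1 := by simpa using ratio_mem_Ico ha hvs'.1
    have hww : (vs' - a) / vs' = w := (pairDefect_strictAntiOn m hlam q).injOn hw'
      ⟨hw.1, by linarith⟩ (h'.2.trans hTw.symm)
    have hveq : vs' = vs := by
      rw [hvs, eq_div_iff hw1.ne', ← hww]
      field_simp
      ring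
    refine ⟨hveq, fun hlt => ?_⟩
    have hwpos : 0 < w := by
      rcases hw.1.eq_or_lt with h0 | h0
      · rw [← h0] at hTw
        linarith [hT0.2 hTw]
      · exact h0
    have h3 := h'.1
    rw [hww, ← heq1] at h3
    have h4 := mul_left_cancel₀ (by positivity : w ^ m ≠ 0) h3
    have h5 : ((m : ℝ) + 1) * α' = (m + 1) * ((1 - lam * betaRatio m w) / (m + 1)) := by linarith
    exact mul_left_cancel₀ hm2.ne' h5
  · rw [hwvs, hTw]

/-! ### Laws on `[a, b]` with a prescribed distribution function -/

lemma exists_isLawWithCDF {a b : ℝ} (hab : a < b) {G : ℝ → ℝ} (hc : ContinuousOn G (Set.Icc a b))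
    (hm : MonotoneOn G (Set.Icc a b)) (h0 : 0 ≤ G a) (h1 : G b = 1) :
    ∃ μ : Measure ℝ, IsLawWithCDF a b μ G := by
  have hmem : ∀ x, a ≤ x → min x b ∈ Set.Icc a b := fun x hx =>
    ⟨le_min hx hab.le, min_le_right _ _⟩
  have hnn : ∀ x ∈ Set.Icc a b, 0 ≤ G x := fun x hx =>
    h0.trans (hm ⟨le_rfl, hab.le⟩ hx hx.1)
  let f : StieltjesFunction ℝ :=
    { toFun := fun x => if x < a then 0 else G (min x b)
      mono' := by
        intro x y hxy
        by_cases hx : x < a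
        · by_cases hy : y < a
          · simp [hx, hy]
          · simpa [hx, hy] using hnn _ (hmem y (not_lt.1 hy))
        · have hy : ¬ y < a := by linarith
          simpa [hx, hy] using hm (hmem x (not_lt.1 hx)) (hmem y (not_lt.1 hy))
            (min_le_min_right b hxy)
      right_continuous' := by
        intro x
        by_cases hx : x < a
        · apply ContinuousAt.continuousWithinAt
          apply (continuousAt_const (y := (0 : ℝ))).congr
          filter_upwards [Iio_mem_nhds hx] with y hy
          rw [if_pos (Set.mem_Iio.1 hy)]
        · have hx' := not_lt.1 hx
          have hcw : ContinuousWithinAt (fun y => G (min y b)) (Set.Ici x) x := by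
            exact ContinuousWithinAt.comp (f := fun y => min y b) (t := Set.Icc a b)
              (hc _ (hmem x hx')) (by fun_prop) fun y hy => hmem y (hx'.trans hy)
          apply hcw.congr
          · intro y hy
            have : x ≤ y := hy
            rw [if_neg (by linarith)]
          · rw [if_neg hx] }
  have hf : ∀ x, f x = if x < a then 0 else G (min x b) := fun _ => rfl
  have hbot : Filter.Tendsto f Filter.atBot (nhds 0) := by
    apply tendsto_atBot_of_eventually_const (i₀ := a - 1)
    intro i hi
    rw [hf, if_pos (by linarith)]
  have htop : Filter.Tendsto f Filter.atTop (nhds 1) := by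
    apply tendsto_atTop_of_eventually_const (i₀ := b)
    intro i hi
    have : b ≤ i := hi
    rw [hf, if_neg (by linarith), min_eq_right this, h1]
  have hP : IsProbabilityMeasure f.measure := f.isProbabilityMeasure hbot htop
  refine ⟨f.measure, hP, ?_, ?_⟩
  · have hsub : (Set.Icc a b)ᶜ ⊆ Set.Iio a ∪ Set.Ioi b := by
      intro x hx
      by_contra h
      simp only [Set.mem_union, Set.mem_Iio, Set.mem_Ioi, not_or, not_lt] at h
      exact hx h
    apply measure_mono_null hsub
    apply measure_union_null
    · have hl : Function.leftLim f a = 0 := by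
        apply leftLim_eq_of_tendsto
        apply tendsto_const_nhds.congr'
        filter_upwards [self_mem_nhdsWithin] with y hy
        rw [hf, if_pos (Set.mem_Iio.1 hy)]
      rw [f.measure_Iio hbot, hl]
      simp
    · have := f.measure_Ioi htop b
      rw [this, hf, if_neg (by linarith), min_self, h1]
      simp
  · intro v hv
    rw [cdf_measure_stieltjesFunction f hbot htop, hf, if_neg (by linarith [hv.1]),
      min_eq_left hv.2]

/-- The law on `[c, b]` with constant virtual value `φ` below `b`: it has density
`(c - φ) / (t - φ)^2` on `(c, b]` and an atom of mass `(c - φ) / (b - φ)` at `b`. -/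
def isoLaw (c b φ : ℝ) : Measure ℝ :=
  (volume.restrict (Set.Ioc c b)).withDensity (fun t => ENNReal.ofReal ((c - φ) / (t - φ) ^ 2))
    + ENNReal.ofReal ((c - φ) / (b - φ)) • Measure.dirac b

section IsoLaw

variable {c b φ : ℝ}

lemma continuousOn_isoDensity (hφ : φ < c) :
    ContinuousOn (fun t : ℝ => (c - φ) / (t - φ) ^ 2) (Set.Ici c) := by
  apply ContinuousOn.div (by fun_prop) (by fun_prop)
  intro x hx
  have : c ≤ x := hx
  have : 0 < x - φ := by linarith
  positivity

lemma measurable_isoDensity : Measurable (fun t : ℝ => (c - φ) / (t - φ) ^ 2) := by fun_prop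

lemma isoDensity_nonneg (hφ : φ < c) (t : ℝ) : 0 ≤ (c - φ) / (t - φ) ^ 2 :=
  div_nonneg (by linarith) (by positivity)

lemma intervalIntegrable_isoDensity (hφ : φ < c) {u v : ℝ} (hu : c ≤ u) (huv : u ≤ v) :
    IntervalIntegrable (fun t : ℝ => (c - φ) / (t - φ) ^ 2) volume u v := by
  apply ContinuousOn.intervalIntegrable
  rw [Set.uIcc_of_le huv]
  exact (continuousOn_isoDensity hφ).mono fun x hx => hu.trans hx.1

lemma isoLaw_apply {s : Set ℝ} (hs : MeasurableSet s) :
    isoLaw c b φ s = (∫⁻ t in s ∩ Set.Ioc c b, ENNReal.ofReal ((c - φ) / (t - φ) ^ 2))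
      + ENNReal.ofReal ((c - φ) / (b - φ)) * Measure.dirac b s := by
  rw [isoLaw, Measure.add_apply, withDensity_apply _ hs, Measure.restrict_restrict hs,
    Measure.smul_apply, smul_eq_mul]

lemma lintegral_isoDensity (hφ : φ < c) {v : ℝ} (hv : c ≤ v) :
    ∫⁻ t in Set.Ioc c v, ENNReal.ofReal ((c - φ) / (t - φ) ^ 2)
      = ENNReal.ofReal ((v - c) / (v - φ)) := by
  have h := intervalIntegral.integral_eq_sub_of_hasDerivAt_of_le hv
    (f := fun t => (t - c) / (t - φ)) (f' := fun t => (c - φ) / (t - φ) ^ 2)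
    ((continuousOn_ratio hφ).mono fun x hx => hx.1)
    (fun x hx => hasDerivAt_ratio (by linarith [hx.1])) (intervalIntegrable_isoDensity hφ le_rfl hv)
  rw [← ofReal_integral_eq_lintegral_ofReal
      ((intervalIntegrable_isoDensity hφ le_rfl hv).1)
      (Filter.Eventually.of_forall fun t => isoDensity_nonneg hφ t),
    ← intervalIntegral.integral_of_le hv, h]
  simp

lemma isProbabilityMeasure_isoLaw (hφ : φ < c) (hcb : c < b) :
    IsProbabilityMeasure (isoLaw c b φ) := by
  constructor
  have h1 : 0 ≤ (b - c) / (b - φ) := div_nonneg (by linarith) (by linarith)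
  have h2 : 0 ≤ (c - φ) / (b - φ) := div_nonneg (by linarith) (by linarith)
  have hb : b - φ ≠ 0 := by linarith
  rw [isoLaw_apply MeasurableSet.univ, Set.univ_inter, lintegral_isoDensity hφ hcb.le]
  simp only [measure_univ, mul_one]
  rw [← ENNReal.ofReal_add h1 h2, ← add_div]
  simp [hb]

lemma isoLaw_compl_Icc (h : c ≤ b) : isoLaw c b φ (Set.Icc c b)ᶜ = 0 := by
  rw [isoLaw_apply measurableSet_Icc.compl]
  have h1 : (Set.Icc c b)ᶜ ∩ Set.Ioc c b = ∅ := by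
    ext x
    simp only [Set.mem_inter_iff, Set.mem_compl_iff, Set.mem_Icc, Set.mem_Ioc,
      Set.mem_empty_iff_false, iff_false]
    intro hx
    exact hx.1 ⟨hx.2.1.le, hx.2.2⟩
  have h2 : b ∉ (Set.Icc c b)ᶜ := by simpa using h
  rw [h1, Measure.dirac_apply' _ measurableSet_Icc.compl]
  simp [h2]

lemma cdf_isoLaw (hφ : φ < c) (hcb : c < b) (v : ℝ) :
    cdf (isoLaw c b φ) v = if v < c then 0 else if v < b then (v - c) / (v - φ) else 1 := by
  have hP := isProbabilityMeasure_isoLaw hφ hcb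
  rw [cdf_eq_real, Measure.real]
  split_ifs with h1 h2
  · rw [isoLaw_apply measurableSet_Iic]
    have h3 : Set.Iic v ∩ Set.Ioc c b = ∅ := by
      ext x
      simp only [Set.mem_inter_iff, Set.mem_Iic, Set.mem_Ioc, Set.mem_empty_iff_false, iff_false]
      intro hx
      linarith [hx.1, hx.2.1]
    have h4 : b ∉ Set.Iic v := by simp; linarith
    rw [h3, Measure.dirac_apply' _ measurableSet_Iic]
    simp [h4]
  · have h1' := not_lt.1 h1
    rw [isoLaw_apply measurableSet_Iic]
    have h3 : Set.Iic v ∩ Set.Ioc c b = Set.Ioc c v := by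
      ext x
      simp only [Set.mem_inter_iff, Set.mem_Iic, Set.mem_Ioc]
      constructor
      · exact fun hx => ⟨hx.2.1, hx.1⟩
      · exact fun hx => ⟨hx.2, hx.1, by linarith [hx.2]⟩
    have h4 : b ∉ Set.Iic v := by simpa using h2
    rw [h3, Measure.dirac_apply' _ measurableSet_Iic, lintegral_isoDensity hφ h1']
    simp only [h4, not_false_eq_true, Set.indicator_of_notMem, mul_zero, add_zero]
    exact ENNReal.toReal_ofReal (div_nonneg (by linarith) (by linarith))
  · have h3 : isoLaw c b φ (Set.Iic v)ᶜ = 0 := by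
      refine measure_mono_null ?_ (isoLaw_compl_Icc hcb.le)
      intro x hx hx'
      exact hx (hx'.2.trans (not_lt.1 h2))
    rw [(prob_compl_eq_zero_iff measurableSet_Iic).1 h3]
    simp

lemma integral_isoLaw (hφ : φ < c) (hcb : c < b) {h : ℝ → ℝ} (hm : Measurable h) {C : ℝ}
    (hC : ∀ t ∈ Set.Icc c b, |h t| ≤ C) :
    ∫ t, h t ∂(isoLaw c b φ)
      = (∫ t in c..b, (c - φ) / (t - φ) ^ 2 * h t) + (c - φ) / (b - φ) * h b := by
  have hP := isProbabilityMeasure_isoLaw hφ hcb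
  have hint : Integrable h (isoLaw c b φ) := by
    apply Integrable.of_bound hm.aestronglyMeasurable C
    have h0 := isoLaw_compl_Icc hcb.le (φ := φ)
    filter_upwards [compl_mem_ae_iff.2 h0] with t ht
    rw [compl_compl] at ht
    exact hC t ht
  rw [isoLaw] at hint ⊢
  rw [integrable_add_measure] at hint
  rw [integral_add_measure hint.1 hint.2, integral_smul_measure, integral_dirac,
    integral_withDensity_eq_integral_toReal_smul measurable_isoDensity.ennreal_ofReal
      (Filter.Eventually.of_forall fun t => ENNReal.ofReal_lt_top),
    intervalIntegral.integral_of_le hcb.le,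
    ENNReal.toReal_ofReal (div_nonneg (by linarith) (by linarith))]
  simp only [smul_eq_mul]
  congr 1
  apply integral_congr_ae
  filter_upwards with t
  rw [ENNReal.toReal_ofReal (isoDensity_nonneg hφ t)]

end IsoLaw

/-! ### The highest valuation and the uniform tie-breaking rule -/

section Highest

variable {n : ℕ}

lemma le_vmax (v : Fin n → ℝ) (i : Fin n) : v i ≤ vmax v := le_ciSup (Set.finite_range v).bddAbove i

lemma vmax_le_iff [Nonempty (Fin n)] {v : Fin n → ℝ} {t : ℝ} : vmax v ≤ t ↔ ∀ i, v i ≤ t :=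
  ciSup_le_iff (Set.finite_range v).bddAbove

lemma exists_eq_vmax [Nonempty (Fin n)] (v : Fin n → ℝ) : ∃ i, v i = vmax v :=
  exists_eq_ciSup_of_finite

lemma measurable_vmax : Measurable (vmax : (Fin n → ℝ) → ℝ) :=
  Measurable.iSup fun i => measurable_pi_apply i

lemma vmax_mem_Icc [Nonempty (Fin n)] {a b : ℝ} {v : Fin n → ℝ} (hv : v ∈ box n a b) :
    vmax v ∈ Set.Icc a b := by
  obtain ⟨i, hi⟩ := exists_eq_vmax v
  rw [← hi]
  exact hv i

lemma update_mem_box {a b t : ℝ} {v : Fin n → ℝ} (hv : v ∈ box n a b) (i : Fin n)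
    (ht : t ∈ Set.Icc a b) : Function.update v i t ∈ box n a b := by
  intro j
  rcases eq_or_ne j i with rfl | h
  · simpa using ht
  · simpa [h] using hv j

/-- On the box, `vmax (Function.update v i a)` is the highest valuation of the competitors of `i`,
and equals `a` if there are none. -/
lemma vmax_update [Nonempty (Fin n)] {a b t : ℝ} {v : Fin n → ℝ} (i : Fin n)
    (ht : t ∈ Set.Icc a b) :
    vmax (Function.update v i t) = max t (vmax (Function.update v i a)) := by
  apply le_antisymm
  · rw [vmax_le_iff]
    intro j
    rcases eq_or_ne j i with rfl | h
    · simp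
    · have := le_vmax (Function.update v i a) j
      simp only [Function.update_of_ne h] at this ⊢
      exact this.trans (le_max_right _ _)
  · apply max_le
    · simpa using le_vmax (Function.update v i t) i
    · rw [vmax_le_iff]
      intro j
      rcases eq_or_ne j i with rfl | h
      · have := le_vmax (Function.update v j t) j
        simp only [Function.update_self] at this ⊢
        exact ht.1.trans this
      · simpa [h] using le_vmax (Function.update v i t) j

lemma highestShare_nonneg (v : Fin n → ℝ) (i : Fin n) : 0 ≤ highestShare v i := by
  unfold highestShare
  split_ifs
  · positivity
  · exact le_rfl

lemma highestShare_of_lt {v : Fin n → ℝ} {i : Fin n} (h : v i < vmax v) : highestShare v i = 0 :=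
  if_neg h.ne

lemma sum_highestShare [Nonempty (Fin n)] (v : Fin n → ℝ) : ∑ i, highestShare v i = 1 := by
  obtain ⟨k, hk⟩ := exists_eq_vmax v
  unfold highestShare
  rw [← Finset.sum_filter, Finset.sum_const, nsmul_eq_mul]
  apply mul_one_div_cancel
  have : k ∈ Finset.univ.filter (fun j => v j = vmax v) := by simp [hk]
  have := Finset.card_pos.2 ⟨k, this⟩
  positivity

lemma highestShare_le_one [Nonempty (Fin n)] (v : Fin n → ℝ) (i : Fin n) :
    highestShare v i ≤ 1 := by
  rw [← sum_highestShare v]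
  exact Finset.single_le_sum (fun j _ => highestShare_nonneg v j) (Finset.mem_univ i)

lemma highestShare_eq_one [Nonempty (Fin n)] {v : Fin n → ℝ} {i : Fin n}
    (h : ∀ j, j ≠ i → v j < v i) :
    highestShare v i = 1 := by
  rw [← sum_highestShare v, Finset.sum_eq_single i]
  · intro j _ hj
    exact highestShare_of_lt ((h j hj).trans_le (le_vmax v i))
  · simp

lemma measurable_highestShare [Nonempty (Fin n)] (i : Fin n) :
    Measurable fun v : Fin n → ℝ => highestShare v i := by
  have hs : ∀ j : Fin n, MeasurableSet {v : Fin n → ℝ | v j = vmax v} := fun j =>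
    measurableSet_eq_fun (measurable_pi_apply j) measurable_vmax
  have hcard : Measurable fun v : Fin n → ℝ =>
      ((Finset.univ.filter (fun j => v j = vmax v)).card : ℝ) := by
    simp only [Finset.card_filter, Nat.cast_sum]
    apply Finset.measurable_sum
    intro j _
    simp only [Nat.cast_ite]
    exact Measurable.ite (hs j) measurable_const measurable_const
  exact Measurable.ite (hs i) (hcard.const_div 1) measurable_const

/-- The share of bidder `i` as a function of the own report `t`: nothing below the competing
maximum, everything above it. -/
lemma highestShare_update_of_lt [Nonempty (Fin n)] {v : Fin n → ℝ} {a b t : ℝ} {i : Fin n}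
    (ht : t ∈ Set.Icc a b)
    (h : t < vmax (Function.update v i a)) : highestShare (Function.update v i t) i = 0 := by
  apply highestShare_of_lt
  rw [vmax_update i ht, max_eq_right h.le]
  simpa using h

lemma highestShare_update_of_gt [Nonempty (Fin n)] {v : Fin n → ℝ} {a t : ℝ} {i : Fin n}
    (h : vmax (Function.update v i a) < t) : highestShare (Function.update v i t) i = 1 := by
  apply highestShare_eq_one
  intro j hj
  have := le_vmax (Function.update v i a) j
  simp only [Function.update_of_ne hj, Function.update_self] at this ⊢
  linarith

end Highest

/-! ### Mechanisms with envelope payments -/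

section Envelope

variable {n : ℕ}

lemma measurable_envelopePayment [Nonempty (Fin n)] (a : ℝ) {x : (Fin n → ℝ) → Fin n → ℝ}
    (hx : Measurable x) :
    Measurable (envelopePayment a x) := by
  rw [measurable_pi_iff]
  intro i
  have hxi : Measurable fun v => x v i := (measurable_pi_apply i).comp hx
  have hf : Measurable fun q : (Fin n → ℝ) × ℝ => x (Function.update q.1 i q.2) i :=
    hxi.comp measurable_update'
  have hv : Measurable fun q : (Fin n → ℝ) × ℝ => q.1 i :=
    (measurable_pi_apply i).comp measurable_fst
  have key : ∀ s : (Fin n → ℝ) → Set ℝ, MeasurableSet {q : (Fin n → ℝ) × ℝ | q.2 ∈ s q.1} →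
      (∀ v, MeasurableSet (s v)) →
      Measurable fun v => ∫ t in s v, x (Function.update v i t) i := by
    intro s hs hs'
    have h1 : StronglyMeasurable (Function.uncurry fun (v : Fin n → ℝ) (t : ℝ) =>
        (s v).indicator (fun t => x (Function.update v i t) i) t) := by
      apply Measurable.stronglyMeasurable
      exact hf.indicator hs
    have h2 := h1.integral_prod_right (ν := volume)
    simpa only [integral_indicator (hs' _)] using h2.measurable
  have h1 := key (fun v => Set.Ioc a (v i))
    ((measurableSet_lt measurable_const measurable_snd).inter
      (measurableSet_le measurable_snd hv)) fun v => measurableSet_Ioc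
  have h2 := key (fun v => Set.Ioc (v i) a)
    ((measurableSet_lt hv measurable_snd).inter
      (measurableSet_le measurable_snd measurable_const)) fun v => measurableSet_Ioc
  exact ((measurable_pi_apply i).mul hxi).sub (h1.sub h2)

/-- Monotonicity in the own report suffices for incentive compatibility. -/
lemma envelope_mem_dsic [Nonempty (Fin n)] {a b : ℝ} {x : (Fin n → ℝ) → Fin n → ℝ}
    (hx : Measurable x) (h01 : ∀ v i, x v i ∈ Set.Icc (0 : ℝ) 1)
    (hmono : ∀ v ∈ box n a b, ∀ i,
      MonotoneOn (fun t => x (Function.update v i t) i) (Set.Icc a b))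
    (hsum : ∀ v, ∑ i, x v i ≤ 1) :
    (⟨x, envelopePayment a x⟩ : Mechanism n) ∈ dsic n a b := by
  refine ⟨hx, measurable_envelopePayment a hx, fun v _ i => h01 v i, ?_, ?_, fun v _ => hsum v⟩
  · intro v hv i
    simp only [envelopePayment, sub_sub_cancel]
    exact intervalIntegral.integral_nonneg (hv i).1 fun t _ => (h01 _ _).1
  · intro v hv i w hw
    simp only [envelopePayment, Function.update_idem, Function.update_self, sub_sub_cancel]
    set X : ℝ → ℝ := fun t => x (Function.update v i t) i with hX
    have hXm := hmono v hv i
    have hint : ∀ s t, s ∈ Set.Icc a b → t ∈ Set.Icc a b → IntervalIntegrable X volume s t :=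
      fun s t hs ht => (hXm.mono (Set.uIcc_subset_Icc hs ht)).intervalIntegrable
    have ha : a ∈ Set.Icc a b := ⟨le_rfl, hw.1.trans hw.2⟩
    have hadd := intervalIntegral.integral_add_adjacent_intervals (hint a w ha hw)
      (hint w (v i) hw (hv i))
    have hkey : (v i - w) * X w ≤ ∫ t in w..(v i), X t := by
      rcases le_total w (v i) with h | h
      · have := intervalIntegral.integral_mono_on (f := fun _ => X w) h (by simp)
          (hint w (v i) hw (hv i)) fun t ht =>
          hXm hw ⟨hw.1.trans ht.1, ht.2.trans (hv i).2⟩ ht.1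
        simpa using this
      · have := intervalIntegral.integral_mono_on (g := fun _ => X w) h
          (hint (v i) w (hv i) hw) (by simp) fun t ht =>
          hXm ⟨(hv i).1.trans ht.1, ht.2.trans hw.2⟩ hw ht.2
        rw [intervalIntegral.integral_symm]
        simp only [intervalIntegral.integral_const, smul_eq_mul] at this
        linarith
    rw [← hadd]
    linarith

end Envelope

/-! ### Random unified thresholds -/

section Unified

variable {n : ℕ}

/-- The allocation of the unified mechanism for a fixed threshold `r`. -/
def thresholdAlloc (n : ℕ) (vs r : ℝ) (v : Fin n → ℝ) (i : Fin n) : ℝ :=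
  if r ≤ vmax v then highestShare v i else if r ≤ vs then 0 else 1 / (n : ℝ)

/-- The expected allocation of the unified mechanism: at highest valuation `y` the item goes to a
highest bidder with probability `D(y)`, and to a bidder drawn uniformly with probability
`1 - D(max v* y)`. -/
def unifiedAlloc (n : ℕ) (vs : ℝ) (D : Measure ℝ) (v : Fin n → ℝ) (i : Fin n) : ℝ :=
  cdf D (vmax v) * highestShare v i + (1 - cdf D (max vs (vmax v))) / n

lemma ite_spa_pool_eq (a vs r : ℝ) :
    (if r ≤ vs then spa n a r else pool n a r)
      = ⟨thresholdAlloc n vs r, envelopePayment a (thresholdAlloc n vs r)⟩ := by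
  by_cases h : r ≤ vs
  · have : (fun (v : Fin n → ℝ) (i : Fin n) => if r ≤ vmax v then highestShare v i else 0)
        = thresholdAlloc n vs r := by
      funext v i
      simp [thresholdAlloc, h]
    rw [if_pos h, spa, this]
  · have : (fun (v : Fin n → ℝ) (i : Fin n) =>
        if r ≤ vmax v then highestShare v i else 1 / (n : ℝ)) = thresholdAlloc n vs r := by
      funext v i
      simp [thresholdAlloc, h]
    rw [if_neg h, pool, this]

lemma abs_thresholdAlloc_le [Nonempty (Fin n)] (vs r : ℝ) (v : Fin n → ℝ) (i : Fin n) :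
    |thresholdAlloc n vs r v i| ≤ 1 := by
  unfold thresholdAlloc
  split_ifs
  · rw [abs_of_nonneg (highestShare_nonneg v i)]
    exact highestShare_le_one v i
  · simp
  · rw [abs_of_nonneg (by positivity)]
    have : 1 ≤ n := Fin.pos_iff_nonempty.2 ‹_›
    have : (1 : ℝ) ≤ n := by exact_mod_cast this
    exact div_le_one_of_le₀ this (by linarith)

lemma measurable_thresholdAlloc [Nonempty (Fin n)] (vs : ℝ) (i : Fin n) :
    Measurable fun q : ℝ × (Fin n → ℝ) => thresholdAlloc n vs q.1 q.2 i := by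
  apply Measurable.ite (measurableSet_le measurable_fst (measurable_vmax.comp measurable_snd))
    ((measurable_highestShare i).comp measurable_snd)
  exact Measurable.ite (measurableSet_le measurable_fst measurable_const) measurable_const
    measurable_const

variable (D : Measure ℝ)

lemma integral_thresholdAlloc [IsProbabilityMeasure D] (vs : ℝ) (v : Fin n → ℝ) (i : Fin n) :
    ∫ r, thresholdAlloc n vs r v i ∂D = unifiedAlloc n vs D v i := by
  have h : ∀ r, thresholdAlloc n vs r v i
      = (Set.Iic (vmax v)).indicator (fun _ => highestShare v i) r
        + (Set.Ioi (max vs (vmax v))).indicator (fun _ => 1 / (n : ℝ)) r := by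
    intro r
    by_cases h1 : r ≤ vmax v
    · simp [thresholdAlloc, Set.indicator, h1, not_lt.2 h1]
    · by_cases h2 : r ≤ vs
      · simp [thresholdAlloc, Set.indicator, h1, h2, not_lt.2 h2]
      · simp [thresholdAlloc, Set.indicator, h1, h2, not_le.1 h1, not_le.1 h2]
  simp_rw [h]
  rw [integral_add ((integrable_const _).indicator measurableSet_Iic)
      ((integrable_const _).indicator measurableSet_Ioi),
    integral_indicator_const _ measurableSet_Iic, integral_indicator_const _ measurableSet_Ioi,
    unifiedAlloc, cdf_eq_real, cdf_eq_real, ← Set.compl_Iic,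
    probReal_compl_eq_one_sub measurableSet_Iic]
  simp [div_eq_mul_inv]

lemma integral_intervalIntegral_thresholdAlloc [Nonempty (Fin n)] [IsProbabilityMeasure D]
    (a vs : ℝ) (v : Fin n → ℝ) (i : Fin n) :
    ∫ r, (∫ t in a..(v i), thresholdAlloc n vs r (Function.update v i t) i) ∂D
      = ∫ t in a..(v i), unifiedAlloc n vs D (Function.update v i t) i := by
  simp_rw [intervalIntegral.intervalIntegral_eq_integral_uIoc, ← integral_thresholdAlloc]
  have : IsFiniteMeasure (volume.restrict (Set.uIoc a (v i))) :=
    ⟨by simp [Set.uIoc, Measure.restrict_apply]⟩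
  rw [integral_smul, integral_integral_swap]
  apply Integrable.of_bound (C := 1)
  · apply Measurable.aestronglyMeasurable
    exact (measurable_thresholdAlloc vs i).comp (measurable_fst.prodMk
      (measurable_update'.comp (measurable_const.prodMk measurable_snd)))
  · filter_upwards with q using abs_thresholdAlloc_le vs _ _ i

lemma measurable_intervalIntegral_thresholdAlloc [Nonempty (Fin n)] (a vs : ℝ) (v : Fin n → ℝ)
    (i : Fin n) :
    Measurable fun r => ∫ t in a..(v i), thresholdAlloc n vs r (Function.update v i t) i := by
  simp_rw [intervalIntegral.intervalIntegral_eq_integral_uIoc, smul_eq_mul]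
  refine Measurable.const_mul (StronglyMeasurable.measurable ?_) _
  apply StronglyMeasurable.integral_prod_right
    (f := fun r t => thresholdAlloc n vs r (Function.update v i t) i)
  apply Measurable.stronglyMeasurable
  exact (measurable_thresholdAlloc vs i).comp (measurable_fst.prodMk
    (measurable_update'.comp (measurable_const.prodMk measurable_snd)))

lemma unified_eq [Nonempty (Fin n)] [IsProbabilityMeasure D] (a vs : ℝ) :
    unified n a vs D = ⟨unifiedAlloc n vs D, envelopePayment a (unifiedAlloc n vs D)⟩ := by
  simp only [unified, ite_spa_pool_eq, mix, Mechanism.mk.injEq]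
  constructor
  · funext v i
    exact integral_thresholdAlloc D vs v i
  · funext v i
    have hm : Measurable fun r => thresholdAlloc n vs r v i :=
      (measurable_thresholdAlloc vs i).comp (measurable_id.prodMk measurable_const)
    have hi : Integrable (fun r => thresholdAlloc n vs r v i) D :=
      Integrable.of_bound hm.aestronglyMeasurable 1
        (Filter.Eventually.of_forall fun r => abs_thresholdAlloc_le vs r v i)
    simp only [envelopePayment]
    rw [integral_sub (hi.const_mul _), integral_const_mul, integral_thresholdAlloc,
      integral_intervalIntegral_thresholdAlloc]
    apply Integrable.of_bound
      (measurable_intervalIntegral_thresholdAlloc a vs v i).aestronglyMeasurable (1 * |v i - a|)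
    filter_upwards with r
    exact intervalIntegral.norm_integral_le_of_norm_le_const fun t _ =>
      abs_thresholdAlloc_le vs r _ i

lemma randomSpa_eq_unified {a b : ℝ} (hD : D (Set.Icc a b)ᶜ = 0) :
    randomSpa n a D = unified n a b D := by
  have h : ∀ᵐ r ∂D, r ≤ b := by
    filter_upwards [compl_mem_ae_iff.2 hD] with r hr
    rw [compl_compl] at hr
    exact hr.2
  simp only [randomSpa, unified, mix, Mechanism.mk.injEq]
  constructor <;>
  · funext v i
    apply integral_congr_ae
    filter_upwards [h] with r hr
    rw [if_pos hr]

lemma randomPool_eq_unified {a b vs : ℝ} (hvs : vs < a) (hD : D (Set.Icc a b)ᶜ = 0) :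
    randomPool n a D = unified n a vs D := by
  have h : ∀ᵐ r ∂D, ¬ r ≤ vs := by
    filter_upwards [compl_mem_ae_iff.2 hD] with r hr
    rw [compl_compl] at hr
    linarith [hr.1]
  simp only [randomPool, unified, mix, Mechanism.mk.injEq]
  constructor <;>
  · funext v i
    apply integral_congr_ae
    filter_upwards [h] with r hr
    rw [if_neg hr]

lemma measurable_cdf : Measurable (cdf D : ℝ → ℝ) := (monotone_cdf D).measurable

lemma measurable_unifiedAlloc [Nonempty (Fin n)] [IsProbabilityMeasure D] (vs : ℝ) : Measurable
    (unifiedAlloc n vs D) := by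
  rw [measurable_pi_iff]
  intro i
  have h1 := (measurable_cdf D).comp (measurable_vmax (n := n))
  have h2 := (measurable_cdf D).comp (measurable_const.max (measurable_vmax (n := n)) :
    Measurable fun v : Fin n → ℝ => max vs (vmax v))
  exact (h1.mul (measurable_highestShare i)).add ((measurable_const.sub h2).div_const _)

lemma sum_unifiedAlloc [Nonempty (Fin n)] (vs : ℝ) (v : Fin n → ℝ) :
    ∑ i, unifiedAlloc n vs D v i = cdf D (vmax v) + (1 - cdf D (max vs (vmax v))) := by
  have hn : 0 < n := Fin.pos_iff_nonempty.2 ‹_›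
  unfold unifiedAlloc
  rw [Finset.sum_add_distrib, ← Finset.mul_sum, sum_highestShare]
  simp
  field_simp

lemma unifiedAlloc_nonneg [Nonempty (Fin n)] (vs : ℝ) (v : Fin n → ℝ) (i : Fin n) :
    0 ≤ unifiedAlloc n vs D v i :=
  add_nonneg (mul_nonneg (cdf_nonneg D _) (highestShare_nonneg v i))
    (div_nonneg (sub_nonneg.2 (cdf_le_one D _)) (by positivity))

lemma sum_unifiedAlloc_le_one [Nonempty (Fin n)] [IsProbabilityMeasure D] (vs : ℝ)
    (v : Fin n → ℝ) : ∑ i, unifiedAlloc n vs D v i ≤ 1 := by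
  rw [sum_unifiedAlloc]
  have := monotone_cdf D (le_max_right vs (vmax v))
  linarith

lemma unifiedAlloc_le_one [Nonempty (Fin n)] [IsProbabilityMeasure D] (vs : ℝ) (v : Fin n → ℝ)
    (i : Fin n) : unifiedAlloc n vs D v i ≤ 1 :=
  (Finset.single_le_sum (fun j _ => unifiedAlloc_nonneg D vs v j) (Finset.mem_univ i)).trans
    (sum_unifiedAlloc_le_one D vs v)

/-- The probability with which a unique highest bidder with valuation `y` is served. -/
def winProb (n : ℕ) (vs : ℝ) (D : Measure ℝ) (y : ℝ) : ℝ :=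
  cdf D y + (1 - cdf D (max vs y)) / n

lemma monotone_winProb [Nonempty (Fin n)] (vs : ℝ) : Monotone (winProb n vs D) := by
  intro y z hyz
  have hn : 0 < n := Fin.pos_iff_nonempty.2 ‹_›
  have hn1 : (1 : ℝ) ≤ n := by exact_mod_cast hn
  have h1 := monotone_cdf D hyz
  have h2 : cdf D (max vs z) - cdf D (max vs y) ≤ cdf D z - cdf D y := by
    rcases le_total vs y with h | h
    · rw [max_eq_right h, max_eq_right (h.trans hyz)]
    · rw [max_eq_left h]
      rcases le_total vs z with h' | h'
      · rw [max_eq_right h']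
        linarith [monotone_cdf D h]
      · rw [max_eq_left h']
        linarith
  have h3 : (cdf D (max vs z) - cdf D (max vs y)) / n ≤ cdf D z - cdf D y := by
    rw [div_le_iff₀ (by linarith)]
    nlinarith
  unfold winProb
  rw [sub_div] at h3
  rw [sub_div, sub_div]
  linarith

lemma unifiedAlloc_update_of_lt [Nonempty (Fin n)] {a b vs t : ℝ} {v : Fin n → ℝ} {i : Fin n}
    (ht : t ∈ Set.Icc a b) (h : t < vmax (Function.update v i a)) :
    unifiedAlloc n vs D (Function.update v i t) i
      = (1 - cdf D (max vs (vmax (Function.update v i a)))) / n := by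
  rw [unifiedAlloc, highestShare_update_of_lt ht h, vmax_update i ht, max_eq_right h.le]
  simp

lemma unifiedAlloc_update_of_gt [Nonempty (Fin n)] {a b vs t : ℝ} {v : Fin n → ℝ} {i : Fin n}
    (ht : t ∈ Set.Icc a b) (h : vmax (Function.update v i a) < t) :
    unifiedAlloc n vs D (Function.update v i t) i = winProb n vs D t := by
  rw [unifiedAlloc, highestShare_update_of_gt h, vmax_update i ht, max_eq_left h.le, winProb,
    mul_one]

lemma unifiedAlloc_update_monotoneOn [Nonempty (Fin n)] [IsProbabilityMeasure D] {a b : ℝ}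
    (vs : ℝ) {v : Fin n → ℝ} (i : Fin n) :
    MonotoneOn (fun t => unifiedAlloc n vs D (Function.update v i t) i) (Set.Icc a b) := by
  intro s hs t ht hst
  set M := vmax (Function.update v i a) with hM
  have hup : ∀ r ∈ Set.Icc a b, unifiedAlloc n vs D (Function.update v i r) i
      ≤ winProb n vs D (max r M) := by
    intro r hr
    rw [unifiedAlloc, vmax_update i hr, winProb]
    have := mul_le_mul_of_nonneg_left (highestShare_le_one (Function.update v i r) i)
      (cdf_nonneg D (max r M))
    linarith
  have hlow : ∀ r ∈ Set.Icc a b, r ≤ M →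
      (1 - cdf D (max vs M)) / n ≤ unifiedAlloc n vs D (Function.update v i r) i := by
    intro r hr hrM
    rw [unifiedAlloc, vmax_update i hr, max_eq_right hrM]
    have := mul_nonneg (cdf_nonneg D M) (highestShare_nonneg (Function.update v i r) i)
    linarith
  simp only
  rcases hst.eq_or_lt with rfl | hst'
  · exact le_rfl
  rcases lt_or_ge M t with h | h
  · rw [unifiedAlloc_update_of_gt D ht h]
    exact (hup s hs).trans (monotone_winProb D vs (max_le hst h.le))
  · rw [unifiedAlloc_update_of_lt D hs (hst'.trans_le h)]
    exact hlow t ht h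

lemma unified_mem_dsic [Nonempty (Fin n)] [IsProbabilityMeasure D] (a b vs : ℝ) :
    unified n a vs D ∈ dsic n a b := by
  rw [unified_eq]
  exact envelope_mem_dsic (measurable_unifiedAlloc D vs)
    (fun v i => ⟨unifiedAlloc_nonneg D vs v i, unifiedAlloc_le_one D vs v i⟩)
    (fun v _ i => unifiedAlloc_update_monotoneOn D vs i) (sum_unifiedAlloc_le_one D vs)

end Unified

/-! ### Expectations of functions of the order statistics -/

section Expectation

lemma expectation_eq_integral {Ω : Type*} [MeasurableSpace Ω] {P : Measure Ω} {f : Ω → ℝ}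
    (hf : Integrable f P) : expectation P f = ((∫ ω, f ω ∂P : ℝ) : EReal) := by
  have hfin : ∀ g : Ω → ℝ, Integrable g P → ∫⁻ ω, ENNReal.ofReal (g ω) ∂P ≠ ⊤ := by
    intro g hg
    refine (lt_of_le_of_lt (lintegral_mono fun ω => ?_) hg.2).ne
    rw [← ofReal_norm]
    exact ENNReal.ofReal_le_ofReal (le_abs_self _)
  have h1 := hfin f hf
  have h2 : ∫⁻ ω, ENNReal.ofReal (-f ω) ∂P ≠ ⊤ := hfin _ hf.neg
  rw [expectation, integral_eq_lintegral_pos_part_sub_lintegral_neg_part hf, EReal.coe_sub,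
    EReal.coe_ennreal_toReal h1, EReal.coe_ennreal_toReal h2]

lemma expectation_mono {Ω : Type*} [MeasurableSpace Ω] {P : Measure Ω} {f g : Ω → ℝ}
    (h : ∀ᵐ ω ∂P, f ω ≤ g ω) : expectation P f ≤ expectation P g := by
  apply EReal.sub_le_sub
  · apply EReal.coe_ennreal_le_coe_ennreal_iff.2
    apply lintegral_mono_ae
    filter_upwards [h] with ω hω using ENNReal.ofReal_le_ofReal hω
  · apply EReal.coe_ennreal_le_coe_ennreal_iff.2
    apply lintegral_mono_ae
    filter_upwards [h] with ω hω using ENNReal.ofReal_le_ofReal (by linarith)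

lemma expectation_congr {Ω : Type*} [MeasurableSpace Ω] {P : Measure Ω} {f g : Ω → ℝ}
    (h : f =ᵐ[P] g) : expectation P f = expectation P g :=
  le_antisymm (expectation_mono h.le) (expectation_mono h.symm.le)

/-- The layer-cake formula: `E[N(Y)] = N(b) - ∫ₐᵇ N'(t) P(Y ≤ t) dt` for `Y` in `[a, b]`. -/
lemma integral_comp_eq_sub {Ω : Type*} [MeasurableSpace Ω] (P : Measure Ω)
    [IsProbabilityMeasure P] {Y : Ω → ℝ} (hYm : Measurable Y) {a b : ℝ} (hab : a ≤ b)
    (hY : ∀ᵐ ω ∂P, Y ω ∈ Set.Icc a b) {N N' : ℝ → ℝ} (hint : IntervalIntegrable N' volume a b)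
    (hN : ∀ y ∈ Set.Icc a b, ∫ t in y..b, N' t = N b - N y) :
    Integrable (fun ω => N (Y ω)) P ∧
      ∫ ω, N (Y ω) ∂P = N b - ∫ t in a..b, N' t * P.real {ω | Y ω ≤ t} := by
  have hS : MeasurableSet {q : Ω × ℝ | Y q.1 ≤ q.2} :=
    measurableSet_le (hYm.comp measurable_fst) measurable_snd
  have hi : Integrable N' (volume.restrict (Set.Icc a b)) := by
    have := (intervalIntegrable_iff_integrableOn_Icc_of_le hab).1 hint
    exact this
  have hprod : Integrable (Function.uncurry fun (ω : Ω) (t : ℝ) =>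
      {q : Ω × ℝ | Y q.1 ≤ q.2}.indicator (fun q => N' q.2) (ω, t))
      (P.prod (volume.restrict (Set.Icc a b))) := (hi.comp_snd P).indicator hS
  have hae : (fun ω => N (Y ω)) =ᵐ[P] fun ω => N b - ∫ t in Set.Icc a b,
      {q : Ω × ℝ | Y q.1 ≤ q.2}.indicator (fun q => N' q.2) (ω, t) := by
    filter_upwards [hY] with ω hω
    have h1 : (fun t => {q : Ω × ℝ | Y q.1 ≤ q.2}.indicator (fun q => N' q.2) (ω, t))
        = (Set.Ici (Y ω)).indicator N' := by
      funext t
      simp [Set.indicator]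
    have h2 : Set.Ici (Y ω) ∩ Set.Icc a b = Set.Icc (Y ω) b := by
      ext t
      simp only [Set.mem_inter_iff, Set.mem_Ici, Set.mem_Icc]
      exact ⟨fun h => ⟨h.1, h.2.2⟩, fun h => ⟨h.1, hω.1.trans h.1, h.2⟩⟩
    rw [h1, integral_indicator measurableSet_Ici, Measure.restrict_restrict measurableSet_Ici, h2,
      integral_Icc_eq_integral_Ioc, ← intervalIntegral.integral_of_le hω.2, hN _ hω]
    ring
  have hright : Integrable (fun ω => ∫ t in Set.Icc a b,
      {q : Ω × ℝ | Y q.1 ≤ q.2}.indicator (fun q => N' q.2) (ω, t)) P := hprod.integral_prod_left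
  refine ⟨((integrable_const (N b)).sub hright).congr hae.symm, ?_⟩
  rw [integral_congr_ae hae, integral_sub (integrable_const _) hright, integral_const,
    integral_integral_swap hprod, intervalIntegral.integral_of_le hab,
    ← integral_Icc_eq_integral_Ioc]
  simp only [probReal_univ, one_smul]
  congr 1
  apply integral_congr_ae
  filter_upwards with t
  have h1 : (fun ω => {q : Ω × ℝ | Y q.1 ≤ q.2}.indicator (fun q => N' q.2) (ω, t))
      = {ω | Y ω ≤ t}.indicator fun _ => N' t := by
    funext ω
    simp [Set.indicator]
  rw [h1, integral_indicator_const _ (measurableSet_le hYm measurable_const), smul_eq_mul,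
    mul_comm]

lemma intervalIntegrable_mul_cdf_pow (μ : Measure ℝ) {a b : ℝ} {f : ℝ → ℝ} (k : ℕ)
    (hf : IntervalIntegrable f volume a b) :
    IntervalIntegrable (fun t => f t * cdf μ t ^ k) volume a b := by
  have hm : Measurable fun t => cdf μ t ^ k := (measurable_cdf μ).pow_const k
  have hb : ∀ t, ‖cdf μ t ^ k‖ ≤ 1 := by
    intro t
    rw [norm_pow, Real.norm_eq_abs, abs_of_nonneg (cdf_nonneg μ t)]
    exact pow_le_one₀ (cdf_nonneg μ t) (cdf_le_one μ t)
  exact ⟨hf.1.mul_bdd hm.aestronglyMeasurable (Filter.Eventually.of_forall hb),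
    hf.2.mul_bdd hm.aestronglyMeasurable (Filter.Eventually.of_forall hb)⟩

variable {m : ℕ} (μ : Measure ℝ) [IsProbabilityMeasure μ]

lemma real_pi_vmax_le (t : ℝ) :
    (Measure.pi fun _ : Fin (m + 1) => μ).real {v | vmax v ≤ t} = cdf μ t ^ (m + 1) := by
  have h : {v : Fin (m + 1) → ℝ | vmax v ≤ t} = Set.univ.pi fun _ => Set.Iic t := by
    ext v
    simp [vmax_le_iff, Pi.le_def]
  rw [h, measureReal_def, Measure.pi_pi, cdf_eq_real, measureReal_def]
  simp

/-- The law of the highest valuation among the competitors of bidder `i`. -/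
lemma real_pi_vmax_update_le (i : Fin (m + 1)) {a t : ℝ} (hat : a ≤ t) :
    (Measure.pi fun _ : Fin (m + 1) => μ).real {v | vmax (Function.update v i a) ≤ t}
      = cdf μ t ^ m := by
  have h : {v : Fin (m + 1) → ℝ | vmax (Function.update v i a) ≤ t}
      = Set.univ.pi fun j => if j = i then Set.univ else Set.Iic t := by
    ext v
    simp only [Set.mem_ofPred_eq, vmax_le_iff, Set.mem_pi, Set.mem_univ, forall_const]
    apply forall_congr'
    intro j
    rcases eq_or_ne j i with rfl | hj
    · simp [hat]
    · simp [hj]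
  rw [h, measureReal_def, Measure.pi_pi, ← Finset.mul_prod_erase _ _ (Finset.mem_univ i)]
  have h2 : ∀ j ∈ Finset.univ.erase i,
      μ (if j = i then Set.univ else Set.Iic t) = μ (Set.Iic t) := by
    intro j hj
    rw [if_neg (Finset.ne_of_mem_erase hj)]
  rw [Finset.prod_congr rfl h2, cdf_eq_real, measureReal_def]
  simp

lemma ae_pi_mem_box {n : ℕ} {a b : ℝ} (hμ : μ (Set.Icc a b)ᶜ = 0) :
    ∀ᵐ v ∂(Measure.pi fun _ : Fin n => μ), v ∈ box n a b := by
  have : ∀ i : Fin n, ∀ᵐ v ∂(Measure.pi fun _ : Fin n => μ), v i ∈ Set.Icc a b := by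
    intro i
    have h : ∀ᵐ x ∂μ, x ∈ Set.Icc a b := by
      filter_upwards [compl_mem_ae_iff.2 hμ] with x hx
      rwa [compl_compl] at hx
    exact (Measure.tendsto_eval_ae_ae (μ := fun _ : Fin n => μ) (i := i)).eventually h
  exact ae_all_iff.2 this

end Expectation

/-! ### The regret of a unified mechanism against an arbitrary i.i.d. law -/

section UnifiedRegret

variable {n : ℕ} (D : Measure ℝ)

/-- The probability that the item is allotted uniformly at random when the highest valuation
is `y`. -/
def poolProb (vs : ℝ) (D : Measure ℝ) (y : ℝ) : ℝ := 1 - cdf D (max vs y)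

/-- The part of the regret of the unified mechanism that depends on the highest valuation. -/
def maxPart (n : ℕ) (lam a vs : ℝ) (D : Measure ℝ) (y : ℝ) : ℝ :=
  lam * y - y * (cdf D y + poolProb vs D y) + n * ∫ t in a..y, winProb n vs D t

/-- The part of the regret that depends on the highest valuation of the competitors of one
bidder. -/
def rivalPart (n : ℕ) (a vs : ℝ) (D : Measure ℝ) (y : ℝ) : ℝ :=
  (y - a) * poolProb vs D y / n - ∫ t in a..y, winProb n vs D t

lemma utility_unified [Nonempty (Fin n)] [IsProbabilityMeasure D] {a b vs : ℝ}
    {v : Fin n → ℝ} (hv : v ∈ box n a b) (i : Fin n) :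
    ∫ t in a..(v i), unifiedAlloc n vs D (Function.update v i t) i
      = (∫ t in a..(vmax v), winProb n vs D t) + rivalPart n a vs D (vmax (Function.update v i a))
        - (vmax v - v i) * poolProb vs D (vmax v) / n := by
  have ha : a ∈ Set.Icc a b := ⟨le_rfl, (hv i).1.trans (hv i).2⟩
  set M := vmax (Function.update v i a) with hM
  have hMI : M ∈ Set.Icc a b := vmax_mem_Icc (update_mem_box hv i ha)
  have hmax : vmax v = max (v i) M := by
    have := vmax_update i (hv i) (v := v)
    rwa [Function.update_eq_self] at this
  have hlow : ∀ y ∈ Set.Icc a b, y ≤ M →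
      ∫ t in a..y, unifiedAlloc n vs D (Function.update v i t) i
        = (y - a) * poolProb vs D M / n := by
    intro y hy hyM
    have h1 : ∫ t in a..y, unifiedAlloc n vs D (Function.update v i t) i
        = ∫ t in a..y, poolProb vs D M / n := by
      apply intervalIntegral.integral_congr_uIoo
      intro t ht
      rw [Set.uIoo_of_le hy.1] at ht
      exact unifiedAlloc_update_of_lt D ⟨ht.1.le, ht.2.le.trans hy.2⟩ (ht.2.trans_le hyM)
    rw [h1]
    simp only [intervalIntegral.integral_const, smul_eq_mul]
    ring
  have hW : ∀ y z, IntervalIntegrable (winProb n vs D) volume y z := fun y z =>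
    (monotone_winProb D vs).intervalIntegrable
  rcases le_total (v i) M with h | h
  · rw [hmax, max_eq_right h, hlow _ (hv i) h, rivalPart]
    ring
  · have h1 : ∫ t in M..(v i), unifiedAlloc n vs D (Function.update v i t) i
        = ∫ t in M..(v i), winProb n vs D t := by
      apply intervalIntegral.integral_congr_uIoo
      intro t ht
      rw [Set.uIoo_of_le h] at ht
      exact unifiedAlloc_update_of_gt D ⟨hMI.1.trans ht.1.le, ht.2.le.trans (hv i).2⟩ ht.1
    have hmono := unifiedAlloc_update_monotoneOn D vs (v := v) (a := a) (b := b) i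
    have hint : ∀ s t, s ∈ Set.Icc a b → t ∈ Set.Icc a b →
        IntervalIntegrable (fun t => unifiedAlloc n vs D (Function.update v i t) i) volume s t :=
      fun s t hs ht => (hmono.mono (Set.uIcc_subset_Icc hs ht)).intervalIntegrable
    rw [hmax, max_eq_left h, ← intervalIntegral.integral_add_adjacent_intervals
      (hint a M ha hMI) (hint M (v i) hMI (hv i)), hlow M hMI le_rfl, h1, rivalPart,
      ← intervalIntegral.integral_add_adjacent_intervals (hW a M) (hW M (v i))]
    ring

/-- Ex post, the regret splits into functions of the highest valuation and of the highest
competing valuations. -/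
lemma regret_unified_expost [Nonempty (Fin n)] [IsProbabilityMeasure D] {lam a b vs : ℝ}
    {v : Fin n → ℝ} (hv : v ∈ box n a b) :
    lam * vmax v - ∑ i, (unified n a vs D).p v i
      = maxPart n lam a vs D (vmax v)
        + ∑ i, rivalPart n a vs D (vmax (Function.update v i a)) := by
  have hn : 0 < n := Fin.pos_iff_nonempty.2 ‹_›
  have hn' : (n : ℝ) ≠ 0 := by positivity
  have hwin : ∀ i, v i * highestShare v i = vmax v * highestShare v i := by
    intro i
    rcases (le_vmax v i).eq_or_lt with h | h
    · rw [h]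
    · rw [highestShare_of_lt h]
      simp
  have hp : ∀ i, (unified n a vs D).p v i = vmax v * cdf D (vmax v) * highestShare v i
      + (vmax v * poolProb vs D (vmax v) / n - ∫ t in a..(vmax v), winProb n vs D t)
      - rivalPart n a vs D (vmax (Function.update v i a)) := by
    intro i
    rw [unified_eq]
    simp only [envelopePayment]
    rw [utility_unified D hv i, unifiedAlloc, mul_add, mul_left_comm, hwin i, poolProb]
    ring
  simp_rw [hp]
  rw [Finset.sum_sub_distrib, Finset.sum_add_distrib, ← Finset.mul_sum, sum_highestShare, maxPart]
  simp only [Finset.sum_const, Finset.card_univ, Fintype.card_fin, nsmul_eq_mul, mul_one]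
  field_simp
  ring

/-- `D` is a law on `(-∞, b]` whose distribution function is continuous on `[a, b]` and, except
at `e`, has derivative `g'` in the interior. An atom at `a` is allowed. -/
structure IsThresholdLaw (a b e : ℝ) (D : Measure ℝ) (g' : ℝ → ℝ) : Prop where
  isProbabilityMeasure : IsProbabilityMeasure D
  mem_Icc : e ∈ Set.Icc a b
  cdf_right : cdf D b = 1
  continuousOn : ContinuousOn (cdf D) (Set.Icc a b)
  hasDerivAt : ∀ t ∈ Set.Ioo a b, t ≠ e → HasDerivAt (cdf D) (g' t) t

/-- The derivative of `maxPart`. -/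
def maxSlope (n : ℕ) (lam vs : ℝ) (D : Measure ℝ) (g' : ℝ → ℝ) (t : ℝ) : ℝ :=
  lam + (n - 1) * cdf D t - (Set.Iio vs).indicator (fun t => t * g' t) t

/-- The derivative of `-rivalPart`. -/
def rivalSlope (n : ℕ) (a vs : ℝ) (D : Measure ℝ) (g' : ℝ → ℝ) (t : ℝ) : ℝ :=
  cdf D t + (Set.Ici vs).indicator (fun t => (t - a) * g' t / n) t

namespace IsThresholdLaw

variable {D} {a b e vs : ℝ} {g' : ℝ → ℝ}

lemma intervalIntegrable (hD : IsThresholdLaw a b e D g') :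
    IntervalIntegrable g' volume a b := by
  have hnn : ∀ t ∈ Set.Ioo a b, t ≠ e → 0 ≤ g' t := fun t ht hte =>
    (hD.hasDerivAt t ht hte).nonneg_of_monotone (monotone_cdf D)
  have h1 : IntervalIntegrable g' volume a e := by
    rw [intervalIntegrable_iff_integrableOn_Ioc_of_le hD.mem_Icc.1]
    apply intervalIntegral.integrableOn_deriv_of_nonneg (g := cdf D)
      (hD.continuousOn.mono (Set.Icc_subset_Icc_right hD.mem_Icc.2))
    · exact fun x hx => hD.hasDerivAt x ⟨hx.1, hx.2.trans_le hD.mem_Icc.2⟩ hx.2.ne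
    · exact fun x hx => hnn x ⟨hx.1, hx.2.trans_le hD.mem_Icc.2⟩ hx.2.ne
  have h2 : IntervalIntegrable g' volume e b := by
    rw [intervalIntegrable_iff_integrableOn_Ioc_of_le hD.mem_Icc.2]
    apply intervalIntegral.integrableOn_deriv_of_nonneg (g := cdf D)
      (hD.continuousOn.mono (Set.Icc_subset_Icc_left hD.mem_Icc.1))
    · exact fun x hx => hD.hasDerivAt x ⟨hD.mem_Icc.1.trans_lt hx.1, hx.2⟩ hx.1.ne'
    · exact fun x hx => hnn x ⟨hD.mem_Icc.1.trans_lt hx.1, hx.2⟩ hx.1.ne'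
  exact h1.trans h2

lemma left_le_right (hD : IsThresholdLaw a b e D g') : a ≤ b := hD.mem_Icc.1.trans hD.mem_Icc.2

lemma intervalIntegrable_indicator {f : ℝ → ℝ} {s : Set ℝ} (hs : MeasurableSet s)
    (hf : IntervalIntegrable f volume a b) : IntervalIntegrable (s.indicator f) volume a b :=
  ⟨hf.1.indicator hs, hf.2.indicator hs⟩

lemma intervalIntegrable_maxSlope (hD : IsThresholdLaw a b e D g') (n : ℕ) (lam vs : ℝ) :
    IntervalIntegrable (maxSlope n lam vs D g') volume a b := by
  have h1 : IntervalIntegrable (cdf D : ℝ → ℝ) volume a b := (monotone_cdf D).intervalIntegrable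
  have h2 : IntervalIntegrable (fun t => t * g' t) volume a b :=
    hD.intervalIntegrable.continuousOn_mul continuousOn_id
  exact (intervalIntegrable_const.add (h1.const_mul _)).sub
    (intervalIntegrable_indicator measurableSet_Iio h2)

lemma intervalIntegrable_rivalSlope (hD : IsThresholdLaw a b e D g') (n : ℕ) (vs : ℝ) :
    IntervalIntegrable (rivalSlope n a vs D g') volume a b := by
  have h1 : IntervalIntegrable (cdf D : ℝ → ℝ) volume a b := (monotone_cdf D).intervalIntegrable
  have h2 : IntervalIntegrable (fun t => (t - a) * g' t / n) volume a b :=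
    (hD.intervalIntegrable.continuousOn_mul
      (g := fun t => t - a) (by fun_prop)).div_const _
  exact h1.add (intervalIntegrable_indicator measurableSet_Ici h2)

lemma continuousOn_poolProb (hD : IsThresholdLaw a b e D g') (hvs : vs ≤ b) :
    ContinuousOn (poolProb vs D) (Set.Icc a b) := by
  apply continuousOn_const.sub
  apply hD.continuousOn.comp (by fun_prop)
  intro t ht
  exact ⟨ht.1.trans (le_max_right _ _), max_le hvs ht.2⟩

lemma hasDerivAt_poolProb (hD : IsThresholdLaw a b e D g') {t : ℝ}
    (ht : t ∈ Set.Ioo a b) (hte : t ≠ e) (htv : t ≠ vs) :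
    HasDerivAt (poolProb vs D) (-(Set.Ici vs).indicator g' t) t := by
  rcases htv.lt_or_gt with h | h
  · rw [Set.indicator_of_notMem (by simpa using h), neg_zero]
    apply (hasDerivAt_const t (1 - cdf D vs)).congr_of_eventuallyEq
    filter_upwards [Iio_mem_nhds h] with y hy
    rw [poolProb, max_eq_left (Set.mem_Iio.1 hy).le]
  · rw [Set.indicator_of_mem (by simpa using h.le)]
    apply ((hD.hasDerivAt t ht hte).const_sub 1).congr_of_eventuallyEq
    filter_upwards [Ioi_mem_nhds h] with y hy
    rw [poolProb, max_eq_right (Set.mem_Ioi.1 hy).le]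

lemma continuousOn_integral_winProb [Nonempty (Fin n)] (hD : IsThresholdLaw a b e D g') :
    ContinuousOn (fun y => ∫ t in a..y, winProb n vs D t) (Set.Icc a b) := by
  have := intervalIntegral.continuousOn_primitive_interval (μ := volume) (a := a) (b := b)
    (f := winProb n vs D) (((monotone_winProb D vs).monotoneOn _).integrableOn_isCompact
      isCompact_uIcc)
  rwa [Set.uIcc_of_le hD.left_le_right] at this

lemma hasDerivAt_integral_winProb [Nonempty (Fin n)] (hD : IsThresholdLaw a b e D g') {t : ℝ}
    (ht : t ∈ Set.Ioo a b) (hte : t ≠ e) (htv : t ≠ vs) :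
    HasDerivAt (fun y => ∫ t in a..y, winProb n vs D t) (cdf D t + poolProb vs D t / n) t := by
  apply intervalIntegral.integral_hasDerivAt_right (f := winProb n vs D)
    (monotone_winProb D vs).intervalIntegrable
  · exact (monotone_winProb D vs).measurable.stronglyMeasurable.stronglyMeasurableAtFilter
  · exact (hD.hasDerivAt t ht hte).continuousAt.add
      ((hD.hasDerivAt_poolProb ht hte htv).continuousAt.div_const _)

lemma hasDerivAt_maxPart [Nonempty (Fin n)] (hD : IsThresholdLaw a b e D g') (lam : ℝ) {t : ℝ}
    (ht : t ∈ Set.Ioo a b) (hte : t ≠ e) (htv : t ≠ vs) :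
    HasDerivAt (maxPart n lam a vs D) (maxSlope n lam vs D g' t) t := by
  have hn : 0 < n := Fin.pos_iff_nonempty.2 ‹_›
  have hn' : (n : ℝ) ≠ 0 := by positivity
  have := (((hasDerivAt_id t).const_mul lam).sub ((hasDerivAt_id t).mul
    ((hD.hasDerivAt t ht hte).add (hD.hasDerivAt_poolProb ht hte htv)))).add
    ((hD.hasDerivAt_integral_winProb ht hte htv (n := n)).const_mul (n : ℝ))
  refine this.congr_deriv ?_
  simp only [id, maxSlope, Set.indicator, Set.mem_Ici, Set.mem_Iio]
  rcases htv.lt_or_gt with h | h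
  · rw [if_pos h, if_neg (not_le.2 h)]
    field_simp
    simp
    ring
  · rw [if_neg (not_lt.2 h.le), if_pos h.le]
    field_simp
    simp
    ring

lemma hasDerivAt_rivalPart [Nonempty (Fin n)] (hD : IsThresholdLaw a b e D g') {t : ℝ}
    (ht : t ∈ Set.Ioo a b) (hte : t ≠ e) (htv : t ≠ vs) :
    HasDerivAt (rivalPart n a vs D) (-rivalSlope n a vs D g' t) t := by
  have := ((((hasDerivAt_id t).sub_const a).mul
    (hD.hasDerivAt_poolProb ht hte htv)).div_const (n : ℝ)).sub
    (hD.hasDerivAt_integral_winProb ht hte htv (n := n))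
  refine this.congr_deriv ?_
  simp only [id, rivalSlope, Set.indicator, Set.mem_Ici]
  rcases htv.lt_or_gt with h | h
  · rw [if_neg (not_le.2 h), if_neg (not_le.2 h)]
    ring
  · rw [if_pos h.le, if_pos h.le]
    ring

lemma integral_slope (hD : IsThresholdLaw a b e D g') {N N' : ℝ → ℝ}
    (hc : ContinuousOn N (Set.Icc a b)) (hi : IntervalIntegrable N' volume a b)
    (hd : ∀ t ∈ Set.Ioo a b, t ≠ e → t ≠ vs → HasDerivAt N (N' t) t) :
    ∀ y ∈ Set.Icc a b, ∫ t in y..b, N' t = N b - N y := by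
  intro y hy
  apply integral_eq_of_hasDerivAt_off_countable_of_le N N' hy.2 (s := {e, vs})
    (Set.Countable.insert _ (Set.countable_singleton _))
    (hc.mono (Set.Icc_subset_Icc_left hy.1))
  · intro x hx
    simp only [Set.mem_sdiff, Set.mem_insert_iff, Set.mem_singleton_iff, not_or] at hx
    exact hd x ⟨hy.1.trans_lt hx.1.1, hx.1.2⟩ hx.2.1 hx.2.2
  · apply hi.mono_set
    rw [Set.uIcc_of_le hy.2, Set.uIcc_of_le hD.left_le_right]
    exact Set.Icc_subset_Icc_left hy.1

/-- The regret against the law with i.i.d. marginals `μ` is an integral over `t` of a polynomial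
in the value of the distribution function of `μ` at `t`. -/
lemma regret_unified {m : ℕ} (hD : IsThresholdLaw a b e D g') (hvs : vs ≤ b) (lam : ℝ)
    {μ : Measure ℝ} [IsProbabilityMeasure μ] (hμ : μ (Set.Icc a b)ᶜ = 0) :
    regret lam (unified (m + 1) a vs D) (Measure.pi fun _ : Fin (m + 1) => μ)
      = ((-(1 - lam) * b + ∫ t in a..b, ((m + 1) * rivalSlope (m + 1) a vs D g' t * cdf μ t ^ m
          - maxSlope (m + 1) lam vs D g' t * cdf μ t ^ (m + 1)) : ℝ) : EReal) := by
  have hP := hD.isProbabilityMeasure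
  have hbox := ae_pi_mem_box μ hμ (n := m + 1)
  have hab := hD.left_le_right
  have ha : a ∈ Set.Icc a b := ⟨le_rfl, hab⟩
  have hΓ := hD.continuousOn_integral_winProb (vs := vs) (n := m + 1)
  have hh := hD.continuousOn_poolProb hvs
  obtain ⟨hN1, hN2⟩ := integral_comp_eq_sub (Measure.pi fun _ : Fin (m + 1) => μ) measurable_vmax
    hab (by filter_upwards [hbox] with v hv using vmax_mem_Icc hv)
    (hD.intervalIntegrable_maxSlope (m + 1) lam vs)
    (hD.integral_slope (N := maxPart (m + 1) lam a vs D) (vs := vs)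
      (((by fun_prop : ContinuousOn (fun y : ℝ => lam * y) (Set.Icc a b)).sub
        (continuousOn_id.mul (hD.continuousOn.add hh))).add (continuousOn_const.mul hΓ))
      (hD.intervalIntegrable_maxSlope (m + 1) lam vs)
      (fun t ht hte htv => hD.hasDerivAt_maxPart lam ht hte htv))
  have hL := fun i : Fin (m + 1) =>
    integral_comp_eq_sub (Measure.pi fun _ : Fin (m + 1) => μ)
      (Y := fun v => vmax (Function.update v i a))
      (measurable_vmax.comp (measurable_update'.comp (measurable_id.prodMk measurable_const)))
      hab (by filter_upwards [hbox] with v hv using vmax_mem_Icc (update_mem_box hv i ha))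
      (hD.intervalIntegrable_rivalSlope (m + 1) vs).neg
      (hD.integral_slope (N := rivalPart (m + 1) a vs D) (vs := vs)
        ((((by fun_prop : ContinuousOn (fun y : ℝ => y - a) (Set.Icc a b)).mul hh).div_const _).sub
          hΓ)
        (hD.intervalIntegrable_rivalSlope (m + 1) vs).neg
        (fun t ht hte htv => hD.hasDerivAt_rivalPart ht hte htv))
  have hae : (fun v => lam * vmax v - ∑ i, (unified (m + 1) a vs D).p v i)
      =ᵐ[Measure.pi fun _ : Fin (m + 1) => μ] fun v => maxPart (m + 1) lam a vs D (vmax v)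
        + ∑ i, rivalPart (m + 1) a vs D (vmax (Function.update v i a)) := by
    filter_upwards [hbox] with v hv using regret_unified_expost D hv
  have hsumint := integrable_finsetSum Finset.univ fun i (_ : i ∈ Finset.univ) => (hL i).1
  rw [regret, expectation_congr hae]
  refine (expectation_eq_integral (hN1.add hsumint)).trans ?_
  rw [integral_add' hN1 hsumint, integral_finsetSum _ fun i _ => (hL i).1, hN2]
  have hLi : ∀ i : Fin (m + 1), ∫ v, rivalPart (m + 1) a vs D (vmax (Function.update v i a))
      ∂(Measure.pi fun _ : Fin (m + 1) => μ) = rivalPart (m + 1) a vs D b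
        + ∫ t in a..b, rivalSlope (m + 1) a vs D g' t * cdf μ t ^ m := by
    intro i
    rw [(hL i).2, sub_eq_add_neg, ← intervalIntegral.integral_neg]
    congr 1
    apply intervalIntegral.integral_congr
    intro t ht
    rw [Set.uIcc_of_le hab] at ht
    simp only [Pi.neg_apply]
    rw [real_pi_vmax_update_le μ i ht.1]
    ring
  simp only [hLi, real_pi_vmax_le]
  have hpow : ∀ {f : ℝ → ℝ} (k : ℕ), IntervalIntegrable f volume a b →
      IntervalIntegrable (fun t => f t * cdf μ t ^ k) volume a b :=
    fun k hf => intervalIntegrable_mul_cdf_pow μ k hf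
  have hsub := intervalIntegral.integral_sub
    ((hpow m (hD.intervalIntegrable_rivalSlope (m + 1) vs)).const_mul ((m : ℝ) + 1))
    (hpow (m + 1) (hD.intervalIntegrable_maxSlope (m + 1) lam vs))
  simp only [← mul_assoc] at hsub
  have hend : maxPart (m + 1) lam a vs D b + (m + 1) * rivalPart (m + 1) a vs D b
      = -(1 - lam) * b := by
    rw [maxPart, rivalPart, poolProb, max_eq_right hvs, hD.cdf_right]
    push_cast
    ring
  rw [hsub, ← hend]
  simp only [mul_assoc, intervalIntegral.integral_const_mul, Finset.sum_const, Finset.card_univ,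
    Fintype.card_fin, nsmul_eq_mul]
  rw [EReal.coe_eq_coe_iff]
  push_cast
  ring

end IsThresholdLaw

end UnifiedRegret

/-! ### Nature's best response -/

/-- Weighted AM-GM: the tangent line of `w ↦ w ^ (m + 1)` at `z` lies below the graph. -/
lemma pow_tangent_le (m : ℕ) {z w : ℝ} (hz : 0 ≤ z) (hw : 0 ≤ w) :
    (m + 1) * z ^ m * w - m * z ^ (m + 1) ≤ w ^ (m + 1) := by
  induction m with
  | zero => simp
  | succ m ih =>
    have h1 := mul_le_mul_of_nonneg_left ih hw
    have h2 : 0 ≤ ((m : ℝ) + 1) * z ^ m * (w - z) ^ 2 := by positivity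
    have h3 : w ^ (m + 1 + 1) = w * w ^ (m + 1) := by ring
    have h4 : z ^ (m + 1) = z ^ m * z := by ring
    have h5 : z ^ (m + 1 + 1) = z ^ m * z * z := by ring
    rw [h3]
    rw [h4] at h1
    push_cast
    rw [h5, h4]
    nlinarith

/-- The regret that both players can guarantee, when the worst-case law is `isoLaw c b φ`. -/
def isoValue (m : ℕ) (lam b c φ : ℝ) : ℝ :=
  -(1 - lam) * b + (b - φ) * ((b - c) / (b - φ)) ^ (m + 1)
    - lam * ∫ t in c..b, ((t - c) / (t - φ)) ^ (m + 1)

/-- The differential equations that make `isoLaw c b φ` a pointwise maximiser of the integrand of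
the regret: nothing is sold below `c`, and above `c` there is one equation where the threshold acts
as a reserve and one where it acts as a pooling threshold. -/
structure IsEqualizer (m : ℕ) (lam a b c φ vs e : ℝ) (D : Measure ℝ) (g' : ℝ → ℝ) : Prop where
  law : IsThresholdLaw a b e D g'
  vs_le : vs ≤ b
  left_le : a ≤ c
  lt_right : c < b
  virtual_lt : φ < c
  virtual_nonneg : 0 ≤ φ
  below : ∀ t ∈ Set.Ioo a c, t ≠ e → t < vs ∧ cdf D t = 0 ∧ g' t = 0
  reserve : ∀ t ∈ Set.Ioo c b, t ≠ e → t < vs →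
    φ = 0 ∧ (lam - t * g' t + m * cdf D t) * ((t - c) / (t - φ)) = m * cdf D t
  pooling : ∀ t ∈ Set.Ioo c b, t ≠ e → vs < t →
    c = a ∧ (lam + m * cdf D t) * ((t - c) / (t - φ)) = m * (cdf D t + (t - a) * g' t / (m + 1))

namespace IsEqualizer

variable {m : ℕ} {lam a b c φ vs e : ℝ} {D : Measure ℝ} {g' : ℝ → ℝ}

lemma slopes_below (h : IsEqualizer m lam a b c φ vs e D g') {t : ℝ} (ht : t ∈ Set.Ioo a c)
    (hte : t ≠ e) : rivalSlope (m + 1) a vs D g' t = 0 ∧ maxSlope (m + 1) lam vs D g' t = lam := by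
  obtain ⟨h1, h2, h3⟩ := h.below t ht hte
  simp [rivalSlope, maxSlope, Set.indicator, h1, not_le.2 h1, h2, h3]

lemma rivalSlope_nonneg (h : IsEqualizer m lam a b c φ vs e D g') {t : ℝ} (ht : t ∈ Set.Ioo a b)
    (hte : t ≠ e) : 0 ≤ rivalSlope (m + 1) a vs D g' t := by
  have h1 : 0 ≤ g' t := (h.law.hasDerivAt t ht hte).nonneg_of_monotone (monotone_cdf D)
  apply add_nonneg (cdf_nonneg D t)
  apply Set.indicator_apply_nonneg
  intro _
  have := ht.1
  have : 0 ≤ t - a := by linarith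
  positivity

lemma slopes_above (h : IsEqualizer m lam a b c φ vs e D g') {t : ℝ} (ht : t ∈ Set.Ioo c b)
    (hte : t ≠ e) (htv : t ≠ vs) :
    maxSlope (m + 1) lam vs D g' t * ((t - c) / (t - φ)) = m * rivalSlope (m + 1) a vs D g' t := by
  rcases htv.lt_or_gt with hv | hv
  · have := (h.reserve t ht hte hv).2
    simp only [rivalSlope, maxSlope, Set.indicator, Set.mem_Iio, Set.mem_Ici, hv, if_pos,
      not_le.2 hv, if_false]
    push_cast
    linear_combination this
  · have := (h.pooling t ht hte hv).2
    simp only [rivalSlope, maxSlope, Set.indicator, Set.mem_Iio, Set.mem_Ici, hv.le, if_pos,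
      not_lt.2 hv.le, if_false]
    push_cast
    linear_combination this

/-- On `(c, b)` the regret integrand at the equalizing value `w` of the distribution function. -/
lemma integrand_eq (h : IsEqualizer m lam a b c φ vs e D g') {t : ℝ} (ht : t ∈ Set.Ioo c b)
    (hte : t ≠ e) (htv : t ≠ vs) :
    (m + 1) * rivalSlope (m + 1) a vs D g' t * ((t - c) / (t - φ)) ^ m
        - maxSlope (m + 1) lam vs D g' t * ((t - c) / (t - φ)) ^ (m + 1)
      = rivalSlope (m + 1) a vs D g' t * ((t - c) / (t - φ)) ^ m := by
  have := h.slopes_above ht hte htv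
  rw [pow_succ]
  linear_combination -((t - c) / (t - φ)) ^ m * this

/-- The integrand is largest where the distribution function takes the equalizing value. -/
lemma integrand_le (h : IsEqualizer m lam a b c φ vs e D g') {t z : ℝ} (ht : t ∈ Set.Ioo c b)
    (hte : t ≠ e) (htv : t ≠ vs) (hz : 0 ≤ z) :
    (m + 1) * rivalSlope (m + 1) a vs D g' t * z ^ m
        - maxSlope (m + 1) lam vs D g' t * z ^ (m + 1)
      ≤ rivalSlope (m + 1) a vs D g' t * ((t - c) / (t - φ)) ^ m := by
  have h1 := h.slopes_above ht hte htv
  have h2 := h.rivalSlope_nonneg ⟨h.left_le.trans_lt ht.1, ht.2⟩ hte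
  have hc := ht.1
  have hφ := h.virtual_lt
  have hw : 0 < (t - c) / (t - φ) := div_pos (by linarith) (by linarith)
  generalize (t - c) / (t - φ) = w at *
  generalize rivalSlope (m + 1) a vs D g' t = A at *
  generalize maxSlope (m + 1) lam vs D g' t = N at *
  have h3 := mul_le_mul_of_nonneg_left (pow_tangent_le m hz hw.le) h2
  have h4 : ((m + 1) * A * z ^ m - N * z ^ (m + 1)) * w ≤ A * w ^ m * w := by
    have h5 : ((m + 1) * A * z ^ m - N * z ^ (m + 1)) * w
        = A * ((m + 1) * z ^ m * w - m * z ^ (m + 1)) := by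
      linear_combination -z ^ (m + 1) * h1
    rw [h5, mul_assoc A (w ^ m) w, ← pow_succ]
    exact h3
  exact le_of_mul_le_mul_right h4 hw

lemma cdf_isoLaw_of_lt (h : IsEqualizer m lam a b c φ vs e D g') {t : ℝ} (ht : t < c) :
    cdf (isoLaw c b φ) t = 0 := by
  rw [cdf_isoLaw h.virtual_lt h.lt_right, if_pos ht]

lemma cdf_isoLaw_of_mem (h : IsEqualizer m lam a b c φ vs e D g') {t : ℝ} (ht : t ∈ Set.Ioo c b) :
    cdf (isoLaw c b φ) t = (t - c) / (t - φ) := by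
  rw [cdf_isoLaw h.virtual_lt h.lt_right, if_neg (not_lt.2 ht.1.le), if_pos ht.2]

lemma intervalIntegrable_integrand (h : IsEqualizer m lam a b c φ vs e D g') (μ : Measure ℝ) :
    IntervalIntegrable (fun t => (m + 1) * rivalSlope (m + 1) a vs D g' t * cdf μ t ^ m
      - maxSlope (m + 1) lam vs D g' t * cdf μ t ^ (m + 1)) volume a b := by
  have h1 := intervalIntegrable_mul_cdf_pow μ m
    ((h.law.intervalIntegrable_rivalSlope (m + 1) vs).const_mul ((m : ℝ) + 1))
  have h2 := intervalIntegrable_mul_cdf_pow μ (m + 1)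
    (h.law.intervalIntegrable_maxSlope (m + 1) lam vs)
  exact h1.sub h2

lemma isoLaw_null (h : IsEqualizer m lam a b c φ vs e D g') :
    isoLaw c b φ (Set.Icc a b)ᶜ = 0 :=
  measure_mono_null (Set.compl_subset_compl.2 (Set.Icc_subset_Icc_left h.left_le))
    (isoLaw_compl_Icc h.lt_right.le)

lemma regret_le_regret_isoLaw (h : IsEqualizer m lam a b c φ vs e D g') (hlam : 0 ≤ lam)
    {μ : Measure ℝ} [IsProbabilityMeasure μ] (hμ : μ (Set.Icc a b)ᶜ = 0) :
    regret lam (unified (m + 1) a vs D) (Measure.pi fun _ : Fin (m + 1) => μ)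
      ≤ regret lam (unified (m + 1) a vs D) (Measure.pi fun _ : Fin (m + 1) => isoLaw c b φ) := by
  have hP := isProbabilityMeasure_isoLaw h.virtual_lt h.lt_right
  have hab := h.law.left_le_right
  rw [h.law.regret_unified h.vs_le lam hμ, h.law.regret_unified h.vs_le lam h.isoLaw_null,
    EReal.coe_le_coe_iff]
  apply add_le_add le_rfl
  rw [intervalIntegral.integral_of_le hab, intervalIntegral.integral_of_le hab]
  apply integral_mono_ae (h.intervalIntegrable_integrand μ).1
    (h.intervalIntegrable_integrand _).1
  have hne : ∀ x : ℝ, ∀ᵐ t ∂(volume.restrict (Set.Ioc a b)), t ≠ x := fun x =>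
    ae_restrict_of_ae (Measure.ae_ne volume x)
  filter_upwards [ae_restrict_mem measurableSet_Ioc, hne b, hne c, hne e, hne vs]
    with t ht htb htc hte htv
  have hzn := cdf_nonneg μ t
  rcases htc.lt_or_gt with hlt | hgt
  · obtain ⟨h1, h2⟩ := h.slopes_below ⟨ht.1, hlt⟩ hte
    rw [h1, h2, h.cdf_isoLaw_of_lt hlt]
    simp only [mul_zero, zero_mul, ne_eq, Nat.succ_ne_zero, not_false_eq_true, zero_pow,
      sub_zero, zero_sub]
    have : 0 ≤ lam * cdf μ t ^ (m + 1) := by positivity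
    linarith
  · have htm : t ∈ Set.Ioo c b := ⟨hgt, lt_of_le_of_ne ht.2 htb⟩
    rw [h.cdf_isoLaw_of_mem htm, h.integrand_eq htm hte htv]
    exact h.integrand_le htm hte htv hzn

/-- The function `(t - φ) w^(m+1) D(t)` is a primitive of the regret integrand plus
`λ w^(m+1)`. -/
lemma hasDerivAt_primitive (h : IsEqualizer m lam a b c φ vs e D g') {t : ℝ}
    (ht : t ∈ Set.Ioo c b) (hte : t ≠ e) (htv : t ≠ vs) :
    HasDerivAt (fun t => (t - φ) * ((t - c) / (t - φ)) ^ (m + 1) * cdf D t)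
      (rivalSlope (m + 1) a vs D g' t * ((t - c) / (t - φ)) ^ m
        + lam * ((t - c) / (t - φ)) ^ (m + 1)) t := by
  have hφt : t - φ ≠ 0 := by
    have := ht.1
    have := h.virtual_lt
    linarith
  have hm1 : (m : ℝ) + 1 ≠ 0 := by positivity
  have hd := h.law.hasDerivAt t ⟨h.left_le.trans_lt ht.1, ht.2⟩ hte
  have := (((hasDerivAt_id t).sub_const φ).mul ((hasDerivAt_ratio (c := c) hφt).pow (m + 1))).mul hd
  refine this.congr_deriv ?_
  have hw' : (t - φ) * ((c - φ) / (t - φ) ^ 2) = 1 - (t - c) / (t - φ) := by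
    field_simp
    ring
  have hw : (t - φ) * ((t - c) / (t - φ)) = t - c := by field_simp
  simp only [id, Pi.pow_apply, Pi.mul_apply, Nat.add_sub_cancel]
  push_cast
  rcases htv.lt_or_gt with hv | hv
  · obtain ⟨h0, h1⟩ := h.reserve t ht hte hv
    have h2 : rivalSlope (m + 1) a vs D g' t = cdf D t := by
      simp [rivalSlope, Set.indicator, not_le.2 hv]
    rw [h2]
    have h3 : (t - φ) * g' t = t * g' t := by rw [h0, sub_zero]
    generalize (t - c) / (t - φ) = w at *
    rw [pow_succ]
    linear_combination (m + 1) * w ^ m * cdf D t * hw' - w ^ m * h1 + w ^ m * w * h3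
  · obtain ⟨h0, h1⟩ := h.pooling t ht hte hv
    have h2 : rivalSlope (m + 1) a vs D g' t = cdf D t + (t - a) * g' t / (m + 1) := by
      simp [rivalSlope, Set.indicator, hv.le]
    have h3 : (m + 1) * (rivalSlope (m + 1) a vs D g' t - cdf D t) = (t - c) * g' t := by
      rw [h2, h0]
      field_simp
      ring
    rw [← h2] at h1
    generalize (t - c) / (t - φ) = w at *
    rw [pow_succ]
    linear_combination (m + 1) * w ^ m * cdf D t * hw' - w ^ m * h1 + w ^ m * g' t * hw
      - w ^ m * h3

lemma regret_isoLaw (h : IsEqualizer m lam a b c φ vs e D g') :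
    regret lam (unified (m + 1) a vs D) (Measure.pi fun _ : Fin (m + 1) => isoLaw c b φ)
      = ((isoValue m lam b c φ : ℝ) : EReal) := by
  have hP := isProbabilityMeasure_isoLaw h.virtual_lt h.lt_right
  have hab := h.law.left_le_right
  have hcb := h.lt_right.le
  rw [h.law.regret_unified h.vs_le lam h.isoLaw_null, EReal.coe_eq_coe_iff, isoValue]
  have hi := h.intervalIntegrable_integrand (isoLaw c b φ)
  have hcm : c ∈ Set.uIcc a b := by
    rw [Set.uIcc_of_le hab]
    exact ⟨h.left_le, hcb⟩
  have hi1 := hi.mono_set (Set.uIcc_subset_uIcc_left hcm)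
  have hi2 := hi.mono_set (Set.uIcc_subset_uIcc_right hcm)
  rw [← intervalIntegral.integral_add_adjacent_intervals hi1 hi2]
  have hne : ∀ x : ℝ, ∀ᵐ t ∂(volume : Measure ℝ), t ≠ x := fun x => Measure.ae_ne volume x
  have hleft : ∫ t in a..c, ((m + 1) * rivalSlope (m + 1) a vs D g' t * cdf (isoLaw c b φ) t ^ m
      - maxSlope (m + 1) lam vs D g' t * cdf (isoLaw c b φ) t ^ (m + 1)) = 0 := by
    rw [← intervalIntegral.integral_zero (a := a) (b := c) (μ := volume) (E := ℝ)]
    apply intervalIntegral.integral_congr_ae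
    filter_upwards [hne c, hne e] with t htc hte ht
    rw [Set.uIoc_of_le h.left_le] at ht
    have hlt := lt_of_le_of_ne ht.2 htc
    rw [(h.slopes_below ⟨ht.1, hlt⟩ hte).1, h.cdf_isoLaw_of_lt hlt]
    simp
  have hwc : ContinuousOn (fun t => lam * ((t - c) / (t - φ)) ^ (m + 1)) (Set.Icc c b) :=
    continuousOn_const.mul (((continuousOn_ratio h.virtual_lt).mono Set.Icc_subset_Ici_self).pow _)
  have hwi : IntervalIntegrable (fun t => lam * ((t - c) / (t - φ)) ^ (m + 1)) volume c b := by
    apply ContinuousOn.intervalIntegrable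
    rwa [Set.uIcc_of_le hcb]
  have hae : ∀ᵐ t ∂(volume : Measure ℝ), t ∈ Set.uIoc c b →
      ((m + 1) * rivalSlope (m + 1) a vs D g' t * cdf (isoLaw c b φ) t ^ m
        - maxSlope (m + 1) lam vs D g' t * cdf (isoLaw c b φ) t ^ (m + 1))
      = rivalSlope (m + 1) a vs D g' t * ((t - c) / (t - φ)) ^ m := by
    filter_upwards [hne b, hne e, hne vs] with t htb hte htv ht
    rw [Set.uIoc_of_le hcb] at ht
    have htm : t ∈ Set.Ioo c b := ⟨ht.1, lt_of_le_of_ne ht.2 htb⟩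
    rw [h.cdf_isoLaw_of_mem htm, h.integrand_eq htm hte htv]
  have hAi : IntervalIntegrable (fun t => rivalSlope (m + 1) a vs D g' t *
      ((t - c) / (t - φ)) ^ m) volume c b :=
    hi2.congr_ae ((ae_restrict_iff' measurableSet_uIoc).2 hae)
  have hU := integral_eq_of_hasDerivAt_off_countable_of_le
    (fun t => (t - φ) * ((t - c) / (t - φ)) ^ (m + 1) * cdf D t)
    (fun t => rivalSlope (m + 1) a vs D g' t * ((t - c) / (t - φ)) ^ m
        + lam * ((t - c) / (t - φ)) ^ (m + 1)) hcb (s := {e, vs})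
    (Set.Countable.insert _ (Set.countable_singleton _)) ?_ ?_ (hAi.add hwi)
  · rw [hleft, intervalIntegral.integral_congr_ae hae]
    rw [intervalIntegral.integral_add hAi hwi, intervalIntegral.integral_const_mul] at hU
    simp only [h.law.cdf_right, sub_self, zero_div, ne_eq, Nat.succ_ne_zero, not_false_eq_true,
      zero_pow, mul_zero, zero_mul, sub_zero, mul_one] at hU
    linarith
  · apply ContinuousOn.mul
    · exact (by fun_prop : ContinuousOn (fun t : ℝ => t - φ) _).mul
        (((continuousOn_ratio h.virtual_lt).mono Set.Icc_subset_Ici_self).pow _)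
    · exact h.law.continuousOn.mono (Set.Icc_subset_Icc_left h.left_le)
  · intro t ht
    simp only [Set.mem_sdiff, Set.mem_insert_iff, Set.mem_singleton_iff, not_or] at ht
    exact h.hasDerivAt_primitive ht.1 ht.2.1 ht.2.2

end IsEqualizer

/-! ### The seller's best response to a law with constant virtual value -/

section Envelope

variable {c b : ℝ} {x u : ℝ → ℝ}

lemma monotoneOn_of_subgradient
    (h : ∀ s ∈ Set.Icc c b, ∀ t ∈ Set.Icc c b, (t - s) * x s ≤ u t - u s) :
    MonotoneOn x (Set.Icc c b) := by
  intro s hs t ht hst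
  rcases hst.eq_or_lt with rfl | hlt
  · exact le_rfl
  · have h1 := h s hs t ht
    have h2 := h t ht s hs
    nlinarith

lemma continuousOn_of_subgradient
    (h : ∀ s ∈ Set.Icc c b, ∀ t ∈ Set.Icc c b, (t - s) * x s ≤ u t - u s)
    (h01 : ∀ s ∈ Set.Icc c b, x s ∈ Set.Icc (0 : ℝ) 1) : ContinuousOn u (Set.Icc c b) := by
  apply LipschitzOnWith.continuousOn (K := 1)
  apply LipschitzOnWith.of_le_add_mul
  intro s hs t ht
  have h1 := h s hs t ht
  have h2 := h01 s hs
  rw [Real.dist_eq, NNReal.coe_one, one_mul]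
  have h3 : (s - t) * x s ≤ |s - t| := by
    calc (s - t) * x s ≤ |s - t| * x s := mul_le_mul_of_nonneg_right (le_abs_self _) h2.1
      _ ≤ |s - t| * 1 := mul_le_mul_of_nonneg_left h2.2 (abs_nonneg _)
      _ = |s - t| := mul_one _
  linarith

lemma hasDerivAt_of_subgradient
    (h : ∀ s ∈ Set.Icc c b, ∀ t ∈ Set.Icc c b, (t - s) * x s ≤ u t - u s) {t : ℝ}
    (ht : t ∈ Set.Ioo c b) (hx : ContinuousWithinAt x (Set.Icc c b) t) :
    HasDerivAt u (x t) t := by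
  have hx' : ContinuousAt x t := hx.continuousAt (Icc_mem_nhds ht.1 ht.2)
  rw [hasDerivAt_iff_isLittleO, Asymptotics.isLittleO_iff]
  intro ε hε
  have h1 : ∀ᶠ s in nhds t, |x s - x t| < ε := by
    have := Metric.continuousAt_iff'.1 hx' ε hε
    simpa [Real.dist_eq] using this
  filter_upwards [h1, Icc_mem_nhds ht.1 ht.2] with s hs hsI
  have h2 := h t ⟨ht.1.le, ht.2.le⟩ s hsI
  have h3 := h s hsI t ⟨ht.1.le, ht.2.le⟩
  simp only [smul_eq_mul, Real.norm_eq_abs]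
  rw [abs_of_nonneg (by linarith)]
  calc u s - u t - (s - t) * x t ≤ (s - t) * (x s - x t) := by linarith
    _ ≤ |(s - t) * (x s - x t)| := le_abs_self _
    _ = |x s - x t| * |s - t| := by rw [abs_mul, mul_comm]
    _ ≤ ε * |s - t| := mul_le_mul_of_nonneg_right hs.le (abs_nonneg _)

/-- The envelope formula. -/
lemma integral_of_subgradient
    (h : ∀ s ∈ Set.Icc c b, ∀ t ∈ Set.Icc c b, (t - s) * x s ≤ u t - u s)
    (h01 : ∀ s ∈ Set.Icc c b, x s ∈ Set.Icc (0 : ℝ) 1) {t : ℝ} (ht : t ∈ Set.Icc c b) :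
    ∫ s in c..t, x s = u t - u c := by
  have hsub : Set.Icc c t ⊆ Set.Icc c b := Set.Icc_subset_Icc_right ht.2
  have hmono := monotoneOn_of_subgradient h
  apply integral_eq_of_hasDerivAt_off_countable_of_le u x ht.1
    hmono.countable_not_continuousWithinAt ((continuousOn_of_subgradient h h01).mono hsub)
  · intro s hs
    have hsb : s ∈ Set.Ioo c b := ⟨hs.1.1, hs.1.2.trans_le ht.2⟩
    apply hasDerivAt_of_subgradient h hsb
    by_contra hcon
    exact hs.2 ⟨⟨hsb.1.le, hsb.2.le⟩, hcon⟩
  · apply MonotoneOn.intervalIntegrable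
    rw [Set.uIcc_of_le ht.1]
    exact hmono.mono hsub

/-- The virtual value of `isoLaw c b φ`. -/
def virtualValue (b φ t : ℝ) : ℝ := if t < b then φ else b

lemma abs_virtualValue_mul_le {b φ t y : ℝ} (hy : y ∈ Set.Icc (0 : ℝ) 1) :
    |virtualValue b φ t * y| ≤ max |φ| |b| := by
  have h2 : |virtualValue b φ t| ≤ max |φ| |b| := by
    unfold virtualValue
    split_ifs
    · exact le_max_left _ _
    · exact le_max_right _ _
  rw [abs_mul, abs_of_nonneg hy.1]
  nlinarith [abs_nonneg (virtualValue b φ t), hy.1, hy.2]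

lemma measurable_virtualValue (b φ : ℝ) : Measurable (virtualValue b φ) :=
  Measurable.ite measurableSet_Iio measurable_const measurable_const

/-- Myerson's formula for one bidder: integration by parts of the envelope payment against the
law with survival function `(c - φ) / (t - φ)`. -/
lemma integral_envelope_isoLaw {φ : ℝ} (hcb : c < b) (hφ : φ < c) (hxm : Measurable x)
    (hEm : Measurable fun t => t * x t - ∫ s in c..t, x s)
    (h : ∀ s ∈ Set.Icc c b, ∀ t ∈ Set.Icc c b, (t - s) * x s ≤ u t - u s)
    (h01 : ∀ s ∈ Set.Icc c b, x s ∈ Set.Icc (0 : ℝ) 1) :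
    ∫ t, (t * x t - ∫ s in c..t, x s) ∂(isoLaw c b φ)
      = ∫ t, virtualValue b φ t * x t ∂(isoLaw c b φ) := by
  have hmono := monotoneOn_of_subgradient h
  have huc := continuousOn_of_subgradient h h01
  have hcm : c ∈ Set.Icc c b := ⟨le_rfl, hcb.le⟩
  have hbm : b ∈ Set.Icc c b := ⟨hcb.le, le_rfl⟩
  have hint : ∀ t ∈ Set.Icc c b, ∫ s in c..t, x s = u t - u c :=
    fun t ht => integral_of_subgradient h h01 ht
  have hbφ : 0 < b - φ := by linarith
  -- Both integrands are bounded on the support.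
  have hbd : ∀ t ∈ Set.Icc c b, |t * x t - ∫ s in c..t, x s| ≤ max |c| |b| + (b - c) := by
    intro t ht
    have h1 : |t * x t| ≤ max |c| |b| := by
      rw [abs_mul]
      have h2 := abs_le_max_abs_abs ht.1 ht.2
      have h3 : |x t| ≤ 1 := abs_le.2 ⟨by linarith [(h01 t ht).1], (h01 t ht).2⟩
      nlinarith [abs_nonneg t, abs_nonneg (x t)]
    have h4 : |∫ s in c..t, x s| ≤ b - c := by
      have h5 := h c hcm t ht
      have h6 := h t ht c hcm
      have h7 := h01 c hcm
      have h8 := h01 t ht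
      have h9 : 0 ≤ (t - c) * x c := mul_nonneg (by linarith [ht.1]) h7.1
      have h10 : (t - c) * x t ≤ (t - c) * 1 :=
        mul_le_mul_of_nonneg_left h8.2 (by linarith [ht.1])
      rw [hint t ht, abs_le]
      constructor <;> linarith [ht.2]
    exact (abs_sub _ _).trans (add_le_add h1 h4)
  have hbd2 : ∀ t ∈ Set.Icc c b, |virtualValue b φ t * x t| ≤ max |φ| |b| :=
    fun t ht => abs_virtualValue_mul_le (h01 t ht)
  rw [integral_isoLaw hφ hcb hEm hbd,
    integral_isoLaw hφ hcb (h := fun t => virtualValue b φ t * x t)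
      ((measurable_virtualValue b φ).mul hxm) hbd2]
  set f : ℝ → ℝ := fun t => (c - φ) / (t - φ) ^ 2 with hf
  have hfi := intervalIntegrable_isoDensity hφ le_rfl hcb.le (c := c)
  have hfc : ContinuousOn f (Set.Icc c b) :=
    (continuousOn_isoDensity hφ).mono Set.Icc_subset_Ici_self
  have hxi : IntervalIntegrable x volume c b := by
    apply MonotoneOn.intervalIntegrable
    rwa [Set.uIcc_of_le hcb.le]
  have huIcc : Set.uIcc c b = Set.Icc c b := Set.uIcc_of_le hcb.le
  have hS : ContinuousOn (fun t => (c - φ) / (t - φ)) (Set.Icc c b) := by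
    apply ContinuousOn.div (by fun_prop) (by fun_prop)
    intro t ht
    linarith [ht.1]
  have hderiv : ∀ t ∈ Set.Ioo c b, HasDerivAt (fun t => (c - φ) / (t - φ)) (-f t) t := by
    intro t ht
    have h1 : t - φ ≠ 0 := by linarith [ht.1]
    have := (hasDerivAt_const t (c - φ)).div ((hasDerivAt_id t).sub_const φ) h1
    refine this.congr_deriv ?_
    simp only [hf, id]
    field_simp
    ring
  have hi1 : IntervalIntegrable (fun t => (c - φ) / (t - φ) * x t) volume c b :=
    hxi.continuousOn_mul (by rwa [huIcc])
  have hi2 : IntervalIntegrable (fun t => f t * (u t - u c)) volume c b := by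
    apply ContinuousOn.intervalIntegrable
    rw [huIcc]
    exact hfc.mul (huc.sub continuousOn_const)
  have hparts := integral_eq_of_hasDerivAt_off_countable_of_le
    (fun t => (u t - u c) * ((c - φ) / (t - φ)))
    (fun t => (c - φ) / (t - φ) * x t - f t * (u t - u c)) hcb.le
    hmono.countable_not_continuousWithinAt ((huc.sub continuousOn_const).mul hS) ?_ (hi1.sub hi2)
  · have hl : ∫ t in c..b, f t * (t * x t - ∫ s in c..t, x s)
        = ∫ t in c..b, (φ * (f t * x t) + ((c - φ) / (t - φ) * x t - f t * (u t - u c))) := by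
      apply intervalIntegral.integral_congr
      intro t ht
      rw [huIcc] at ht
      simp only
      rw [hint t ht]
      have h1 : t - φ ≠ 0 := by linarith [ht.1]
      simp only [hf]
      field_simp
      ring
    have hr : ∫ t in c..b, f t * (virtualValue b φ t * x t)
        = ∫ t in c..b, φ * (f t * x t) := by
      apply intervalIntegral.integral_congr_uIoo
      intro t ht
      rw [Set.uIoo_of_le hcb.le] at ht
      simp only [virtualValue, if_pos ht.2]
      ring
    have hfx : IntervalIntegrable (fun t => φ * (f t * x t)) volume c b :=
      (hxi.continuousOn_mul (by rwa [huIcc])).const_mul φ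
    rw [hl, hr, intervalIntegral.integral_add hfx (hi1.sub hi2), hparts, hint b hbm]
    simp only [virtualValue, lt_irrefl, if_false, sub_self, zero_mul, sub_zero]
    ring
  · intro t ht
    have hd : HasDerivAt u (x t) t := by
      apply hasDerivAt_of_subgradient h ht.1
      by_contra hcon
      exact ht.2 ⟨⟨ht.1.1.le, ht.1.2.le⟩, hcon⟩
    refine ((hd.sub_const (u c)).mul (hderiv t ht.1)).congr_deriv ?_
    ring

end Envelope

/-- Resampling one coordinate of an i.i.d. vector does not change its law. -/
lemma measurePreserving_update {n : ℕ} (μ : Measure ℝ) [IsProbabilityMeasure μ] (i : Fin n) :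
    MeasurePreserving (fun q : (Fin n → ℝ) × ℝ => Function.update q.1 i q.2)
      ((Measure.pi fun _ : Fin n => μ).prod μ) (Measure.pi fun _ : Fin n => μ) := by
  refine ⟨measurable_update', (Measure.pi_eq fun s hs => ?_).symm⟩
  rw [Measure.map_apply measurable_update' (MeasurableSet.univ_pi hs)]
  have h : (fun q : (Fin n → ℝ) × ℝ => Function.update q.1 i q.2) ⁻¹' (Set.univ.pi s)
      = (Set.univ.pi fun j => if j = i then Set.univ else s j) ×ˢ s i := by
    ext q
    simp only [Set.mem_preimage, Set.mem_pi, Set.mem_univ, forall_const, Set.mem_prod]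
    constructor
    · intro hq
      refine ⟨fun j => ?_, by simpa using hq i⟩
      rcases eq_or_ne j i with rfl | hj
      · simp
      · simpa [hj] using hq j
    · rintro ⟨h1, h2⟩ j
      rcases eq_or_ne j i with rfl | hj
      · simpa using h2
      · simpa [hj] using h1 j
  rw [h, Measure.prod_prod, Measure.pi_pi, ← Finset.mul_prod_erase _ _ (Finset.mem_univ i),
    ← Finset.mul_prod_erase _ (fun j => μ (s j)) (Finset.mem_univ i)]
  have h2 : ∏ j ∈ Finset.univ.erase i, μ (if j = i then Set.univ else s j)
      = ∏ j ∈ Finset.univ.erase i, μ (s j) := by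
    apply Finset.prod_congr rfl
    intro j hj
    rw [if_neg (Finset.ne_of_mem_erase hj)]
  rw [h2]
  simp [mul_comm]

section Seller

variable {n : ℕ} {a b c φ : ℝ}

lemma dsic_subgradient {M : Mechanism n} (hM : M ∈ dsic n a b) (hac : a ≤ c)
    {v : Fin n → ℝ} (hv : v ∈ box n c b) (i : Fin n) :
    ∀ s ∈ Set.Icc c b, ∀ t ∈ Set.Icc c b,
      (t - s) * M.x (Function.update v i s) i
        ≤ (t * M.x (Function.update v i t) i - M.p (Function.update v i t) i)
          - (s * M.x (Function.update v i s) i - M.p (Function.update v i s) i) := by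
  intro s hs t ht
  have hI : Set.Icc c b ⊆ Set.Icc a b := Set.Icc_subset_Icc_left hac
  have hv' : v ∈ box n a b := fun j => hI (hv j)
  have h := hM.2.2.2.2.1 _ (update_mem_box hv' i (hI ht)) i s (hI hs)
  simp only [Function.update_idem, Function.update_self] at h
  linarith

/-- Individual rationality and the envelope formula bound the payments from above. -/
lemma payment_le_envelopePayment {M : Mechanism n} (hM : M ∈ dsic n a b) (hac : a ≤ c)
    {v : Fin n → ℝ} (hv : v ∈ box n c b) (i : Fin n) :
    M.p v i ≤ envelopePayment c M.x v i := by
  have hI : Set.Icc c b ⊆ Set.Icc a b := Set.Icc_subset_Icc_left hac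
  have hv' : v ∈ box n a b := fun j => hI (hv j)
  have hcm : c ∈ Set.Icc c b := ⟨le_rfl, (hv i).1.trans (hv i).2⟩
  have h1 := integral_of_subgradient (dsic_subgradient hM hac hv i)
    (fun s hs => hM.2.2.1 _ (update_mem_box hv' i (hI hs)) i) (hv i)
  have h2 := hM.2.2.2.1 _ (update_mem_box hv' i (hI hcm)) i
  simp only [Function.update_eq_self, Function.update_self] at h1 h2
  rw [envelopePayment, h1]
  linarith

lemma abs_envelopePayment_le {x : (Fin n → ℝ) → Fin n → ℝ} (hc : 0 ≤ c)
    (hx : ∀ v ∈ box n c b, ∀ i, x v i ∈ Set.Icc (0 : ℝ) 1) {v : Fin n → ℝ} (hv : v ∈ box n c b)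
    (i : Fin n) : |envelopePayment c x v i| ≤ b + (b - c) := by
  have h1 : ‖∫ t in c..(v i), x (Function.update v i t) i‖ ≤ 1 * |v i - c| := by
    apply intervalIntegral.norm_integral_le_of_norm_le_const
    intro t ht
    rw [Set.uIoc_of_le (hv i).1] at ht
    have := hx _ (update_mem_box hv i ⟨ht.1.le, ht.2.trans (hv i).2⟩) i
    rw [Real.norm_eq_abs, abs_of_nonneg this.1]
    exact this.2
  rw [one_mul, Real.norm_eq_abs, abs_of_nonneg (by linarith [(hv i).1] : 0 ≤ v i - c)] at h1
  have h2 := hx v hv i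
  have h3 : |v i * x v i| ≤ b := by
    have hv0 : 0 ≤ v i := hc.trans (hv i).1
    rw [abs_of_nonneg (mul_nonneg hv0 h2.1)]
    nlinarith [(hv i).2, h2.2]
  have h4 := (hv i).2
  exact (abs_sub _ _).trans (add_le_add h3 (by linarith))

/-- The expected envelope payment of one bidder is the expected virtual surplus. -/
lemma integral_envelopePayment {M : Mechanism n} (hM : M ∈ dsic n a b) (hac : a ≤ c)
    (hcb : c < b) (hφ : φ < c) (hc : 0 ≤ c) (i : Fin n) :
    ∫ v, envelopePayment c M.x v i ∂(Measure.pi fun _ : Fin n => isoLaw c b φ)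
      = ∫ v, virtualValue b φ (v i) * M.x v i ∂(Measure.pi fun _ : Fin n => isoLaw c b φ) := by
  have hP := isProbabilityMeasure_isoLaw hφ hcb
  have hI : Set.Icc c b ⊆ Set.Icc a b := Set.Icc_subset_Icc_left hac
  have h01 : ∀ v ∈ box n c b, ∀ i, M.x v i ∈ Set.Icc (0 : ℝ) 1 :=
    fun v hv i => hM.2.2.1 v (fun j => hI (hv j)) i
  have hbox := ae_pi_mem_box (isoLaw c b φ) (isoLaw_compl_Icc hcb.le) (n := n)
  have hxi : Measurable fun v => M.x v i := (measurable_pi_apply i).comp hM.1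
  have hpi : Measurable fun v => envelopePayment c M.x v i := by
    by_cases hn : Nonempty (Fin n)
    · exact (measurable_pi_apply i).comp (measurable_envelopePayment c hM.1)
    · exact absurd ⟨i⟩ hn
  have hvx : Measurable fun v : Fin n → ℝ => virtualValue b φ (v i) * M.x v i :=
    ((measurable_virtualValue b φ).comp (measurable_pi_apply i)).mul hxi
  have hmp := measurePreserving_update (isoLaw c b φ) i
  have hresample : ∀ g : (Fin n → ℝ) → ℝ, Measurable g → (∃ C, ∀ v ∈ box n c b, |g v| ≤ C) →
      ∫ v, g v ∂(Measure.pi fun _ : Fin n => isoLaw c b φ)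
        = ∫ v, ∫ t, g (Function.update v i t) ∂(isoLaw c b φ)
            ∂(Measure.pi fun _ : Fin n => isoLaw c b φ) := by
    rintro g hg ⟨C, hC⟩
    have hgi : Integrable g (Measure.pi fun _ : Fin n => isoLaw c b φ) := by
      apply Integrable.of_bound hg.aestronglyMeasurable C
      filter_upwards [hbox] with v hv using hC v hv
    have h1 : Integrable (fun q : (Fin n → ℝ) × ℝ => g (Function.update q.1 i q.2))
        ((Measure.pi fun _ : Fin n => isoLaw c b φ).prod (isoLaw c b φ)) :=
      (hmp.integrable_comp hg.aestronglyMeasurable).2 hgi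
    rw [← integral_prod _ h1]
    conv_lhs => rw [← hmp.map_eq]
    rw [integral_map hmp.measurable.aemeasurable hg.aestronglyMeasurable]
  rw [hresample _ hpi ⟨_, fun v hv => abs_envelopePayment_le hc h01 hv i⟩,
    hresample _ hvx ⟨max |φ| |b|, fun v hv => abs_virtualValue_mul_le (h01 v hv i)⟩]
  apply integral_congr_ae
  filter_upwards [hbox] with v hv
  have hxu : Measurable fun t => M.x (Function.update v i t) i :=
    hxi.comp (measurable_update v)
  have hEm : Measurable fun t => t * M.x (Function.update v i t) i
      - ∫ s in c..t, M.x (Function.update v i s) i := by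
    have h1 : Measurable fun t => envelopePayment c M.x (Function.update v i t) i :=
      hpi.comp (measurable_update v)
    simpa only [envelopePayment, Function.update_idem, Function.update_self] using h1
  have h := integral_envelope_isoLaw hcb hφ hxu hEm (dsic_subgradient hM hac hv i)
    (fun s hs => h01 _ (update_mem_box hv i hs) i)
  simpa only [envelopePayment, Function.update_idem, Function.update_self] using h

lemma isoLaw_real_Iio (hcb : c < b) (hφ : φ < c) :
    (isoLaw c b φ).real (Set.Iio b) = (b - c) / (b - φ) := by
  have h : Set.Iio b ∩ Set.Ioc c b = Set.Ioo c b := by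
    ext x
    simp only [Set.mem_inter_iff, Set.mem_Iio, Set.mem_Ioc, Set.mem_Ioo]
    exact ⟨fun hx => ⟨hx.2.1, hx.1⟩, fun hx => ⟨hx.2, hx.1, hx.2.le⟩⟩
  rw [measureReal_def, isoLaw_apply measurableSet_Iio, h, setLIntegral_congr Ioo_ae_eq_Ioc,
    lintegral_isoDensity hφ hcb.le, Measure.dirac_apply' _ measurableSet_Iio]
  simp only [Set.mem_Iio, lt_irrefl, not_false_eq_true, Set.indicator_of_notMem, mul_zero,
    add_zero]
  exact ENNReal.toReal_ofReal (div_nonneg (by linarith) (by linarith))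

lemma sum_virtualValue_le {x : Fin n → ℝ} [Nonempty (Fin n)] (hφ : 0 ≤ φ) (hφb : φ ≤ b)
    {v : Fin n → ℝ} (hx : ∀ i, 0 ≤ x i) (hsum : ∑ i, x i ≤ 1) :
    ∑ i, virtualValue b φ (v i) * x i ≤ virtualValue b φ (vmax v) := by
  have h0 : 0 ≤ virtualValue b φ (vmax v) := by
    unfold virtualValue
    split_ifs <;> linarith
  have h1 : ∀ i, virtualValue b φ (v i) ≤ virtualValue b φ (vmax v) := by
    intro i
    have := le_vmax v i
    unfold virtualValue
    split_ifs <;> linarith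
  calc ∑ i, virtualValue b φ (v i) * x i ≤ ∑ i, virtualValue b φ (vmax v) * x i :=
        Finset.sum_le_sum fun i _ => mul_le_mul_of_nonneg_right (h1 i) (hx i)
    _ = virtualValue b φ (vmax v) * ∑ i, x i := by rw [Finset.mul_sum]
    _ ≤ virtualValue b φ (vmax v) := mul_le_of_le_one_right h0 hsum

lemma integral_virtualValue_vmax {m : ℕ} (hcb : c < b) (hφ : φ < c) :
    Integrable (fun v => virtualValue b φ (vmax v))
        (Measure.pi fun _ : Fin (m + 1) => isoLaw c b φ) ∧
      ∫ v, virtualValue b φ (vmax v) ∂(Measure.pi fun _ : Fin (m + 1) => isoLaw c b φ)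
        = b - (b - φ) * ((b - c) / (b - φ)) ^ (m + 1) := by
  have hP := isProbabilityMeasure_isoLaw hφ hcb
  have hS : MeasurableSet {v : Fin (m + 1) → ℝ | vmax v < b} :=
    measurableSet_lt measurable_vmax measurable_const
  have h1 : (fun v : Fin (m + 1) → ℝ => virtualValue b φ (vmax v))
      = fun v => b - {v : Fin (m + 1) → ℝ | vmax v < b}.indicator (fun _ => b - φ) v := by
    funext v
    by_cases h : vmax v < b
    · simp [virtualValue, Set.indicator, h]
    · simp [virtualValue, Set.indicator, h]
  have hset : {v : Fin (m + 1) → ℝ | vmax v < b} = Set.univ.pi fun _ => Set.Iio b := by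
    ext v
    simp only [Set.mem_ofPred_eq, Set.mem_pi, Set.mem_univ, forall_const, Set.mem_Iio]
    constructor
    · exact fun h i => (le_vmax v i).trans_lt h
    · intro h
      obtain ⟨i, hi⟩ := exists_eq_vmax v
      rw [← hi]
      exact h i
  have hreal : (Measure.pi fun _ : Fin (m + 1) => isoLaw c b φ).real
      {v : Fin (m + 1) → ℝ | vmax v < b} = ((b - c) / (b - φ)) ^ (m + 1) := by
    rw [hset, ← isoLaw_real_Iio hcb hφ, measureReal_def, measureReal_def, Measure.pi_pi]
    simp
  have hind : Integrable ({v : Fin (m + 1) → ℝ | vmax v < b}.indicator (fun _ => b - φ))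
      (Measure.pi fun _ : Fin (m + 1) => isoLaw c b φ) := (integrable_const _).indicator hS
  rw [h1]
  refine ⟨(integrable_const _).sub hind, ?_⟩
  rw [integral_sub (integrable_const _) hind, integral_indicator_const _ hS, hreal]
  simp [mul_comm]

/-- Against `isoLaw c b φ` no mechanism has regret below `isoValue`: its expected payments are
at most the expected highest virtual value. -/
lemma isoValue_le_regret {m : ℕ} {M : Mechanism (m + 1)} (hM : M ∈ dsic (m + 1) a b) (hac : a ≤ c)
    (hcb : c < b) (hφ : φ < c) (hφ0 : 0 ≤ φ) (lam : ℝ) :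
    ((isoValue m lam b c φ : ℝ) : EReal)
      ≤ regret lam M (Measure.pi fun _ : Fin (m + 1) => isoLaw c b φ) := by
  have hP := isProbabilityMeasure_isoLaw hφ hcb
  have hc : 0 ≤ c := hφ0.trans hφ.le
  have hI : Set.Icc c b ⊆ Set.Icc a b := Set.Icc_subset_Icc_left hac
  have hbox := ae_pi_mem_box (isoLaw c b φ) (isoLaw_compl_Icc hcb.le) (n := m + 1)
  have h01 : ∀ v ∈ box (m + 1) c b, ∀ i, M.x v i ∈ Set.Icc (0 : ℝ) 1 :=
    fun v hv i => hM.2.2.1 v (fun j => hI (hv j)) i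
  obtain ⟨hmi, hmv⟩ := integral_comp_eq_sub (Measure.pi fun _ : Fin (m + 1) => isoLaw c b φ)
    measurable_vmax hcb.le (by filter_upwards [hbox] with v hv using vmax_mem_Icc hv)
    (N := fun y => y) (N' := fun _ => 1) intervalIntegrable_const (fun y _ => by simp)
  have hEi : ∀ i : Fin (m + 1), Integrable (fun v => envelopePayment c M.x v i)
      (Measure.pi fun _ : Fin (m + 1) => isoLaw c b φ) := by
    intro i
    apply Integrable.of_bound ((measurable_pi_apply i).comp
      (measurable_envelopePayment c hM.1)).aestronglyMeasurable (b + (b - c))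
    filter_upwards [hbox] with v hv using abs_envelopePayment_le hc h01 hv i
  have hvx : ∀ i : Fin (m + 1), Integrable (fun v => virtualValue b φ (v i) * M.x v i)
      (Measure.pi fun _ : Fin (m + 1) => isoLaw c b φ) := by
    intro i
    apply Integrable.of_bound (((measurable_virtualValue b φ).comp
      (measurable_pi_apply i)).mul
      ((measurable_pi_apply i).comp hM.1)).aestronglyMeasurable (max |φ| |b|)
    filter_upwards [hbox] with v hv using abs_virtualValue_mul_le (h01 v hv i)
  obtain ⟨hwi, hwv⟩ := integral_virtualValue_vmax (m := m) hcb hφ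
  have hsumE := integrable_finsetSum Finset.univ fun i (_ : i ∈ Finset.univ) => hEi i
  have hle : ∫ v, ∑ i, virtualValue b φ (v i) * M.x v i
      ∂(Measure.pi fun _ : Fin (m + 1) => isoLaw c b φ)
      ≤ b - (b - φ) * ((b - c) / (b - φ)) ^ (m + 1) := by
    rw [← hwv]
    apply integral_mono_ae (integrable_finsetSum Finset.univ fun i _ => hvx i) hwi
    filter_upwards [hbox] with v hv
    exact sum_virtualValue_le hφ0 (hφ.le.trans hcb.le) (fun i => (h01 v hv i).1)
      (hM.2.2.2.2.2 v fun j => hI (hv j))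
  have hval : ∫ v, (lam * vmax v - ∑ i, envelopePayment c M.x v i)
      ∂(Measure.pi fun _ : Fin (m + 1) => isoLaw c b φ)
      = lam * (b - ∫ t in c..b, ((t - c) / (t - φ)) ^ (m + 1))
        - ∫ v, ∑ i, virtualValue b φ (v i) * M.x v i
          ∂(Measure.pi fun _ : Fin (m + 1) => isoLaw c b φ) := by
    rw [integral_sub (hmi.const_mul lam) hsumE, integral_const_mul, hmv,
      integral_finsetSum _ fun i _ => hEi i, integral_finsetSum _ fun i _ => hvx i]
    congr 1
    · congr 2
      apply intervalIntegral.integral_congr_uIoo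
      intro t ht
      rw [Set.uIoo_of_le hcb.le] at ht
      simp only [real_pi_vmax_le, one_mul]
      rw [cdf_isoLaw hφ hcb, if_neg (not_lt.2 ht.1.le), if_pos ht.2]
    · exact Finset.sum_congr rfl fun i _ => integral_envelopePayment hM hac hcb hφ hc i
  have hexp := expectation_eq_integral ((hmi.const_mul lam).sub hsumE)
  have hmono : expectation (Measure.pi fun _ : Fin (m + 1) => isoLaw c b φ)
      (fun v => lam * vmax v - ∑ i, envelopePayment c M.x v i)
      ≤ regret lam M (Measure.pi fun _ : Fin (m + 1) => isoLaw c b φ) := by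
    apply expectation_mono
    filter_upwards [hbox] with v hv
    have := Finset.sum_le_sum fun i (_ : i ∈ Finset.univ) =>
      payment_le_envelopePayment hM hac hv i
    linarith
  refine le_trans ?_ (hexp.symm.le.trans hmono)
  rw [EReal.coe_le_coe_iff]
  simp only [Pi.sub_apply]
  rw [hval, isoValue]
  linarith

end Seller

/-! ### Saddle points and the minimax regret -/

lemma minimaxRegret_eq_of_isSaddlePoint {n : ℕ} {lam a b : ℝ} {M : Mechanism n}
    {P : Measure (Fin n → ℝ)} (h : IsSaddlePoint n lam a b M P) :
    minimaxRegret n lam a b = regret lam M P := by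
  obtain ⟨hM, hP, h1, h2⟩ := h
  apply le_antisymm
  · exact (iInf₂_le M hM).trans (iSup₂_le h1)
  · exact le_iInf₂ fun M' hM' => (h2 M' hM').trans
      (le_iSup₂ (f := fun Q (_ : Q ∈ iidLaws n a b) => regret lam M' Q) P hP)

lemma IsEqualizer.isSaddlePoint {m : ℕ} {lam a b c φ vs e : ℝ} {D : Measure ℝ} {g' : ℝ → ℝ}
    (h : IsEqualizer m lam a b c φ vs e D g') (hlam : 0 ≤ lam) :
    IsSaddlePoint (m + 1) lam a b (unified (m + 1) a vs D)
        (Measure.pi fun _ : Fin (m + 1) => isoLaw c b φ) ∧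
      minimaxRegret (m + 1) lam a b = ((isoValue m lam b c φ : ℝ) : EReal) := by
  have hD := h.law.isProbabilityMeasure
  have hP := isProbabilityMeasure_isoLaw h.virtual_lt h.lt_right
  have hs : IsSaddlePoint (m + 1) lam a b (unified (m + 1) a vs D)
      (Measure.pi fun _ : Fin (m + 1) => isoLaw c b φ) := by
    refine ⟨unified_mem_dsic D a b vs, ⟨isoLaw c b φ, hP, h.isoLaw_null, rfl⟩, ?_, ?_⟩
    · rintro Q ⟨μ, hμ, hμn, rfl⟩
      exact h.regret_le_regret_isoLaw hlam hμn
    · intro M hM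
      rw [h.regret_isoLaw]
      exact isoValue_le_regret hM h.left_le h.lt_right h.virtual_lt h.virtual_nonneg lam
  exact ⟨hs, (minimaxRegret_eq_of_isSaddlePoint hs).trans h.regret_isoLaw⟩

lemma IsLawWithCDF.isThresholdLaw {a b e : ℝ} {D : Measure ℝ} {G g' : ℝ → ℝ}
    (h : IsLawWithCDF a b D G) (he : e ∈ Set.Icc a b) (hb : G b = 1)
    (hc : ContinuousOn G (Set.Icc a b))
    (hd : ∀ t ∈ Set.Ioo a b, t ≠ e → HasDerivAt G (g' t) t) : IsThresholdLaw a b e D g' where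
  isProbabilityMeasure := h.1
  mem_Icc := he
  cdf_right := (h.2.2 b ⟨he.1.trans he.2, le_rfl⟩).trans hb
  continuousOn := hc.congr h.2.2
  hasDerivAt := fun t ht hte => (hd t ht hte).congr_of_eventuallyEq (by
    filter_upwards [Icc_mem_nhds ht.1 ht.2] with y hy using h.2.2 y hy)

/-- The law `isoLaw c b φ` as a law on a larger interval `[a, b]`. -/
lemma isLawWithCDF_isoLaw {a b c φ : ℝ} (hac : a ≤ c) (hcb : c < b) (hφ : φ < c) :
    IsLawWithCDF a b (isoLaw c b φ)
      (fun v => if v < c then 0 else if v < b then (v - c) / (v - φ) else 1) :=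
  ⟨isProbabilityMeasure_isoLaw hφ hcb,
    measure_mono_null (Set.compl_subset_compl.2 (Set.Icc_subset_Icc_left hac))
      (isoLaw_compl_Icc hcb.le), fun v _ => cdf_isoLaw hφ hcb v⟩

/-! ### Solutions of the threshold equations -/

lemma monotoneOn_ratio {c φ : ℝ} (hφ : φ < c) :
    MonotoneOn (fun t => (t - c) / (t - φ)) (Set.Ici c) := by
  intro s hs t ht hst
  have hs' : c ≤ s := hs
  have ht' : c ≤ t := ht
  simp only
  rw [div_le_div_iff₀ (by linarith) (by linarith)]
  nlinarith

lemma continuousOn_betaRatio_ratio (m : ℕ) {c φ : ℝ} (hφ : φ < c) :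
    ContinuousOn (fun t => betaRatio m ((t - c) / (t - φ))) (Set.Ici c) :=
  (continuousOn_betaRatio m).comp (continuousOn_ratio hφ) fun _ ht => ratio_mem_Ico hφ ht

lemma monotoneOn_betaRatio_ratio (m : ℕ) {c φ : ℝ} (hφ : φ < c) :
    MonotoneOn (fun t => betaRatio m ((t - c) / (t - φ))) (Set.Ici c) := by
  intro s hs t ht hst
  exact (betaRatio_strictMonoOn m).monotoneOn (ratio_mem_Ico hφ hs) (ratio_mem_Ico hφ ht)
    (monotoneOn_ratio hφ hs ht hst)

/-- The general solution of the linear equation for the threshold distribution. -/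
lemma hasDerivAt_thresholdCDF (k : ℕ) (κ ν : ℝ) {c φ t : ℝ} (hφ : φ < c) (ht : c < t) :
    HasDerivAt (fun t => (κ + ν * betaInt k ((t - c) / (t - φ))) / ((t - c) / (t - φ)) ^ k)
      (ν / (t - φ) - k * (c - φ) / ((t - φ) * (t - c))
        * ((κ + ν * betaInt k ((t - c) / (t - φ))) / ((t - c) / (t - φ)) ^ k)) t := by
  have h1 : t - φ ≠ 0 := by linarith
  have h2 : t - c ≠ 0 := by linarith
  have h3 : c - φ ≠ 0 := by linarith
  have hw : (t - c) / (t - φ) ≠ 0 := div_ne_zero h2 h1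
  have := (((hasDerivAt_betaInt_ratio k hφ (hφ.trans ht)).const_mul ν).const_add κ).div
    ((hasDerivAt_ratio (c := c) h1).pow k) (pow_ne_zero k hw)
  refine this.congr_deriv ?_
  simp only [Pi.pow_apply]
  generalize betaInt k ((t - c) / (t - φ)) = B
  rcases k with _ | k
  · simp
    field_simp
  · simp only [Nat.add_sub_cancel, div_pow]
    push_cast
    field_simp
    ring

lemma betaRatio_eq_thresholdCDF (k : ℕ) (ν w : ℝ) :
    ν * betaRatio k w = (0 + ν * betaInt k w) / w ^ k := by
  rw [betaRatio]
  ring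

/-! ### Low relative support information -/

lemma lowReserveCDF_eq (m : ℕ) (lam : ℝ) {rs v : ℝ} (hrs : 0 < rs) :
    lowReserveCDF (m + 1) lam rs v = lam * betaRatio m ((max v rs - rs) / (max v rs - 0)) := by
  unfold lowReserveCDF
  split_ifs with h
  · rw [max_eq_right h.le]
    simp
  · have h' := not_lt.1 h
    rw [max_eq_left h', Nat.add_sub_cancel, integral_ratio_zero_eq m hrs le_rfl h', betaRatio,
      div_pow]
    simp only [sub_self, zero_div, betaInt_zero, sub_zero]
    rw [mul_assoc, ← mul_div_right_comm, mul_comm (v ^ m), div_div_eq_mul_div]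

/-- With `v* = b` every threshold acts as a reserve. -/
lemma exists_lowEqualizer (m : ℕ) {lam kl a b : ℝ} (hlam : 0 < lam)
    (hl : IsLowCutoff (m + 1) lam kl) (ha : 0 ≤ a) (hab : a < b) (h : a / b ≤ kl) :
    ∃ (Φ : Measure ℝ) (g' : ℝ → ℝ),
      IsLawWithCDF a b Φ (lowReserveCDF (m + 1) lam (kl * b)) ∧
      IsEqualizer m lam a b (kl * b) 0 b (kl * b) Φ g' := by
  have hb : 0 < b := ha.trans_lt hab
  set rs := kl * b with hrs
  have hk := hl.1
  have hrs0 : 0 < rs := mul_pos hk.1 hb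
  have hrsb : rs < b := by nlinarith [hk.2]
  have hars : a ≤ rs := (div_le_iff₀ hb).1 h
  have hmaps : Set.MapsTo (fun v => max v rs) (Set.Icc a b) (Set.Ici rs) :=
    fun v _ => Set.mem_Ici.2 (le_max_right v rs)
  have hGeq : lowReserveCDF (m + 1) lam rs
      = fun v => lam * betaRatio m ((max v rs - rs) / (max v rs - 0)) :=
    funext fun v => lowReserveCDF_eq m lam hrs0
  have hc : ContinuousOn (lowReserveCDF (m + 1) lam rs) (Set.Icc a b) := by
    rw [hGeq]
    exact continuousOn_const.mul
      ((continuousOn_betaRatio_ratio m hrs0).comp (by fun_prop) hmaps)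
  have hm : MonotoneOn (lowReserveCDF (m + 1) lam rs) (Set.Icc a b) := by
    intro s hs t ht hst
    rw [hGeq]
    exact mul_le_mul_of_nonneg_left (monotoneOn_betaRatio_ratio m hrs0 (hmaps hs) (hmaps ht)
      (max_le_max_right rs hst)) hlam.le
  have h0 : 0 ≤ lowReserveCDF (m + 1) lam rs a := by
    rw [hGeq]
    have := ratio_mem_Ico hrs0 (le_max_right a rs)
    exact mul_nonneg hlam.le (betaRatio_nonneg m this.1 this.2)
  have h1 : lowReserveCDF (m + 1) lam rs b = 1 := by
    have hq : (b - rs) / (b - 0) = 1 - kl := by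
      rw [hrs, sub_zero, sub_div, mul_div_assoc, div_self hb.ne', mul_one]
    simp only [hGeq]
    rw [max_eq_left hrsb.le, hq]
    exact (isLowCutoff_iff m hk).1 hl
  obtain ⟨Φ, hΦ⟩ := exists_isLawWithCDF hab hc hm h0 h1
  set G := lowReserveCDF (m + 1) lam rs with hG
  refine ⟨Φ, fun t => if t < rs then 0 else lam / (t - 0) - m * (rs - 0) / ((t - 0) * (t - rs))
    * G t, hΦ, ?_⟩
  have hder : ∀ t ∈ Set.Ioo a b, t ≠ rs → HasDerivAt G
      (if t < rs then 0 else lam / (t - 0) - m * (rs - 0) / ((t - 0) * (t - rs)) * G t) t := by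
    intro t ht hte
    rcases hte.lt_or_gt with hlt | hgt
    · rw [if_pos hlt]
      apply (hasDerivAt_const t (0 : ℝ)).congr_of_eventuallyEq
      filter_upwards [Iio_mem_nhds hlt] with y hy
      exact if_pos hy
    · rw [if_neg (not_lt.2 hgt.le)]
      have hGt : ∀ y, rs < y → G y = (0 + lam * betaInt m ((y - rs) / (y - 0)))
          / ((y - rs) / (y - 0)) ^ m := by
        intro y hy
        rw [hGeq, ← betaRatio_eq_thresholdCDF]
        simp only [max_eq_left hy.le]
      rw [hGt t hgt]
      apply (hasDerivAt_thresholdCDF m 0 lam hrs0 hgt).congr_of_eventuallyEq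
      filter_upwards [Ioi_mem_nhds hgt] with y hy using hGt y hy
  exact {
    law := hΦ.isThresholdLaw ⟨hars, hrsb.le⟩ h1 hc hder
    vs_le := le_rfl
    left_le := hars
    lt_right := hrsb
    virtual_lt := hrs0
    virtual_nonneg := le_rfl
    below := fun t ht _ => ⟨ht.2.trans hrsb, by
      rw [hΦ.2.2 t ⟨ht.1.le, (ht.2.trans hrsb).le⟩]
      exact if_pos ht.2, if_pos ht.2⟩
    reserve := fun t ht _ _ => ⟨rfl, by
      have h2 : t - rs ≠ 0 := by linarith [ht.1]
      have h3 : t ≠ 0 := by linarith [ht.1]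
      rw [hΦ.2.2 t ⟨hars.trans ht.1.le, ht.2.le⟩]
      simp only [if_neg (not_lt.2 ht.1.le), sub_zero]
      field_simp
      ring⟩
    pooling := fun t ht _ hbt => absurd ht.2 (not_lt.2 hbt.le) }

lemma isoValue_low (m : ℕ) {lam kl b : ℝ} (hk : kl ∈ Set.Ioo (0 : ℝ) 1) (hb : 0 < b) :
    isoValue m lam b (kl * b) 0 = lowValue (m + 1) lam kl b := by
  have h1 : (b - kl * b) / (b - 0) = 1 - kl := by
    rw [sub_zero, sub_div, mul_div_assoc, div_self hb.ne', mul_one]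
  have h2 : ∫ t in (kl * b)..b, ((t - kl * b) / (t - 0)) ^ (m + 1)
      = b * ∫ t in kl..1, (1 - kl / t) ^ (m + 1) := by
    have h3 := intervalIntegral.mul_integral_comp_mul_right (a := kl) (b := 1)
      (f := fun t => ((t - kl * b) / (t - 0)) ^ (m + 1)) b
    rw [one_mul] at h3
    rw [← h3]
    congr 1
    apply intervalIntegral.integral_congr
    intro t ht
    rw [Set.uIcc_of_le hk.2.le] at ht
    have ht0 : t ≠ 0 := by linarith [hk.1, ht.1]
    simp only
    congr 1
    rw [sub_zero, ← sub_mul, mul_div_mul_right _ _ hb.ne', sub_div, div_self ht0]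
  rw [isoValue, lowValue, h1, h2]
  ring

/-! ### High relative support information -/

lemma highThresholdCDF_eq (m : ℕ) (lam : ℝ) {a φ v : ℝ} (hφ : φ < a) (hv : a ≤ v) :
    highThresholdCDF (m + 1) lam a φ v
      = (m + 1) * lam / m * betaRatio (m + 1) ((v - a) / (v - φ)) := by
  rw [highThresholdCDF, integral_ratio_eq (m + 1) hφ le_rfl hv, betaRatio,
    ← inv_div (v - a) (v - φ), inv_pow]
  simp only [sub_self, zero_div, betaInt_zero, sub_zero]
  push_cast
  rw [add_sub_cancel_right]
  ring

/-- With `v* = a - 1` every threshold acts as a pooling threshold. -/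
lemma exists_highEqualizer {m : ℕ} (hm0 : m ≠ 0) {lam kh a b : ℝ} (hlam : 0 < lam)
    (hh : IsHighCutoff (m + 1) lam kh) (hab : a < b)
    (hφ0 : 0 ≤ (a - kh * b) / (1 - kh)) :
    ∃ (Ψ : Measure ℝ) (g' : ℝ → ℝ),
      IsLawWithCDF a b Ψ (highThresholdCDF (m + 1) lam a ((a - kh * b) / (1 - kh))) ∧
      IsEqualizer m lam a b a ((a - kh * b) / (1 - kh)) (a - 1) a Ψ g' := by
  have hk := hh.mem_Ioo hm0
  have hk1 : 0 < 1 - kh := by linarith [hk.2]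
  have hφ : (a - kh * b) / (1 - kh) < a := by
    rw [div_lt_iff₀ hk1]
    nlinarith [hk.1]
  have hq : (b - a) / (b - (a - kh * b) / (1 - kh)) = 1 - kh := by
    have : b - (a - kh * b) / (1 - kh) = (b - a) / (1 - kh) := by
      field_simp
      ring
    have hba : b - a ≠ 0 := by linarith
    rw [this]
    field_simp
  set φ := (a - kh * b) / (1 - kh)
  have hm' : (0 : ℝ) < m := by positivity
  have hGeq : Set.EqOn (highThresholdCDF (m + 1) lam a φ)
      (fun v => (m + 1) * lam / m * betaRatio (m + 1) ((v - a) / (v - φ))) (Set.Ici a) :=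
    fun v hv => highThresholdCDF_eq m lam hφ hv
  have hIcc : Set.Icc a b ⊆ Set.Ici a := Set.Icc_subset_Ici_self
  have hν : 0 ≤ (m + 1) * lam / m := by positivity
  have hc : ContinuousOn (highThresholdCDF (m + 1) lam a φ) (Set.Icc a b) :=
    ((continuousOn_const.mul (continuousOn_betaRatio_ratio (m + 1) hφ)).congr hGeq).mono hIcc
  have hm : MonotoneOn (highThresholdCDF (m + 1) lam a φ) (Set.Icc a b) := by
    intro s hs t ht hst
    rw [hGeq (hIcc hs), hGeq (hIcc ht)]
    exact mul_le_mul_of_nonneg_left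
      (monotoneOn_betaRatio_ratio (m + 1) hφ (hIcc hs) (hIcc ht) hst) hν
  have h0 : 0 ≤ highThresholdCDF (m + 1) lam a φ a := by
    rw [hGeq Set.self_mem_Ici]
    simp
  have h1 : highThresholdCDF (m + 1) lam a φ b = 1 := by
    rw [hGeq hab.le]
    have := (isHighCutoff_iff m hm0 hk).1 hh
    simp only [hq]
    rw [div_mul_eq_mul_div, mul_assoc, this]
    field_simp
  obtain ⟨Ψ, hΨ⟩ := exists_isLawWithCDF hab hc hm h0 h1
  set G := highThresholdCDF (m + 1) lam a φ with hG
  refine ⟨Ψ, fun t => (m + 1) * lam / m / (t - φ)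
    - ((m + 1 : ℕ) : ℝ) * (a - φ) / ((t - φ) * (t - a)) * G t, hΨ, ?_⟩
  exact {
    law := by
      refine hΨ.isThresholdLaw ⟨le_rfl, hab.le⟩ h1 hc fun t ht _ => ?_
      have hGt : ∀ y, a < y → G y = (0 + (m + 1) * lam / m
          * betaInt (m + 1) ((y - a) / (y - φ))) / ((y - a) / (y - φ)) ^ (m + 1) := by
        intro y hy
        rw [hGeq hy.le, ← betaRatio_eq_thresholdCDF]
      rw [hGt t ht.1]
      apply (hasDerivAt_thresholdCDF (m + 1) 0 ((m + 1) * lam / m) hφ ht.1).congr_of_eventuallyEq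
      filter_upwards [Ioi_mem_nhds ht.1] with y hy using hGt y hy
    vs_le := by linarith
    left_le := le_rfl
    lt_right := hab
    virtual_lt := hφ
    virtual_nonneg := hφ0
    below := fun t ht _ => absurd ht.1 (not_lt.2 ht.2.le)
    reserve := fun t ht _ hv => absurd ht.1 (by linarith)
    pooling := fun t ht _ _ => ⟨rfl, by
      have h2 : t - a ≠ 0 := by linarith [ht.1]
      have h3 : t - φ ≠ 0 := by linarith [ht.1]
      rw [hΨ.2.2 t ⟨ht.1.le, ht.2.le⟩]
      push_cast
      field_simp
      ring⟩ }

lemma isoValue_high (m : ℕ) {lam kh a b : ℝ} (hk : kh ∈ Set.Ioo (0 : ℝ) 1) (hab : a < b) :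
    isoValue m lam b a ((a - kh * b) / (1 - kh))
      = highValue (m + 1) lam kh (kh / (1 - kh)) a b := by
  have hk1 : 0 < 1 - kh := by linarith [hk.2]
  set k' := kh / (1 - kh) with hk'
  have hk'0 : 0 < k' := div_pos hk.1 hk1
  have hba : 0 < b - a := by linarith
  set φ := (a - kh * b) / (1 - kh) with hφ
  have hbφ : b - φ = (b - a) / (1 - kh) := by
    rw [hφ]
    field_simp
    ring
  have haφ : a - φ = (b - a) * k' := by
    rw [hφ, hk']
    field_simp
    ring
  have hq : (b - a) / (b - φ) = 1 - kh := by
    rw [hbφ]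
    field_simp
  have hpos : ∀ t ∈ Set.Icc (0 : ℝ) 1, 0 < t + k' := fun t ht => by linarith [ht.1]
  -- Both integrals are taken over `t ∈ [0, 1]`, where `v = a + (b - a) t`.
  have h2 : ∫ t in a..b, ((t - a) / (t - φ)) ^ (m + 1)
      = (b - a) * ∫ t in (0 : ℝ)..1, (t / (t + k')) ^ (m + 1) := by
    have h3 := intervalIntegral.mul_integral_comp_mul_add (a := 0) (b := 1)
      (f := fun t => ((t - a) / (t - φ)) ^ (m + 1)) (b - a) a
    rw [mul_zero, zero_add, mul_one, sub_add_cancel] at h3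
    rw [← h3]
    congr 1
    apply intervalIntegral.integral_congr
    intro t ht
    simp only
    have h4 : (b - a) * t + a - φ = (b - a) * (t + k') := by linarith
    rw [h4, add_sub_cancel_right, mul_div_mul_left _ _ hba.ne']
  have hder : ∀ t ∈ Set.Ioo (0 : ℝ) 1, HasDerivAt (fun t => k' * (t / (t + k')) ^ (m + 1))
      ((m + 1) * k' ^ 2 * t ^ m / (t + k') ^ (m + 2)) t := by
    intro t ht
    have h5 := (hpos t ⟨ht.1.le, ht.2.le⟩).ne'
    have := (((hasDerivAt_id t).div ((hasDerivAt_id t).add_const k') h5).pow (m + 1)).const_mul k'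
    refine this.congr_deriv ?_
    simp only [id, Nat.add_sub_cancel, Pi.div_apply, div_pow]
    push_cast
    field_simp
    ring
  have hcont : ContinuousOn (fun t : ℝ => t / (t + k')) (Set.Icc 0 1) :=
    continuousOn_id.div (by fun_prop) fun t ht => (hpos t ht).ne'
  have huIcc : Set.uIcc (0 : ℝ) 1 = Set.Icc 0 1 := Set.uIcc_of_le zero_le_one
  have hi1 : IntervalIntegrable (fun t : ℝ => (m + 1) * k' ^ 2 * t ^ m / (t + k') ^ (m + 2))
      volume 0 1 := by
    apply ContinuousOn.intervalIntegrable
    rw [huIcc]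
    exact ContinuousOn.div (by fun_prop) (by fun_prop) fun t ht => (pow_pos (hpos t ht) _).ne'
  have hi2 : IntervalIntegrable (fun t : ℝ => lam * (t / (t + k')) ^ (m + 1)) volume 0 1 := by
    apply ContinuousOn.intervalIntegrable
    rw [huIcc]
    exact continuousOn_const.mul (hcont.pow _)
  have hF := intervalIntegral.integral_eq_sub_of_hasDerivAt_of_le zero_le_one
    (continuousOn_const.mul (hcont.pow (m + 1))) hder hi1
  have hsplit : ∫ t in (0 : ℝ)..1, t ^ m * (((m : ℝ) + 1) * k' ^ 2 - lam * t * (t + k'))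
        / (t + k') ^ (m + 1 + 1)
      = k' * (1 / (1 + k')) ^ (m + 1) - lam * ∫ t in (0 : ℝ)..1, (t / (t + k')) ^ (m + 1) := by
    have h6 : ∫ t in (0 : ℝ)..1, t ^ m * (((m : ℝ) + 1) * k' ^ 2 - lam * t * (t + k'))
        / (t + k') ^ (m + 1 + 1) = ∫ t in (0 : ℝ)..1,
          ((m + 1) * k' ^ 2 * t ^ m / (t + k') ^ (m + 2) - lam * (t / (t + k')) ^ (m + 1)) := by
      apply intervalIntegral.integral_congr
      intro t ht
      rw [huIcc] at ht
      have h7 := (hpos t ht).ne'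
      simp only [div_pow]
      field_simp
      ring
    rw [h6, intervalIntegral.integral_sub hi1 hi2, hF, intervalIntegral.integral_const_mul]
    simp [← hk']
  have hk1' : 1 / (1 + k') = 1 - kh := by
    rw [hk']
    field_simp
    ring
  rw [isoValue, highValue, hq, h2, Nat.add_sub_cancel]
  push_cast
  rw [hsplit, hk1', hbφ, hk']
  field_simp
  ring

/-! ### Moderate relative support information -/

lemma unifiedCDF_one {lam a b vs v : ℝ} (ha : 0 < a) (hav : a ≤ v) (hab : a < b) :
    unifiedCDF 1 lam a b vs v
      = (1 - lam * betaInt 0 ((b - a) / b) + lam * betaInt 0 ((v - a) / (v - 0)))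
        / ((v - a) / (v - 0)) ^ 0 := by
  have hb : 0 < b := ha.trans hab
  have hv : 0 < v := ha.trans_le hav
  obtain ⟨-, h0, h1⟩ := relativeWidth ha hab
  have h2 := ratio_mem_Ico ha hav
  rw [unifiedCDF, if_pos rfl, betaInt_zero_eq h0.le h1, betaInt_zero_eq h2.1 h2.2,
    one_sub_ratio (by linarith), show 1 - (b - a) / b = a / b by field_simp; ring, sub_zero,
    sub_zero, Real.log_div hv.ne' hb.ne', Real.log_div ha.ne' hb.ne', Real.log_div ha.ne' hv.ne']
  ring

lemma unifiedCDF_of_le {m : ℕ} (hm : m ≠ 0) (lam b : ℝ) {a vs v : ℝ} (ha : 0 < a) (hav : a ≤ v)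
    (hv : v ≤ vs) :
    unifiedCDF (m + 1) lam a b vs v = lam * betaRatio m ((v - a) / (v - 0)) := by
  rw [unifiedCDF, if_neg (by omega), if_pos hv, Nat.add_sub_cancel,
    integral_ratio_zero_eq m ha le_rfl hav, betaRatio, ← inv_div (v - a) v, inv_pow]
  simp only [sub_self, zero_div, betaInt_zero, sub_zero]
  ring

lemma unifiedCDF_of_lt {m : ℕ} (hm : m ≠ 0) (lam : ℝ) {a b vs v : ℝ} (ha : 0 < a) (hav : a < v)
    (hv : vs < v) (hvb : v ≤ b) :
    unifiedCDF (m + 1) lam a b vs v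
      = (((b - a) / b) ^ (m + 1) - (m + 1) * lam / m * betaInt (m + 1) ((b - a) / b)
          + (m + 1) * lam / m * betaInt (m + 1) ((v - a) / (v - 0)))
        / ((v - a) / (v - 0)) ^ (m + 1) := by
  have hm' : (0 : ℝ) < m := by positivity
  have hm1 : (0 : ℝ) < m + 1 := by positivity
  have hw : (v - a) / v ≠ 0 := div_ne_zero (by linarith) (by linarith)
  rw [unifiedCDF, if_neg (by omega), if_neg (not_le.2 hv), Nat.add_sub_cancel,
    integral_pooling_integrand m lam ha hav.le hvb, ← inv_div (v - a) v, inv_pow, sub_zero]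
  push_cast
  rw [add_sub_cancel_right]
  generalize (v - a) / v = w at *
  field_simp
  ring

/-- The homogeneous part of the solution of the pooling equation. Its coefficient is `0` when the
pooling region reaches down to `a`, where the solution would otherwise be singular. -/
lemma monotoneOn_div_ratio_pow (k : ℕ) {κ a vs : ℝ} (ha : 0 < a) (hvs : a ≤ vs) (hκ : κ ≤ 0)
    (h0 : vs = a → κ = 0) :
    MonotoneOn (fun t => κ / ((t - a) / (t - 0)) ^ k) (Set.Ici vs) ∧
      ContinuousOn (fun t => κ / ((t - a) / (t - 0)) ^ k) (Set.Ici vs) := by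
  rcases hvs.eq_or_lt with rfl | hlt
  · simp [h0 rfl, monotoneOn_const, continuousOn_const]
  · have hpos : ∀ t ∈ Set.Ici vs, 0 < (t - a) / (t - 0) := by
      intro t ht
      have : vs ≤ t := ht
      exact div_pos (by linarith) (by linarith)
    have hsub : Set.Ici vs ⊆ Set.Ici a := Set.Ici_subset_Ici.2 hvs
    constructor
    · intro s hs t ht hst
      have h1 := hpos s hs
      have h2 := pow_le_pow_left₀ h1.le (monotoneOn_ratio ha (hsub hs) (hsub ht) hst) k
      have h3 : 0 < ((s - a) / (s - 0)) ^ k := pow_pos h1 k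
      simp only at h2 ⊢
      have h4 := div_le_div_of_nonneg_left (neg_nonneg.2 hκ) h3 h2
      rw [neg_div, neg_div] at h4
      linarith
    · exact continuousOn_const.div (((continuousOn_ratio ha).mono hsub).pow k)
        fun t ht => (pow_pos (hpos t ht) k).ne'

/-- For a single bidder the two equations leave no room for pooling. -/
lemma eq_right_of_pairDefect_zero {lam a b vs : ℝ} (hlam : 0 < lam) (ha : 0 < a) (hab : a < b)
    (hvs : vs ∈ Set.Icc a b) (h : pairDefect 0 lam ((b - a) / b) ((vs - a) / vs) = 0) :
    vs = b := by
  have hb : 0 < b := ha.trans hab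
  have hv : 0 < vs := ha.trans_le hvs.1
  obtain ⟨-, h0, h1⟩ := relativeWidth ha hab
  have hw := ratio_mem_Ico ha hvs.1
  rw [sub_zero] at hw
  have := (pairDefect_strictAntiOn 0 hlam ((b - a) / b)).injOn hw ⟨h0.le, h1⟩
    (h.trans (by simp [pairDefect]))
  rw [div_eq_div_iff hv.ne' hb.ne'] at this
  nlinarith

/-- Regularity of the threshold distribution: the reserve and the pooling solution agree at `v*`
because `v*` solves the remaining equation. -/
lemma unifiedCDF_regular {m : ℕ} (hm : m ≠ 0) {lam kh a b vs : ℝ} (hlam : 0 < lam)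
    (hh : IsHighCutoff (m + 1) lam kh) (ha : 0 < a) (hab : a < b)
    (h2 : a / b ≤ kh) (hvs : vs ∈ Set.Icc a b)
    (hT : pairDefect m lam ((b - a) / b) ((vs - a) / vs) = 0) :
    ContinuousOn (unifiedCDF (m + 1) lam a b vs) (Set.Icc a b) ∧
      MonotoneOn (unifiedCDF (m + 1) lam a b vs) (Set.Icc a b) ∧
      unifiedCDF (m + 1) lam a b vs b = 1 := by
  have hb : 0 < b := ha.trans hab
  obtain ⟨-, hq0, hq1⟩ := relativeWidth ha hab
  have hm' : (0 : ℝ) < m := by positivity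
  have hm1 : (0 : ℝ) < m + 1 := by positivity
  have hT0 := (hh.pairDefect_zero hlam ha hab h2).1
  set q := (b - a) / b with hq
  set ν := (m + 1) * lam / m with hν
  set κ := q ^ (m + 1) - ν * betaInt (m + 1) q with hκdef
  have hν0 : 0 ≤ ν := by positivity
  have hκT : ∀ w, pairDefect m lam q w
      = m * (lam * (w * betaInt m w) - (κ + ν * betaInt (m + 1) w)) := by
    intro w
    rw [pairDefect, hκdef, hν]
    field_simp
    ring
  have hκ : κ ≤ 0 := by
    rw [hκT, betaInt_zero, betaInt_zero] at hT0
    nlinarith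
  have hκ0 : vs = a → κ = 0 := by
    intro h
    rw [hκT, h, sub_self, zero_div, betaInt_zero, betaInt_zero] at hT
    rcases mul_eq_zero.1 hT with h3 | h3 <;> linarith
  set G₂ : ℝ → ℝ := fun t => κ / ((t - a) / (t - 0)) ^ (m + 1)
    + ν * betaRatio (m + 1) ((t - a) / (t - 0)) with hG₂
  have hG₂' : ∀ t, G₂ t = (κ + ν * betaInt (m + 1) ((t - a) / (t - 0)))
      / ((t - a) / (t - 0)) ^ (m + 1) := by
    intro t
    simp only [hG₂, betaRatio]
    ring
  have heq1 : Set.EqOn (unifiedCDF (m + 1) lam a b vs)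
      (fun t => lam * betaRatio m ((t - a) / (t - 0))) (Set.Icc a vs) :=
    fun t ht => unifiedCDF_of_le hm lam b ha ht.1 ht.2
  -- The two solutions agree at `v*`. If `v* = a`, both are `0` there, by `x / 0 = 0`.
  have hmatch : lam * betaRatio m ((vs - a) / (vs - 0)) = G₂ vs := by
    rw [hG₂']
    rcases hvs.1.eq_or_lt with h | h
    · simp [← h]
    · have hw : (vs - a) / (vs - 0) ≠ 0 := div_ne_zero (by linarith) (by linarith)
      rw [hκT] at hT
      rw [sub_zero] at hw ⊢
      have h3 := (mul_eq_zero.1 hT).resolve_left hm'.ne'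
      rw [betaRatio, ← sub_eq_zero.1 h3]
      generalize (vs - a) / vs = w at *
      field_simp
      ring
  have heq2 : Set.EqOn (unifiedCDF (m + 1) lam a b vs) G₂ (Set.Icc vs b) := by
    intro t ht
    rcases ht.1.eq_or_lt with h | h
    · rw [← h, unifiedCDF_of_le hm lam b ha hvs.1 le_rfl, hmatch]
    · rw [unifiedCDF_of_lt hm lam ha (hvs.1.trans_lt h) h ht.2, hG₂']
  obtain ⟨hκm, hκc⟩ := monotoneOn_div_ratio_pow (m + 1) ha hvs.1 hκ hκ0
  have hsub1 : Set.Icc a vs ⊆ Set.Ici a := Set.Icc_subset_Ici_self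
  have hsub2 : Set.Icc vs b ⊆ Set.Ici vs := Set.Icc_subset_Ici_self
  have hsub3 : Set.Icc vs b ⊆ Set.Ici a := hsub2.trans (Set.Ici_subset_Ici.2 hvs.1)
  rw [← Set.Icc_union_Icc_eq_Icc hvs.1 hvs.2]
  refine ⟨ContinuousOn.union_of_isClosed ?_ ?_ isClosed_Icc isClosed_Icc,
    MonotoneOn.union_right (c := vs) ?_ ?_ (isGreatest_Icc hvs.1) (isLeast_Icc hvs.2), ?_⟩
  · exact ((continuousOn_const.mul (continuousOn_betaRatio_ratio m ha)).mono hsub1).congr heq1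
  · exact ((hκc.mono hsub2).add (continuousOn_const.mul
      ((continuousOn_betaRatio_ratio (m + 1) ha).mono hsub3))).congr heq2
  · intro s hs t ht hst
    rw [heq1 hs, heq1 ht]
    exact mul_le_mul_of_nonneg_left
      (monotoneOn_betaRatio_ratio m ha (hsub1 hs) (hsub1 ht) hst) hlam.le
  · intro s hs t ht hst
    rw [heq2 hs, heq2 ht]
    exact add_le_add (hκm (hsub2 hs) (hsub2 ht) hst) (mul_le_mul_of_nonneg_left
      (monotoneOn_betaRatio_ratio (m + 1) ha (hsub3 hs) (hsub3 ht) hst) hν0)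
  · rw [heq2 ⟨hvs.2, le_rfl⟩, hG₂', sub_zero, ← hq, hκdef, sub_add_cancel]
    exact div_self (by positivity)

lemma exists_moderateEqualizer (m : ℕ) {lam kl kh a b vs : ℝ} (hlam : 0 < lam)
    (hl : IsLowCutoff (m + 1) lam kl) (hh : IsHighCutoff (m + 1) lam kh) (ha : 0 < a)
    (hab : a < b) (h1 : kl ≤ a / b) (h2 : a / b ≤ kh) (hvs : vs ∈ Set.Icc a b)
    (hT : pairDefect m lam ((b - a) / b) ((vs - a) / vs) = 0) :
    ∃ (D : Measure ℝ) (g' : ℝ → ℝ),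
      IsLawWithCDF a b D (unifiedCDF (m + 1) lam a b vs) ∧
      IsEqualizer m lam a b a 0 vs vs D g' := by
  have hb : 0 < b := ha.trans hab
  rcases eq_or_ne m 0 with rfl | hm
  · obtain rfl := eq_right_of_pairDefect_zero hlam ha hab hvs hT
    set b := vs
    have hq := relativeWidth ha hab
    have hIcc : Set.Icc a b ⊆ Set.Ici a := Set.Icc_subset_Ici_self
    have hGeq : Set.EqOn (unifiedCDF (0 + 1) lam a b b) (fun v => 1 - lam * betaInt 0 ((b - a) / b)
        + lam * betaRatio 0 ((v - a) / (v - 0))) (Set.Icc a b) := by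
      intro v hv
      rw [unifiedCDF_one ha hv.1 hab]
      simp [betaRatio]
    have hc : ContinuousOn (unifiedCDF (0 + 1) lam a b b) (Set.Icc a b) :=
      (continuousOn_const.add (continuousOn_const.mul
        ((continuousOn_betaRatio_ratio 0 ha).mono hIcc))).congr hGeq
    have hmono : MonotoneOn (unifiedCDF (0 + 1) lam a b b) (Set.Icc a b) := by
      intro s hs t ht hst
      rw [hGeq hs, hGeq ht]
      have := mul_le_mul_of_nonneg_left
        (monotoneOn_betaRatio_ratio 0 ha (hIcc hs) (hIcc ht) hst) hlam.le
      simp only at this ⊢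
      linarith
    have h0 : 0 ≤ unifiedCDF (0 + 1) lam a b b a := by
      rw [hGeq ⟨le_rfl, hab.le⟩]
      have := hl.mul_betaRatio_le_one hlam ha hab h1
      simp only [betaRatio, pow_zero, div_one] at this
      simp only [sub_self, zero_div, betaRatio_zero, mul_zero]
      linarith
    have hone : unifiedCDF (0 + 1) lam a b b b = 1 := by simp [unifiedCDF, hb.ne']
    obtain ⟨D, hD⟩ := exists_isLawWithCDF hab hc hmono h0 hone
    refine ⟨D, fun t => lam / (t - 0) - ((0 : ℕ) : ℝ) * (a - 0) / ((t - 0) * (t - a))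
      * unifiedCDF (0 + 1) lam a b b t, hD, ?_⟩
    exact {
      law := by
        refine hD.isThresholdLaw ⟨hab.le, le_rfl⟩ hone hc fun t ht _ => ?_
        rw [unifiedCDF_one ha ht.1.le hab]
        apply (hasDerivAt_thresholdCDF 0 _ lam ha ht.1).congr_of_eventuallyEq
        filter_upwards [Ioi_mem_nhds ht.1] with y hy
        exact unifiedCDF_one ha (le_of_lt hy) hab
      vs_le := le_rfl
      left_le := le_rfl
      lt_right := hab
      virtual_lt := ha
      virtual_nonneg := le_rfl
      below := fun t ht _ => absurd ht.1 (not_lt.2 ht.2.le)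
      reserve := fun t ht _ _ => ⟨rfl, by
        have h3 : t ≠ 0 := by linarith [ht.1]
        simp [mul_div_cancel₀ _ h3]⟩
      pooling := fun t ht _ hv => absurd ht.2 (not_lt.2 hv.le) }
  · obtain ⟨hc, hmono, hone⟩ := unifiedCDF_regular hm hlam hh ha hab h2 hvs hT
    have h0 : 0 ≤ unifiedCDF (m + 1) lam a b vs a := by
      rw [unifiedCDF_of_le hm lam b ha le_rfl hvs.1]
      simp
    obtain ⟨D, hD⟩ := exists_isLawWithCDF hab hc hmono h0 hone
    have hm' : (m : ℝ) ≠ 0 := by exact_mod_cast hm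
    set G := unifiedCDF (m + 1) lam a b vs with hG
    refine ⟨D, fun t => if t < vs
      then lam / (t - 0) - m * (a - 0) / ((t - 0) * (t - a)) * G t
      else (m + 1) * lam / m / (t - 0)
        - ((m + 1 : ℕ) : ℝ) * (a - 0) / ((t - 0) * (t - a)) * G t, hD, ?_⟩
    exact {
      law := by
        refine hD.isThresholdLaw hvs hone hc fun t ht hte => ?_
        rcases hte.lt_or_gt with hlt | hgt
        · have hGt : ∀ y, a < y → y < vs → G y = (0 + lam * betaInt m ((y - a) / (y - 0)))
              / ((y - a) / (y - 0)) ^ m := by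
            intro y hy hyv
            rw [hG, unifiedCDF_of_le hm lam b ha hy.le hyv.le, betaRatio_eq_thresholdCDF]
          rw [if_pos hlt, hGt t ht.1 hlt]
          apply (hasDerivAt_thresholdCDF m 0 lam ha ht.1).congr_of_eventuallyEq
          filter_upwards [Ioo_mem_nhds ht.1 hlt] with y hy using hGt y hy.1 hy.2
        · rw [if_neg (not_lt.2 hgt.le), hG, unifiedCDF_of_lt hm lam ha ht.1 hgt ht.2.le]
          apply (hasDerivAt_thresholdCDF (m + 1) _ _ ha ht.1).congr_of_eventuallyEq
          filter_upwards [Ioo_mem_nhds hgt ht.2] with y hy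
          exact unifiedCDF_of_lt hm lam ha (hvs.1.trans_lt hy.1) hy.1 hy.2.le
      vs_le := hvs.2
      left_le := le_rfl
      lt_right := hab
      virtual_lt := ha
      virtual_nonneg := le_rfl
      below := fun t ht _ => absurd ht.1 (not_lt.2 ht.2.le)
      reserve := fun t ht _ hv => ⟨rfl, by
        have h3 : t - a ≠ 0 := by linarith [ht.1]
        have h4 : t ≠ 0 := by linarith [ht.1]
        rw [hD.2.2 t ⟨ht.1.le, ht.2.le⟩]
        simp only [if_pos hv, sub_zero]
        field_simp
        ring⟩
      pooling := fun t ht _ hv => ⟨rfl, by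
        have h3 : t - a ≠ 0 := by linarith [ht.1]
        have h4 : t ≠ 0 := by linarith [ht.1]
        rw [hD.2.2 t ⟨ht.1.le, ht.2.le⟩]
        simp only [if_neg (not_lt.2 hv.le), sub_zero]
        push_cast
        field_simp
        ring⟩ }

lemma isoValue_moderate (m : ℕ) (lam : ℝ) {a b : ℝ} (ha : 0 < a) (hab : a < b) :
    isoValue m lam b a 0 = moderateValue (m + 1) lam a b := by
  have h : ∀ t, a ≤ t → (t - a) / (t - 0) = 1 - a / t := by
    intro t ht
    rw [sub_zero, sub_div, div_self (ha.trans_le ht).ne']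
  have hint : ∫ t in a..b, ((t - a) / (t - 0)) ^ (m + 1) = ∫ t in a..b, (1 - a / t) ^ (m + 1) := by
    apply intervalIntegral.integral_congr
    intro t ht
    rw [Set.uIcc_of_le hab.le] at ht
    simp only [h t ht.1]
  rw [isoValue, moderateValue, hint, h b hab.le, sub_zero]

/-! ### The worst-case laws -/

lemma isLawWithCDF_isorevenue {a b rs : ℝ} (hars : a ≤ rs) (hrs : 0 < rs) (hrsb : rs < b) :
    IsLawWithCDF a b (isoLaw rs b 0) (isorevenueCDF b rs) := by
  obtain ⟨h1, h2, h3⟩ := isLawWithCDF_isoLaw hars hrsb hrs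
  refine ⟨h1, h2, fun v hv => (h3 v hv).trans ?_⟩
  unfold isorevenueCDF
  simp only
  split_ifs with h4 h5
  · rfl
  · rw [sub_zero, sub_div, div_self (by linarith)]
  · rfl

lemma isLawWithCDF_constVirtual {a b φ : ℝ} (hab : a < b) (hφ : φ < a) :
    IsLawWithCDF a b (isoLaw a b φ) (constVirtualCDF a b φ) := by
  obtain ⟨h1, h2, h3⟩ := isLawWithCDF_isoLaw le_rfl hab hφ
  refine ⟨h1, h2, fun v hv => (h3 v hv).trans ?_⟩
  unfold constVirtualCDF
  simp only
  rw [if_neg (not_lt.2 hv.1), ← one_sub_ratio (by linarith [hv.1]), sub_sub_cancel]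

end RobustAuction

end

theorem mainTheorem1 (n : ℕ) (hn : 1 ≤ n) (lam : ℝ) (hlam0 : 0 < lam) (hlam1 : lam ≤ 1) :
    ∃ kl kh : ℝ,
      RobustAuction.IsLowCutoff n lam kl ∧
      (∀ k, RobustAuction.IsLowCutoff n lam k → k = kl) ∧
      RobustAuction.IsHighCutoff n lam kh ∧
      (∀ k, RobustAuction.IsHighCutoff n lam k → k = kh) ∧
      kl < kh ∧
      ∀ a b : ℝ, 0 ≤ a → a < b →
        -- low relative support information
        (a / b ≤ kl →
          (∃ Φ F : MeasureTheory.Measure ℝ,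
            RobustAuction.IsLawWithCDF a b Φ (RobustAuction.lowReserveCDF n lam (kl * b)) ∧
            RobustAuction.IsLawWithCDF a b F (RobustAuction.isorevenueCDF b (kl * b)) ∧
            RobustAuction.IsSaddlePoint n lam a b
              (RobustAuction.randomSpa n a Φ) (MeasureTheory.Measure.pi fun _ : Fin n => F)) ∧
          RobustAuction.minimaxRegret n lam a b
            = ((RobustAuction.lowValue n lam kl b : ℝ) : EReal)) ∧
        -- high relative support information
        (kh ≤ a / b →
          (a - kh * b) / (1 - kh) ∈ Set.Icc 0 a ∧
          (∃ Ψ F : MeasureTheory.Measure ℝ,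
            RobustAuction.IsLawWithCDF a b Ψ
              (RobustAuction.highThresholdCDF n lam a ((a - kh * b) / (1 - kh))) ∧
            RobustAuction.IsLawWithCDF a b F
              (RobustAuction.constVirtualCDF a b ((a - kh * b) / (1 - kh))) ∧
            RobustAuction.IsSaddlePoint n lam a b
              (RobustAuction.randomPool n a Ψ) (MeasureTheory.Measure.pi fun _ : Fin n => F)) ∧
          RobustAuction.minimaxRegret n lam a b
            = ((RobustAuction.highValue n lam kh (kh / (1 - kh)) a b : ℝ) : EReal)) ∧
        -- moderate relative support information
        (kl ≤ a / b → a / b ≤ kh →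
          (∃ vs α : ℝ,
            RobustAuction.IsModeratePair n lam a b vs α ∧
            α ∈ Set.Icc 0 (1 / (n : ℝ)) ∧
            (∀ vs' α', RobustAuction.IsModeratePair n lam a b vs' α' →
              vs' = vs ∧ (a / b < kh → α' = α)) ∧
            ∃ D F : MeasureTheory.Measure ℝ,
              RobustAuction.IsLawWithCDF a b D (RobustAuction.unifiedCDF n lam a b vs) ∧
              RobustAuction.IsLawWithCDF a b F (RobustAuction.isorevenueCDF b a) ∧
              RobustAuction.IsSaddlePoint n lam a b
                (RobustAuction.unified n a vs D)
                (MeasureTheory.Measure.pi fun _ : Fin n => F)) ∧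
          RobustAuction.minimaxRegret n lam a b
            = ((RobustAuction.moderateValue n lam a b : ℝ) : EReal)) := by
  obtain ⟨m, rfl⟩ : ∃ m, n = m + 1 := ⟨n - 1, by omega⟩
  obtain ⟨kl, hl, hlu⟩ := RobustAuction.exists_lowCutoff m hlam0
  obtain ⟨kh, hh, hhu⟩ := RobustAuction.exists_highCutoff m hlam0
  refine ⟨kl, kh, hl, hlu, hh, hhu, RobustAuction.lowCutoff_lt_highCutoff m hlam0 hlam1 hl hh,
    fun a b ha hab => ?_⟩
  have hb : 0 < b := ha.trans_lt hab
  refine ⟨fun h => ?_, fun h => ?_, fun h1 h2 => ?_⟩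
  · obtain ⟨Φ, g', hΦ, hE⟩ := RobustAuction.exists_lowEqualizer m hlam0 hl ha hab h
    obtain ⟨hs, hv⟩ := hE.isSaddlePoint hlam0.le
    have := hΦ.1
    rw [← RobustAuction.randomSpa_eq_unified Φ hΦ.2.1] at hs
    exact ⟨⟨Φ, RobustAuction.isoLaw (kl * b) b 0, hΦ,
      RobustAuction.isLawWithCDF_isorevenue hE.left_le hE.virtual_lt hE.lt_right, hs⟩,
      hv.trans (congrArg _ (RobustAuction.isoValue_low m hl.1 hb))⟩
  · have hm : m ≠ 0 := by
      rintro rfl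
      have hk : kh = 1 := by simpa [RobustAuction.IsHighCutoff] using hh
      rw [hk, one_le_div hb] at h
      exact absurd hab (not_lt.2 h)
    have hk := hh.mem_Ioo hm
    have hk1 : 0 < 1 - kh := by linarith [hk.2]
    have h0 : 0 ≤ (a - kh * b) / (1 - kh) :=
      div_nonneg (by linarith [(le_div_iff₀ hb).1 h]) hk1.le
    obtain ⟨Ψ, g', hΨ, hE⟩ := RobustAuction.exists_highEqualizer hm hlam0 hh hab h0
    obtain ⟨hs, hv⟩ := hE.isSaddlePoint hlam0.le
    have := hΨ.1
    rw [← RobustAuction.randomPool_eq_unified Ψ (sub_one_lt a) hΨ.2.1] at hs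
    exact ⟨⟨h0, hE.virtual_lt.le⟩, ⟨Ψ, RobustAuction.isoLaw a b _, hΨ,
      RobustAuction.isLawWithCDF_constVirtual hab hE.virtual_lt, hs⟩,
      hv.trans (congrArg _ (RobustAuction.isoValue_high m hk hab))⟩
  · have ha0 : 0 < a := by
      have := (le_div_iff₀ hb).1 h1
      have := mul_pos hl.1.1 hb
      linarith
    obtain ⟨vs, α, hp, hα, hu, hT⟩ :=
      RobustAuction.exists_moderatePair m hlam0 hl hh hab ha0 h1 h2
    obtain ⟨D, g', hD, hE⟩ :=
      RobustAuction.exists_moderateEqualizer m hlam0 hl hh ha0 hab h1 h2 hp.1 hT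
    obtain ⟨hs, hv⟩ := hE.isSaddlePoint hlam0.le
    exact ⟨⟨vs, α, hp, by simpa only [Nat.cast_add, Nat.cast_one] using hα, hu, D,
      RobustAuction.isoLaw a b 0, hD, RobustAuction.isLawWithCDF_isorevenue le_rfl ha0 hab, hs⟩,
      hv.trans (congrArg _ (RobustAuction.isoValue_moderate m lam ha0 hab))⟩
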